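/- Let $P$ be a set of $n\ge 1$ points in an axis-aligned rectangle $R$, no two sharing an $x$- or a $y$-coordinate, each point $p$ having a color $c(p)$ from a finite set $C$, and let $\Delta>0$. A *labeling with finite backbones* consists of finitely many labels on the right side of $R$, each with a color and a height $y(l)$ in the vertical range of $R$, and a map assigning every point $p$ to a label of color $c(p)$, so that each label is assigned at least one point. The leader of a label $l$ consists of its backbone, i.e. the horizontal segment at height $y(l)$ from the right side of $R$ to the $x$-coordinate of the leftmost point assigned to $l$, and of the vertical segments joining the points assigned to $l$ to the backbone. The labeling is *crossing-free* if leaders of different labels are disjoint. It has *minimum separation* $\Delta$ if any two backbones have vertical distance at least $\Delta$, and each backbone has vertical distance at least $\Delta$ from every point not assigned to its label (alternatively: from every such point that is not to the left of the left end of the backbone). The *total leader length* is the sum of the lengths of all vertical segments and all backbones (alternatively: of all vertical segments only). The labeling is *feasible* for a label bound $K\ge 1$ if it has at most $K$ labels in total, and feasible for a color vector $(k_c)_{c\in C}$ of integers $k_c\ge 1$ if it has at most $k_c$ labels of each color $c$. For each choice among these alternatives the following holds on a real RAM (natural and real numbers, indirect addressing, additions, subtractions and comparisons at unit cost). 1.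 There is an algorithm that, given $P$, $R$, $C$, $\Delta$ and a label bound $K$, takes $O(n^7|C|^2K^2)$ time and computes a crossing-free labeling of $P$ with finite backbones and minimum separation $\Delta$ that is feasible for $K$ and has minimum total leader length among all such labelings, or reports that there is no such labeling. 2. There is an algorithm that, given $P$, $R$, $C$, $\Delta$ and a color vector $(k_c)_{c\in C}$, takes $O\bigl(n^7|C|^2(\prod_{c\in C}k_c)^2\bigr)$ time and computes a crossing-free labeling of $P$ with finite backbones and minimum separation $\Delta$ that is feasible for $(k_c)$ and has minimum total leader length among all such labelings, or reports that there is no such labeling. -/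

import Mathlib

open scoped BigOperators

namespace BackboneLabeling

/-! ### The geometric problem -/

/-- `n` colored points in an axis-aligned rectangle, with colors from a set of `C` colors,
no two points sharing an `x`- or a `y`-coordinate. -/
structure PointSet (n C : ℕ) where
  left : ℝ
  right : ℝ
  bottom : ℝ
  top : ℝ
  x : Fin n → ℝ
  y : Fin n → ℝ
  color : Fin n → Fin C
  x_mem : ∀ i, x i ∈ Set.Icc left right
  y_mem : ∀ i, y i ∈ Set.Icc bottom top
  x_inj : Function.Injective x
  y_inj : Function.Injective y

/-- A finite set of colored labels, each given by the `y`-coordinate of its backbone, together with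
a map from the points to the labels. A finite backbone ends at a point that is connected to it,
so each label has at least one point. -/
structure Labeling (n C : ℕ) where
  numLabels : ℕ
  color : Fin numLabels → Fin C
  y : Fin numLabels → ℝ
  assign : Fin n → Fin numLabels
  assign_surj : Function.Surjective assign

namespace Labeling

variable {n C : ℕ}

/-- The `x`-coordinate of the left end of the finite backbone of `l`, which is attached to the right
side of the rectangle: that of the leftmost point connected to `l`. -/
noncomputable def leftEnd (L : Labeling n C) (P : PointSet n C) (l : Fin L.numLabels) : ℝ :=
  sInf (P.x '' {p | L.assign p = l})

/-- The finite horizontal backbone of `l`. -/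
def backbone (L : Labeling n C) (P : PointSet n C) (l : Fin L.numLabels) : Set (ℝ × ℝ) :=
  Set.Icc (L.leftEnd P l) P.right ×ˢ {L.y l}

/-- The vertical segment that connects the point `p` to the backbone of its label. -/
def connection (L : Labeling n C) (P : PointSet n C) (p : Fin n) : Set (ℝ × ℝ) :=
  {P.x p} ×ˢ Set.uIcc (P.y p) (L.y (L.assign p))

/-- The backbone leader of `l`: its backbone and the vertical segments of its points. -/
def leader (L : Labeling n C) (P : PointSet n C) (l : Fin L.numLabels) : Set (ℝ × ℝ) :=
  L.backbone P l ∪ ⋃ p ∈ {p | L.assign p = l}, L.connection P p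

/-- Leaders of different labels neither cross nor overlap. -/
def CrossingFree (L : Labeling n C) (P : PointSet n C) : Prop :=
  ∀ l l', l ≠ l' → Disjoint (L.leader P l) (L.leader P l')

end Labeling

/-- To which of the points that are not connected to it a backbone has to keep its distance:
to all of them, or to those that the backbone passes above or below. -/
inductive Clearance
  | allPoints
  | alongBackbone

/-- Whether the horizontal lengths of the backbones count. -/
inductive Objective
  | withBackbones
  | withoutBackbones

namespace Labeling

variable {n C : ℕ}

/-- Minimum separation `Δ` between any two backbones, and between a backbone and a point that is not
connected to it. -/
def Separated (L : Labeling n C) (P : PointSet n C) (cl : Clearance) (Δ : ℝ) : Prop :=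
  (∀ l l', l ≠ l' → Δ ≤ |L.y l - L.y l'|) ∧
  ∀ l p, L.assign p ≠ l →
    (match cl with
      | .allPoints => True
      | .alongBackbone => L.leftEnd P l ≤ P.x p) →
    Δ ≤ |P.y p - L.y l|

/-- A crossing-free legal labeling with labels on the right side of the rectangle and minimum
separation `Δ`. -/
structure Valid (L : Labeling n C) (P : PointSet n C) (cl : Clearance) (Δ : ℝ) : Prop where
  color_eq : ∀ p, L.color (L.assign p) = P.color p
  on_boundary : ∀ l, L.y l ∈ Set.Icc P.bottom P.top
  crossingFree : L.CrossingFree P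
  separated : L.Separated P cl Δ

/-- The number of labels of color `c`. -/
def numOfColor (L : Labeling n C) (c : Fin C) : ℕ :=
  (Finset.univ.filter fun l => L.color l = c).card

/-- Feasibility under a global bound `K` on the number of labels. -/
def FeasibleGlobal (L : Labeling n C) (P : PointSet n C) (cl : Clearance) (Δ : ℝ) (K : ℕ) : Prop :=
  L.Valid P cl Δ ∧ L.numLabels ≤ K

/-- Feasibility under a color vector `k`. -/
def FeasibleVector (L : Labeling n C) (P : PointSet n C) (cl : Clearance) (Δ : ℝ)
    (k : Fin C → ℕ) : Prop :=
  L.Valid P cl Δ ∧ ∀ c, L.numOfColor c ≤ k c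

/-- The total leader length. -/
noncomputable def totalLength (L : Labeling n C) (P : PointSet n C) : Objective → ℝ
  | .withBackbones =>
      ∑ p, |P.y p - L.y (L.assign p)| + ∑ l, (P.right - L.leftEnd P l)
  | .withoutBackbones => ∑ p, |P.y p - L.y (L.assign p)|

end Labeling

/-! ### The machine model

Programs for a random access machine with natural numbers and exact real numbers (a real RAM).
A program uses finitely many variables and unbounded arrays of either sort. Each elementary
operation (constant, access to a variable or array cell, addition, subtraction, comparison,
connective, assignment, jump) takes one step. There is no multiplication, division or rounding. -/

/-- Contents of the variables and arrays. -/
structure Store where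
  natVar : ℕ → ℕ
  realVar : ℕ → ℝ
  natArr : ℕ → ℕ → ℕ
  realArr : ℕ → ℕ → ℝ

/-- Expressions with values in `ℕ`; subtraction is truncated. -/
inductive NatExp
  | const (k : ℕ)
  | var (v : ℕ)
  | cell (a : ℕ) (i : NatExp)
  | add (e f : NatExp)
  | sub (e f : NatExp)

/-- Expressions with values in `ℝ`. -/
inductive RealExp
  | zero
  | var (v : ℕ)
  | cell (a : ℕ) (i : NatExp)
  | add (e f : RealExp)
  | sub (e f : RealExp)

/-- Tests. -/
inductive Test
  | natLT (e f : NatExp)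
  | realLT (e f : RealExp)
  | neg (b : Test)
  | conj (b b' : Test)

namespace NatExp

def eval (s : Store) : NatExp → ℕ
  | const k => k
  | var v => s.natVar v
  | cell a i => s.natArr a (i.eval s)
  | add e f => e.eval s + f.eval s
  | sub e f => e.eval s - f.eval s

/-- Number of elementary operations in one evaluation. -/
def cost : NatExp → ℕ
  | const _ => 1
  | var _ => 1
  | cell _ i => i.cost + 1
  | add e f => e.cost + f.cost + 1
  | sub e f => e.cost + f.cost + 1

end NatExp

namespace RealExp

noncomputable def eval (s : Store) : RealExp → ℝ
  | zero => 0
  | var v => s.realVar v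
  | cell a i => s.realArr a (i.eval s)
  | add e f => e.eval s + f.eval s
  | sub e f => e.eval s - f.eval s

/-- Number of elementary operations in one evaluation. -/
def cost : RealExp → ℕ
  | zero => 1
  | var _ => 1
  | cell _ i => i.cost + 1
  | add e f => e.cost + f.cost + 1
  | sub e f => e.cost + f.cost + 1

end RealExp

namespace Test

def Holds (s : Store) : Test → Prop
  | natLT e f => e.eval s < f.eval s
  | realLT e f => e.eval s < f.eval s
  | neg b => ¬ b.Holds s
  | conj b b' => b.Holds s ∧ b'.Holds s

/-- Number of elementary operations in one evaluation. -/
def cost : Test → ℕ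
  | natLT e f => e.cost + f.cost + 1
  | realLT e f => e.cost + f.cost + 1
  | neg b => b.cost + 1
  | conj b b' => b.cost + b'.cost + 1

end Test

/-- Programs. -/
inductive Program
  | skip
  | setNat (v : ℕ) (e : NatExp)
  | setReal (v : ℕ) (e : RealExp)
  | storeNat (a : ℕ) (i e : NatExp)
  | storeReal (a : ℕ) (i : NatExp) (e : RealExp)
  | seq (p q : Program)
  | ite (b : Test) (p q : Program)
  | loop (b : Test) (p : Program)

namespace Store

def setNat (s : Store) (v w : ℕ) : Store :=
  { s with natVar := Function.update s.natVar v w }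

noncomputable def setReal (s : Store) (v : ℕ) (w : ℝ) : Store :=
  { s with realVar := Function.update s.realVar v w }

def storeNat (s : Store) (a i w : ℕ) : Store :=
  { s with natArr := Function.update s.natArr a (Function.update (s.natArr a) i w) }

noncomputable def storeReal (s : Store) (a i : ℕ) (w : ℝ) : Store :=
  { s with realArr := Function.update s.realArr a (Function.update (s.realArr a) i w) }

end Store

/-- `Runs p s s' t`: the program `p`, started in `s`, halts in `s'` after exactly `t` steps.
`Program.loop b p` repeats `p` while `b` holds. -/
inductive Runs : Program → Store → Store → ℕ → Prop
  | skip (s) : Runs .skip s s 1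
  | setNat (s v e) : Runs (.setNat v e) s (s.setNat v (e.eval s)) (e.cost + 1)
  | setReal (s v e) : Runs (.setReal v e) s (s.setReal v (e.eval s)) (e.cost + 1)
  | storeNat (s a i e) :
      Runs (.storeNat a i e) s (s.storeNat a (i.eval s) (e.eval s)) (i.cost + e.cost + 1)
  | storeReal (s a i e) :
      Runs (.storeReal a i e) s (s.storeReal a (i.eval s) (e.eval s)) (i.cost + e.cost + 1)
  | seq {p q s s' s'' t t'} : Runs p s s' t → Runs q s' s'' t' → Runs (.seq p q) s s'' (t + t')
  | iteTrue {b p q s s' t} : b.Holds s → Runs p s s' t → Runs (.ite b p q) s s' (b.cost + t + 1)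
  | iteFalse {b p q s s' t} : ¬ b.Holds s → Runs q s s' t → Runs (.ite b p q) s s' (b.cost + t + 1)
  | loopTrue {b p s s' s'' t t'} : b.Holds s → Runs p s s' t → Runs (.loop b p) s' s'' t' →
      Runs (.loop b p) s s'' (b.cost + t + t' + 1)
  | loopFalse {b p s} : ¬ b.Holds s → Runs (.loop b p) s s (b.cost + 1)

/-! ### Input and output -/

/-- A finite sequence as the contents of an array, padded with zeros. -/
def toArray {α : Type} [Zero α] {n : ℕ} (f : Fin n → α) (i : ℕ) : α :=
  if h : i < n then f ⟨i, h⟩ else 0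

/-- The initial store: the natural number variables hold `n`, `C`, `K`, the real variables hold `Δ`
and the sides of the rectangle, the arrays hold the colors of the points, the color vector and the
coordinates of the points. Everything else is zero. -/
noncomputable def inputStore {n C : ℕ} (P : PointSet n C) (Δ : ℝ) (K : ℕ) (k : Fin C → ℕ) :
    Store where
  natVar := toArray ![n, C, K]
  realVar := toArray ![Δ, P.left, P.right, P.bottom, P.top]
  natArr := toArray ![toArray fun p => (P.color p : ℕ), toArray k]
  realArr := toArray ![toArray P.x, toArray P.y]

/-- The store describes the labeling `L`: the number of labels, the color and the `y`-coordinate of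
each label and the label of each point. -/
def Describes {n C : ℕ} (s : Store) (L : Labeling n C) : Prop :=
  s.natVar 1 = L.numLabels ∧
  (∀ l : Fin L.numLabels, s.natArr 0 (l : ℕ) = (L.color l : ℕ)) ∧
  (∀ l : Fin L.numLabels, s.realArr 0 (l : ℕ) = L.y l) ∧
  ∀ p : Fin n, s.natArr 1 (p : ℕ) = (L.assign p : ℕ)

/-- The output of the minimization of `len` over the labelings that satisfy `Feas`:
the answer `1` and a minimizer, or the answer `0` if there is no feasible labeling. -/
def IsMinimizationOutput {n C : ℕ} (Feas : Labeling n C → Prop) (len : Labeling n C → ℝ)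
    (s : Store) : Prop :=
  (s.natVar 0 = 1 ∧ ∃ L, Describes s L ∧ Feas L ∧ ∀ L', Feas L' → len L ≤ len L') ∨
  (s.natVar 0 = 0 ∧ ∀ L, ¬ Feas L)

end BackboneLabeling

namespace BackboneLabeling

/-! ### Reasoning about programs -/

infixr:60 " ;; " => Program.seq

/-- `p`, started in `s`, halts within `T` steps in a store that satisfies `Q`. -/
def RunsWithin (p : Program) (s : Store) (T : ℕ) (Q : Store → Prop) : Prop :=
  ∃ s' t, Runs p s s' t ∧ t ≤ T ∧ Q s'

/-- All variables and arrays with an index below `N` have the same contents in `s` and `s'`. -/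
structure AgreeBelow (N : ℕ) (s s' : Store) : Prop where
  natVar : ∀ v, v < N → s'.natVar v = s.natVar v
  realVar : ∀ v, v < N → s'.realVar v = s.realVar v
  natArr : ∀ a, a < N → s'.natArr a = s.natArr a
  realArr : ∀ a, a < N → s'.realArr a = s.realArr a

namespace AgreeBelow

variable {N N' : ℕ} {s s' s'' : Store}

theorem refl (N : ℕ) (s : Store) : AgreeBelow N s s :=
  ⟨fun _ _ => rfl, fun _ _ => rfl, fun _ _ => rfl, fun _ _ => rfl⟩

theorem trans (h : AgreeBelow N s s') (h' : AgreeBelow N s' s'') : AgreeBelow N s s'' :=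
  ⟨fun v hv => (h'.natVar v hv).trans (h.natVar v hv),
    fun v hv => (h'.realVar v hv).trans (h.realVar v hv),
    fun v hv => (h'.natArr v hv).trans (h.natArr v hv),
    fun v hv => (h'.realArr v hv).trans (h.realArr v hv)⟩

theorem mono (h : AgreeBelow N s s') (hN : N' ≤ N) : AgreeBelow N' s s' :=
  ⟨fun v hv => h.natVar v (hv.trans_le hN), fun v hv => h.realVar v (hv.trans_le hN),
    fun v hv => h.natArr v (hv.trans_le hN), fun v hv => h.realArr v (hv.trans_le hN)⟩

theorem setNat {v w : ℕ} (hv : N ≤ v) : AgreeBelow N s (s.setNat v w) :=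
  ⟨fun u hu => Function.update_of_ne (by omega) _ _, fun _ _ => rfl, fun _ _ => rfl, fun _ _ => rfl⟩

theorem setReal {v : ℕ} {w : ℝ} (hv : N ≤ v) : AgreeBelow N s (s.setReal v w) :=
  ⟨fun _ _ => rfl, fun u hu => Function.update_of_ne (by omega) _ _, fun _ _ => rfl, fun _ _ => rfl⟩

theorem storeNat {a i w : ℕ} (ha : N ≤ a) : AgreeBelow N s (s.storeNat a i w) :=
  ⟨fun _ _ => rfl, fun _ _ => rfl, fun u hu => Function.update_of_ne (by omega) _ _, fun _ _ => rfl⟩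

theorem storeReal {a i : ℕ} {w : ℝ} (ha : N ≤ a) : AgreeBelow N s (s.storeReal a i w) :=
  ⟨fun _ _ => rfl, fun _ _ => rfl, fun _ _ => rfl, fun u hu => Function.update_of_ne (by omega) _ _⟩

end AgreeBelow

namespace Program

/-- The program writes only to variables and arrays with an index of at least `N`. -/
def above (N : ℕ) : Program → Bool
  | skip => true
  | setNat v _ => Nat.ble N v
  | setReal v _ => Nat.ble N v
  | storeNat a _ _ => Nat.ble N a
  | storeReal a _ _ => Nat.ble N a
  | seq p q => p.above N && q.above N
  | ite _ p q => p.above N && q.above N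
  | loop _ p => p.above N

def loopFree : Program → Bool
  | seq p q => p.loopFree && q.loopFree
  | ite _ p q => p.loopFree && q.loopFree
  | loop _ _ => false
  | _ => true

/-- A bound on the running time of a loop-free program. -/
def maxCost : Program → ℕ
  | skip => 1
  | setNat _ e => e.cost + 1
  | setReal _ e => e.cost + 1
  | storeNat _ i e => i.cost + e.cost + 1
  | storeReal _ i e => i.cost + e.cost + 1
  | seq p q => p.maxCost + q.maxCost
  | ite b p q => b.cost + (p.maxCost + q.maxCost) + 1
  | loop _ _ => 0

open Classical in
/-- The final store of a loop-free program. -/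
noncomputable def run : Program → Store → Store
  | skip, s => s
  | setNat v e, s => s.setNat v (e.eval s)
  | setReal v e, s => s.setReal v (e.eval s)
  | storeNat a i e, s => s.storeNat a (i.eval s) (e.eval s)
  | storeReal a i e, s => s.storeReal a (i.eval s) (e.eval s)
  | seq p q, s => q.run (p.run s)
  | ite b p q, s => if b.Holds s then p.run s else q.run s
  | loop _ _, s => s

/-- `body` for the values `0, 1, …` of the variable `v` below the value of the variable `w`. -/
def forUp (v w : ℕ) (body : Program) : Program :=
  .setNat v (.const 0) ;;
  .loop (.natLT (.var v) (.var w)) (body ;; .setNat v (.add (.var v) (.const 1)))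

end Program

theorem Runs.agreeBelow {p : Program} {s s' : Store} {t N : ℕ} (h : Runs p s s' t)
    (hp : p.above N = true) : AgreeBelow N s s' := by
  induction h with
  | skip s => exact .refl _ _
  | setNat s v e => exact .setNat (Nat.le_of_ble_eq_true hp)
  | setReal s v e => exact .setReal (Nat.le_of_ble_eq_true hp)
  | storeNat s a i e => exact .storeNat (Nat.le_of_ble_eq_true hp)
  | storeReal s a i e => exact .storeReal (Nat.le_of_ble_eq_true hp)
  | seq _ _ ih ih' =>
    simp only [Program.above, Bool.and_eq_true] at hp
    exact (ih hp.1).trans (ih' hp.2)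
  | iteTrue _ _ ih =>
    simp only [Program.above, Bool.and_eq_true] at hp
    exact ih hp.1
  | iteFalse _ _ ih =>
    simp only [Program.above, Bool.and_eq_true] at hp
    exact ih hp.2
  | loopTrue _ _ _ ih ih' => exact (ih hp).trans (ih' hp)
  | loopFalse _ => exact .refl _ _

namespace RunsWithin

variable {p q body : Program} {s : Store} {T T' N : ℕ} {Q Q' : Store → Prop}

theorem mono (h : RunsWithin p s T Q) (hT : T ≤ T') (hQ : ∀ s', Q s' → Q' s') :
    RunsWithin p s T' Q' := by
  obtain ⟨s', t, hr, ht, hq⟩ := h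
  exact ⟨s', t, hr, ht.trans hT, hQ s' hq⟩

theorem mono_time (h : RunsWithin p s T Q) (hT : T ≤ T') : RunsWithin p s T' Q :=
  h.mono hT fun _ => id

theorem frame (h : RunsWithin p s T Q) (hp : p.above N = true) :
    RunsWithin p s T fun s' => AgreeBelow N s s' ∧ Q s' := by
  obtain ⟨s', t, hr, ht, hq⟩ := h
  exact ⟨s', t, hr, ht, hr.agreeBelow hp, hq⟩

theorem seq (h : RunsWithin p s T fun s' => RunsWithin q s' T' Q) :
    RunsWithin (p ;; q) s (T + T') Q := by
  obtain ⟨s', t, hr, ht, s'', t', hr', ht', hq⟩ := h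
  exact ⟨s'', t + t', .seq hr hr', by omega, hq⟩

theorem ite {b : Test} (h : b.Holds s → RunsWithin p s T Q)
    (h' : ¬ b.Holds s → RunsWithin q s T Q) :
    RunsWithin (.ite b p q) s (b.cost + T + 1) Q := by
  by_cases hb : b.Holds s
  · obtain ⟨s', t, hr, ht, hq⟩ := h hb
    exact ⟨s', _, .iteTrue hb hr, by omega, hq⟩
  · obtain ⟨s', t, hr, ht, hq⟩ := h' hb
    exact ⟨s', _, .iteFalse hb hr, by omega, hq⟩

theorem of_loopFree (h : p.loopFree = true) (hT : p.maxCost ≤ T) (hQ : Q (p.run s)) :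
    RunsWithin p s T Q := by
  suffices ∀ s, ∃ t, Runs p s (p.run s) t ∧ t ≤ p.maxCost by
    obtain ⟨t, hr, ht⟩ := this s
    exact ⟨_, t, hr, ht.trans hT, hQ⟩
  clear hQ hT
  induction p with
  | skip => exact fun s => ⟨_, .skip s, le_rfl⟩
  | setNat v e => exact fun s => ⟨_, .setNat s v e, le_rfl⟩
  | setReal v e => exact fun s => ⟨_, .setReal s v e, le_rfl⟩
  | storeNat a i e => exact fun s => ⟨_, .storeNat s a i e, le_rfl⟩
  | storeReal a i e => exact fun s => ⟨_, .storeReal s a i e, le_rfl⟩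
  | seq p q ihp ihq =>
    simp only [Program.loopFree, Bool.and_eq_true] at h
    intro s
    obtain ⟨t, hr, ht⟩ := ihp h.1 s
    obtain ⟨t', hr', ht'⟩ := ihq h.2 (p.run s)
    exact ⟨_, .seq hr hr', by simp only [Program.maxCost]; omega⟩
  | ite b p q ihp ihq =>
    simp only [Program.loopFree, Bool.and_eq_true] at h
    intro s
    by_cases hb : b.Holds s
    · obtain ⟨t, hr, ht⟩ := ihp h.1 s
      refine ⟨b.cost + t + 1, ?_, by simp only [Program.maxCost]; omega⟩
      simp only [Program.run, hb, if_true]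
      exact .iteTrue hb hr
    · obtain ⟨t, hr, ht⟩ := ihq h.2 s
      refine ⟨b.cost + t + 1, ?_, by simp only [Program.maxCost]; omega⟩
      simp only [Program.run, hb, if_false]
      exact .iteFalse hb hr
  | loop b p => simp [Program.loopFree] at h

/-- The rule for counting loops whose body keeps the counter and the bound. -/
theorem forUp_of_keeps {v w n : ℕ} (Inv : ℕ → Store → Prop)
    (hw : (s.setNat v 0).natVar w = n) (h0 : Inv 0 (s.setNat v 0))
    (hstep : ∀ i, i < n → ∀ s', s'.natVar v = i → s'.natVar w = n → Inv i s' →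
      RunsWithin body s' T fun s'' => s''.natVar v = i ∧ (s''.setNat v (i + 1)).natVar w = n ∧
        Inv (i + 1) (s''.setNat v (i + 1))) :
    RunsWithin (.forUp v w body) s (n * (T + 8) + 6) (Inv n) := by
  suffices ∀ j i, i + j = n → ∀ s', s'.natVar v = i → s'.natVar w = n → Inv i s' →
      RunsWithin (.loop (.natLT (.var v) (.var w))
        (body ;; .setNat v (.add (.var v) (.const 1)))) s' (j * (T + 8) + 4) (Inv n) by
    obtain ⟨s', t, hr, ht, hq⟩ :=
      this n 0 (by omega) (s.setNat v 0) (by simp [Store.setNat]) hw h0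
    exact ⟨s', _, .seq (.setNat _ _ _) hr, by simp only [NatExp.cost]; omega, hq⟩
  intro j
  induction j with
  | zero =>
    intro i hi s' hv hw' hI
    obtain rfl : i = n := by omega
    exact ⟨s', _, .loopFalse (by simp [Test.Holds, NatExp.eval, hv, hw']),
      by simp [Test.cost, NatExp.cost], hI⟩
  | succ j ih =>
    intro i hi s' hv hw' hI
    obtain ⟨s'', t, hr, ht, hv', hw'', hI'⟩ := hstep i (by omega) s' hv hw' hI
    obtain ⟨s₃, t', hr', ht', hq⟩ := ih (i + 1) (by omega) (s''.setNat v (i + 1))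
      (by simp [Store.setNat]) hw'' hI'
    have h1 : Runs (.setNat v (.add (.var v) (.const 1))) s'' (s''.setNat v (i + 1)) 4 := by
      have := Runs.setNat s'' v (.add (.var v) (.const 1))
      simpa only [NatExp.eval, hv', NatExp.cost] using this
    refine ⟨s₃, _, .loopTrue (by simp only [Test.Holds, NatExp.eval, hv, hw']; omega)
      (.seq hr h1) hr', ?_, hq⟩
    simp only [Test.cost, NatExp.cost, add_mul]
    omega

/-- The rule for counting loops whose body writes only above the counter. -/
theorem forUp {v w n : ℕ} (Inv : ℕ → Store → Prop) (hwv : w < v) (hw : s.natVar w = n)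
    (hb : body.above (v + 1) = true) (h0 : Inv 0 (s.setNat v 0))
    (hstep : ∀ i, i < n → ∀ s', AgreeBelow v s s' → s'.natVar v = i → Inv i s' →
      RunsWithin body s' T fun s'' => Inv (i + 1) (s''.setNat v (i + 1))) :
    RunsWithin (.forUp v w body) s (n * (T + 8) + 6) fun s' => AgreeBelow v s s' ∧ Inv n s' := by
  have hset : ∀ (s' : Store) (i : ℕ), (s'.setNat v i).natVar w = s'.natVar w := fun s' i =>
    Function.update_of_ne hwv.ne _ _
  refine forUp_of_keeps (fun i s' => AgreeBelow v s s' ∧ Inv i s') ((hset _ _).trans hw)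
    ⟨.setNat le_rfl, h0⟩ ?_
  rintro i hi s' hv hw' ⟨ha, hI⟩
  refine ((hstep i hi s' ha hv hI).frame hb).mono le_rfl ?_
  rintro s'' ⟨ha', hI'⟩
  exact ⟨(ha'.natVar v (by omega)).trans hv,
    (hset _ _).trans ((ha'.natVar w (by omega)).trans hw'),
    (ha.trans (ha'.mono (by omega))).trans (.setNat le_rfl), hI'⟩

end RunsWithin

namespace Store

variable (s : Store) (v w a i j : ℕ) (z : ℝ)

@[simp] theorem natVar_setNat_self : (s.setNat v w).natVar v = w := Function.update_self ..
@[simp] theorem natVar_setNat_of_ne {u : ℕ} (h : u ≠ v) : (s.setNat v w).natVar u = s.natVar u :=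
  Function.update_of_ne h ..
@[simp] theorem realVar_setNat : (s.setNat v w).realVar = s.realVar := rfl
@[simp] theorem natArr_setNat : (s.setNat v w).natArr = s.natArr := rfl
@[simp] theorem realArr_setNat : (s.setNat v w).realArr = s.realArr := rfl
@[simp] theorem realVar_setReal_self : (s.setReal v z).realVar v = z := Function.update_self ..
@[simp] theorem realVar_setReal_of_ne {u : ℕ} (h : u ≠ v) :
    (s.setReal v z).realVar u = s.realVar u := Function.update_of_ne h ..
@[simp] theorem natVar_setReal : (s.setReal v z).natVar = s.natVar := rfl
@[simp] theorem natArr_setReal : (s.setReal v z).natArr = s.natArr := rfl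
@[simp] theorem realArr_setReal : (s.setReal v z).realArr = s.realArr := rfl
@[simp] theorem natArr_storeNat_self :
    (s.storeNat a i w).natArr a = Function.update (s.natArr a) i w := Function.update_self ..
@[simp] theorem natArr_storeNat_of_ne {b : ℕ} (h : b ≠ a) :
    (s.storeNat a i w).natArr b = s.natArr b := Function.update_of_ne h ..
@[simp] theorem natVar_storeNat : (s.storeNat a i w).natVar = s.natVar := rfl
@[simp] theorem realVar_storeNat : (s.storeNat a i w).realVar = s.realVar := rfl
@[simp] theorem realArr_storeNat : (s.storeNat a i w).realArr = s.realArr := rfl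
@[simp] theorem realArr_storeReal_self :
    (s.storeReal a i z).realArr a = Function.update (s.realArr a) i z := Function.update_self ..
@[simp] theorem realArr_storeReal_of_ne {b : ℕ} (h : b ≠ a) :
    (s.storeReal a i z).realArr b = s.realArr b := Function.update_of_ne h ..
@[simp] theorem natVar_storeReal : (s.storeReal a i z).natVar = s.natVar := rfl
@[simp] theorem realVar_storeReal : (s.storeReal a i z).realVar = s.realVar := rfl
@[simp] theorem natArr_storeReal : (s.storeReal a i z).natArr = s.natArr := rfl

end Store

attribute [simp] Program.run Test.Holds NatExp.eval RealExp.eval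

/-- `a[i] = i * w` for all `i` up to the value of the variable `b`. -/
def mulTable (v b w a : ℕ) : Program :=
  .storeNat a (.const 0) (.const 0) ;;
  .forUp v b
    (.storeNat a (.add (.var v) (.const 1)) (.add (.cell a (.var v)) (.var w)))

theorem mulTable_runs {s : Store} {v b w a n k : ℕ} (hb : b < v) (hw : w < v) (ha : v < a)
    (hn : s.natVar b = n) (hk : s.natVar w = k) :
    RunsWithin (mulTable v b w a) s (n * 16 + 9) fun s' =>
      AgreeBelow v s s' ∧ ∀ i, i ≤ n → s'.natArr a i = i * k := by
  have h1 : RunsWithin (.storeNat a (.const 0) (.const 0)) s 3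
      (fun s' => AgreeBelow v s s' ∧ s'.natArr a 0 = 0) :=
    .of_loopFree rfl le_rfl ⟨.storeNat ha.le, by simp⟩
  refine (RunsWithin.seq (T := 3) (T' := n * 16 + 6) (h1.mono le_rfl ?_)).mono_time (by omega)
  rintro s₁ ⟨h1a, h1z⟩
  refine (RunsWithin.forUp (T := 8) (fun i s' => ∀ j, j ≤ i → s'.natArr a j = j * k) hb
    ((h1a.natVar _ hb).trans hn) ?_ ?_ ?_).mono (by omega)
    (fun s' h => ⟨h1a.trans h.1, h.2⟩)
  · simp only [Program.above]
    exact Nat.ble_eq_true_of_le ha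
  · intro j hj
    obtain rfl : j = 0 := by omega
    simpa using h1z
  · intro i hi s' hs' hv hI
    refine .of_loopFree rfl (by simp [Program.maxCost, NatExp.cost]) ?_
    intro j hj
    have : s'.natVar w = k := (hs'.natVar _ hw).trans ((h1a.natVar _ hw).trans hk)
    simp only [Program.run, NatExp.eval, Store.natArr_setNat, Store.natArr_storeNat_self, hv, this,
      Function.update_apply]
    split_ifs with h
    · rw [hI i le_rfl, h]; ring
    · exact hI j (by omega)

end BackboneLabeling

namespace BackboneLabeling

/-! ### Crossings -/

namespace Labeling

variable {n C : ℕ} {L : Labeling n C} {P : PointSet n C} {cl : Clearance} {Δ : ℝ}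

theorem leftEnd_le (L : Labeling n C) (P : PointSet n C) (p : Fin n) :
    L.leftEnd P (L.assign p) ≤ P.x p :=
  csInf_le ((Set.toFinite _).bddBelow) ⟨p, rfl, rfl⟩

theorem exists_leftEnd (L : Labeling n C) (P : PointSet n C) (l : Fin L.numLabels) :
    ∃ p, L.assign p = l ∧ L.leftEnd P l = P.x p := by
  obtain ⟨p, hp⟩ := L.assign_surj l
  have hne : (P.x '' {p | L.assign p = l}).Nonempty := ⟨_, p, hp, rfl⟩
  obtain ⟨q, hq, hq'⟩ := hne.csInf_mem (Set.toFinite _)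
  exact ⟨q, hq, hq'.symm⟩

theorem crossingFree_of_outside (hy : ∀ l l', l ≠ l' → L.y l ≠ L.y l')
    (h : ∀ p l, L.assign p ≠ l → L.leftEnd P l ≤ P.x p →
      (L.y l < P.y p ∧ L.y l < L.y (L.assign p)) ∨ (P.y p < L.y l ∧ L.y (L.assign p) < L.y l)) :
    L.CrossingFree P := by
  have hmix : ∀ l p, L.assign p ≠ l → ∀ z ∈ L.backbone P l, z ∉ L.connection P p := by
    rintro l p hpl ⟨a, b⟩ ⟨⟨ha, -⟩, hb⟩ ⟨ha', hb'⟩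
    simp only [Set.mem_singleton_iff] at hb ha' ha hb'
    subst hb ha'
    have hb'' : L.y l ∈ Set.uIcc (P.y p) (L.y (L.assign p)) := hb'
    rw [Set.mem_uIcc] at hb''
    rcases h p l hpl ha with h | h <;> rcases hb'' with h' | h' <;> linarith [h.1, h.2, h'.1, h'.2]
  intro l l' hl
  rw [Set.disjoint_left]
  rintro z (hz | hz) (hz' | hz')
  · obtain ⟨-, hb⟩ := hz
    obtain ⟨-, hb'⟩ := hz'
    exact hy l l' hl (hb.symm.trans hb')
  · simp only [Set.mem_iUnion] at hz'
    obtain ⟨p, rfl, hp⟩ := hz'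
    exact hmix l p hl.symm z hz hp
  · simp only [Set.mem_iUnion] at hz
    obtain ⟨p, rfl, hp⟩ := hz
    exact hmix l' p hl z hz' hp
  · simp only [Set.mem_iUnion] at hz hz'
    obtain ⟨p, rfl, hp⟩ := hz
    obtain ⟨p', rfl, hp'⟩ := hz'
    have : P.x p = P.x p' := hp.1.symm.trans hp'.1
    exact hl (by rw [P.x_inj this])

theorem CrossingFree.outside (h : L.CrossingFree P) {p : Fin n} {l : Fin L.numLabels}
    (hpl : L.assign p ≠ l) (hx : L.leftEnd P l ≤ P.x p) :
    (L.y l < P.y p ∧ L.y l < L.y (L.assign p)) ∨ (P.y p < L.y l ∧ L.y (L.assign p) < L.y l) := by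
  have h1 : ((P.x p, L.y l) : ℝ × ℝ) ∈ L.leader P l :=
    Or.inl ⟨⟨hx, (P.x_mem p).2⟩, rfl⟩
  have h2 : L.y l ∉ Set.uIcc (P.y p) (L.y (L.assign p)) := by
    intro h2
    refine Set.disjoint_left.1 (h _ _ hpl) (Or.inr ?_) h1
    simp only [Set.mem_iUnion]
    exact ⟨p, rfl, rfl, h2⟩
  rw [Set.mem_uIcc, not_or, not_and_or, not_and_or] at h2
  rcases h2 with ⟨h2 | h2, h3 | h3⟩ <;> rw [not_le] at h2 h3
  · exact .inl ⟨h2, h3⟩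
  · exact absurd (h2.trans h3) (by
      intro h4
      rcases le_total (P.y p) (L.y (L.assign p)) with h5 | h5 <;> linarith)
  · exact absurd (h2.trans h3) (by
      intro h4
      rcases le_total (P.y p) (L.y (L.assign p)) with h5 | h5 <;> linarith)
  · exact .inr ⟨h3, h2⟩

/-! ### Discretization of the heights -/

/-- The labeling with new heights. -/
def withHeights (L : Labeling n C) (y : Fin L.numLabels → ℝ) : Labeling n C where
  numLabels := L.numLabels
  color := L.color
  y := y
  assign := L.assign
  assign_surj := L.assign_surj

/-- Whether a backbone has to keep its distance to a point of another label. -/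
def MustClear (L : Labeling n C) (P : PointSet n C) (cl : Clearance) (l : Fin L.numLabels)
    (p : Fin n) : Prop :=
  match cl with
  | .allPoints => True
  | .alongBackbone => L.leftEnd P l ≤ P.x p

theorem mustClear_of_le {l : Fin L.numLabels} {p : Fin n} (h : L.leftEnd P l ≤ P.x p) :
    L.MustClear P cl l p := by
  cases cl
  · trivial
  · exact h

/-- The heights that make `L` valid, described by weak inequalities. -/
def heightSet (L : Labeling n C) (P : PointSet n C) (cl : Clearance) (Δ : ℝ) :
    Set (Fin L.numLabels → ℝ) :=
  {y | (∀ l, P.bottom ≤ y l) ∧ (∀ l, y l ≤ P.top) ∧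
    (∀ l l', l ≠ l' → Δ ≤ |y l - y l'|) ∧
    (∀ l p, L.assign p ≠ l → L.MustClear P cl l p → Δ ≤ |P.y p - y l|) ∧
    ∀ l p, L.assign p ≠ l → L.leftEnd P l ≤ P.x p →
      (y l ≤ P.y p ∧ y l ≤ y (L.assign p)) ∨ (P.y p ≤ y l ∧ y (L.assign p) ≤ y l)}

theorem Valid.mem_heightSet (h : L.Valid P cl Δ) : L.y ∈ L.heightSet P cl Δ := by
  refine ⟨fun l => (h.on_boundary l).1, fun l => (h.on_boundary l).2, h.separated.1, ?_, ?_⟩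
  · intro l p hpl hc
    refine h.separated.2 l p hpl ?_
    cases cl <;> exact hc
  · intro l p hpl hx
    exact (h.crossingFree.outside hpl hx).imp (fun h => ⟨h.1.le, h.2.le⟩)
      (fun h => ⟨h.1.le, h.2.le⟩)

theorem outside_of_mem_heightSet (hΔ : 0 < Δ) {y : Fin L.numLabels → ℝ}
    (hy : y ∈ L.heightSet P cl Δ) {l : Fin L.numLabels} {p : Fin n} (hpl : L.assign p ≠ l)
    (hx : L.leftEnd P l ≤ P.x p) :
    (y l < P.y p ∧ y l < y (L.assign p)) ∨ (P.y p < y l ∧ y (L.assign p) < y l) := by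
  obtain ⟨-, -, h1, h2, h3⟩ := hy
  have h4 : P.y p ≠ y l := fun h => by
    have := h2 l p hpl (mustClear_of_le hx)
    rw [h, sub_self, abs_zero] at this
    linarith
  have h5 : y (L.assign p) ≠ y l := fun h => by
    have := h1 _ _ hpl
    rw [h, sub_self, abs_zero] at this
    linarith
  exact (h3 l p hpl hx).imp (fun h => ⟨h.1.lt_of_ne h4.symm, h.2.lt_of_ne h5.symm⟩)
    (fun h => ⟨h.1.lt_of_ne h4, h.2.lt_of_ne h5⟩)

theorem valid_withHeights (hΔ : 0 < Δ) (hc : ∀ p, L.color (L.assign p) = P.color p)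
    {y : Fin L.numLabels → ℝ} (hy : y ∈ L.heightSet P cl Δ) :
    (L.withHeights y).Valid P cl Δ where
  color_eq := hc
  on_boundary l := ⟨hy.1 l, hy.2.1 l⟩
  crossingFree := by
    refine crossingFree_of_outside (fun l l' hl h => ?_)
      (fun p l hpl hx => outside_of_mem_heightSet hΔ hy hpl hx)
    have := hy.2.2.1 l l' hl
    have h' : y l = y l' := h
    rw [h', sub_self, abs_zero] at this
    linarith
  separated := by
    refine ⟨hy.2.2.1, fun l p hpl h => hy.2.2.2.1 l p hpl ?_⟩
    cases cl <;> exact h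

theorem isCompact_heightSet : IsCompact (L.heightSet P cl Δ) := by
  have hb : L.heightSet P cl Δ ⊆ Set.pi Set.univ fun _ => Set.Icc P.bottom P.top :=
    fun y hy l _ => ⟨hy.1 l, hy.2.1 l⟩
  refine (isCompact_univ_pi fun _ => isCompact_Icc).of_isClosed_subset ?_ hb
  simp only [heightSet, Set.ofPred_and, Set.ofPred_forall]
  refine IsClosed.inter (isClosed_iInter fun l => isClosed_le (by fun_prop) (by fun_prop))
    (IsClosed.inter (isClosed_iInter fun l => isClosed_le (by fun_prop) (by fun_prop))
    (IsClosed.inter (isClosed_iInter fun l => isClosed_iInter fun l' => isClosed_iInter fun _ =>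
      isClosed_le (by fun_prop) (by fun_prop))
    (IsClosed.inter (isClosed_iInter fun l => isClosed_iInter fun p => isClosed_iInter fun _ =>
      isClosed_iInter fun _ => isClosed_le (by fun_prop) (by fun_prop))
    (isClosed_iInter fun l => isClosed_iInter fun p => isClosed_iInter fun _ =>
      isClosed_iInter fun _ => ?_))))
  rw [Set.ofPred_or, Set.ofPred_and, Set.ofPred_and]
  exact ((isClosed_le (by fun_prop) (by fun_prop)).inter
    (isClosed_le (by fun_prop) (by fun_prop))).union
    ((isClosed_le (by fun_prop) (by fun_prop)).inter (isClosed_le (by fun_prop) (by fun_prop)))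

/-- The total length of the vertical segments for the heights `y`. -/
noncomputable def vertLength (L : Labeling n C) (P : PointSet n C) (y : Fin L.numLabels → ℝ) : ℝ :=
  ∑ p, |P.y p - y (L.assign p)|

theorem totalLength_withHeights_le {y : Fin L.numLabels → ℝ} {obj : Objective}
    (h : L.vertLength P y ≤ L.vertLength P L.y) :
    (L.withHeights y).totalLength P obj ≤ L.totalLength P obj := by
  cases obj
  · exact add_le_add_left h _
  · exact h

/-- Heights at which a backbone is not free to move: the sides of the rectangle, and the heights
at distance `0` or `Δ` from a point. -/
def IsRigid (P : PointSet n C) (Δ h : ℝ) : Prop :=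
  h = P.bottom ∨ h = P.top ∨ ∃ p, h = P.y p ∨ |P.y p - h| = Δ

open Filter Topology in
/-- Heights can be shifted a bit without violating a constraint if the shifted backbones are neither
rigid nor at distance `Δ` from the other ones. -/
theorem eventually_shift (hΔ : 0 < Δ) {y : Fin L.numLabels → ℝ} (hy : y ∈ L.heightSet P cl Δ)
    (ind : Fin L.numLabels → ℝ) (hind : ∀ l, ind l = 0 ∨ ind l = 1)
    (hR : ∀ l, ind l = 1 → ¬ IsRigid P Δ (y l))
    (hout : ∀ l l', ind l ≠ ind l' → |y l - y l'| ≠ Δ) :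
    ∀ᶠ δ in 𝓝 (0 : ℝ), (fun l => y l + δ * ind l) ∈ L.heightSet P cl Δ ∧
      ∀ p, |P.y p - (y (L.assign p) + δ * ind (L.assign p))| +
        |P.y p - (y (L.assign p) - δ * ind (L.assign p))| = 2 * |P.y p - y (L.assign p)| := by
  have hc : ∀ l, Tendsto (fun δ : ℝ => y l + δ * ind l) (𝓝 0) (𝓝 (y l)) := fun l => by
    have : Continuous fun δ : ℝ => y l + δ * ind l := by fun_prop
    simpa using this.tendsto 0
  have hlt : ∀ {f g : ℝ → ℝ} {a b : ℝ}, Tendsto f (𝓝 0) (𝓝 a) → Tendsto g (𝓝 0) (𝓝 b) → a < b →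
      ∀ᶠ δ in 𝓝 (0 : ℝ), f δ < g δ := fun hf hg hab => hf.eventually_lt hg hab
  have h1 : ∀ l, ∀ᶠ δ in 𝓝 (0 : ℝ), P.bottom ≤ y l + δ * ind l := fun l => by
    rcases hind l with h | h
    · simpa [h] using hy.1 l
    · refine (hlt tendsto_const_nhds (hc l) ((hy.1 l).lt_of_ne ?_)).mono fun _ h => h.le
      exact fun h' => hR l h (.inl h'.symm)
  have h2 : ∀ l, ∀ᶠ δ in 𝓝 (0 : ℝ), y l + δ * ind l ≤ P.top := fun l => by
    rcases hind l with h | h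
    · simpa [h] using hy.2.1 l
    · refine (hlt (hc l) tendsto_const_nhds ((hy.2.1 l).lt_of_ne ?_)).mono fun _ h => h.le
      exact fun h' => hR l h (.inr (.inl h'))
  have h3 : ∀ l l', ∀ᶠ δ in 𝓝 (0 : ℝ), l ≠ l' → Δ ≤ |y l + δ * ind l - (y l' + δ * ind l')| :=
    fun l l' => by
    by_cases hl : l = l'
    · simp [hl]
    have h0 := hy.2.2.1 l l' hl
    by_cases h : ind l = ind l'
    · refine .of_forall fun δ _ => ?_
      rw [h]
      simpa using h0
    · refine (hlt tendsto_const_nhds ((hc l).sub (hc l')).abs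
        (h0.lt_of_ne (hout l l' h).symm)).mono fun _ h _ => h.le
  have h4 : ∀ l p, ∀ᶠ δ in 𝓝 (0 : ℝ), L.assign p ≠ l → L.MustClear P cl l p →
      Δ ≤ |P.y p - (y l + δ * ind l)| := fun l p => by
    by_cases h : L.assign p ≠ l ∧ L.MustClear P cl l p
    swap
    · exact .of_forall fun δ h' h'' => absurd ⟨h', h''⟩ h
    have h0 := hy.2.2.2.1 l p h.1 h.2
    rcases hind l with h' | h'
    · refine .of_forall fun δ _ _ => ?_
      simpa [h'] using h0
    · refine (hlt tendsto_const_nhds ((tendsto_const_nhds (x := P.y p)).sub (hc l)).abs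
        (h0.lt_of_ne ?_)).mono fun _ h _ _ => h.le
      exact fun h => hR l h' (.inr (.inr ⟨p, .inr h.symm⟩))
  have h5 : ∀ l p, ∀ᶠ δ in 𝓝 (0 : ℝ), L.assign p ≠ l → L.leftEnd P l ≤ P.x p →
      (y l + δ * ind l ≤ P.y p ∧
        y l + δ * ind l ≤ y (L.assign p) + δ * ind (L.assign p)) ∨
      (P.y p ≤ y l + δ * ind l ∧
        y (L.assign p) + δ * ind (L.assign p) ≤ y l + δ * ind l) := fun l p => by
    by_cases h : L.assign p ≠ l ∧ L.leftEnd P l ≤ P.x p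
    swap
    · exact .of_forall fun δ h' h'' => absurd ⟨h', h''⟩ h
    rcases outside_of_mem_heightSet hΔ hy h.1 h.2 with h0 | h0
    · filter_upwards [hlt (hc l) tendsto_const_nhds h0.1, hlt (hc l) (hc _) h0.2] with δ ha hb _ _
      exact .inl ⟨ha.le, hb.le⟩
    · filter_upwards [hlt tendsto_const_nhds (hc l) h0.1, hlt (hc _) (hc l) h0.2] with δ ha hb _ _
      exact .inr ⟨ha.le, hb.le⟩
  have h6 : ∀ p, ∀ᶠ δ in 𝓝 (0 : ℝ), |P.y p - (y (L.assign p) + δ * ind (L.assign p))| +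
        |P.y p - (y (L.assign p) - δ * ind (L.assign p))| = 2 * |P.y p - y (L.assign p)| :=
    fun p => by
    rcases hind (L.assign p) with h | h
    · simp [h, two_mul]
    · have h0 : P.y p ≠ y (L.assign p) := fun h' => hR _ h (.inr (.inr ⟨p, .inl h'.symm⟩))
      have h' : 0 < |P.y p - y (L.assign p)| := abs_pos.2 (sub_ne_zero.2 h0)
      have habs : Tendsto (fun δ : ℝ => |δ|) (𝓝 0) (𝓝 0) := by
        simpa using (continuous_abs (G := ℝ)).tendsto 0
      filter_upwards [hlt habs tendsto_const_nhds h'] with δ hδ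
      rw [h, mul_one]
      have hδ' := abs_lt.1 hδ
      rcases le_total 0 (P.y p - y (L.assign p)) with h1 | h1
      · rw [abs_of_nonneg h1] at hδ' ⊢
        rw [abs_of_nonneg (by linarith), abs_of_nonneg (by linarith)]
        ring
      · rw [abs_of_nonpos h1] at hδ' ⊢
        rw [abs_of_nonpos (by linarith), abs_of_nonpos (by linarith)]
        ring
  filter_upwards [eventually_all.2 h1, eventually_all.2 h2,
    eventually_all.2 fun l => eventually_all.2 (h3 l),
    eventually_all.2 fun l => eventually_all.2 (h4 l),
    eventually_all.2 fun l => eventually_all.2 (h5 l), eventually_all.2 h6]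
    with δ g1 g2 g3 g4 g5 g6
  exact ⟨⟨g1, g2, g3, g4, g5⟩, g6⟩

/-- The graph on the labels whose edges are the pairs of backbones at distance exactly `Δ`. -/
def tightGraph (y : Fin L.numLabels → ℝ) (Δ : ℝ) : SimpleGraph (Fin L.numLabels) where
  Adj l l' := l ≠ l' ∧ |y l - y l'| = Δ
  symm := ⟨fun l l' h => ⟨h.1.symm, by rw [abs_sub_comm]; exact h.2⟩⟩
  loopless := ⟨fun l h => h.1 rfl⟩

theorem exists_int_of_walk {y : Fin L.numLabels → ℝ} {l l' : Fin L.numLabels}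
    (w : (tightGraph (L := L) y Δ).Walk l l') :
    ∃ j : ℤ, |j| ≤ w.length ∧ y l = y l' + j * Δ := by
  induction w with
  | nil => exact ⟨0, by simp, by simp⟩
  | @cons a b c h w ih =>
    obtain ⟨j, hj, hy⟩ := ih
    rw [abs_le] at hj
    rcases (abs_eq (h.2 ▸ abs_nonneg _)).1 h.2 with h' | h'
    · refine ⟨j + 1, ?_, by push_cast; linarith⟩
      rw [abs_le, SimpleGraph.Walk.length_cons]
      push_cast
      omega
    · refine ⟨j - 1, ?_, by push_cast; linarith⟩
      rw [abs_le, SimpleGraph.Walk.length_cons]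
      push_cast
      omega

theorem numLabels_le (L : Labeling n C) : L.numLabels ≤ n := by
  simpa using Fintype.card_le_of_surjective L.assign L.assign_surj

/-- The base heights of the candidate positions. -/
def baseHeight (P : PointSet n C) : Option (Fin n ⊕ Unit) → ℝ
  | none => P.bottom
  | some (.inl p) => P.y p
  | some (.inr ()) => P.top

theorem IsRigid.exists_baseHeight {h : ℝ} (hh : IsRigid P Δ h) :
    ∃ b, ∃ j : ℤ, |j| ≤ 1 ∧ h = baseHeight P b + j * Δ := by
  rcases hh with h | h | ⟨p, h | h⟩
  · exact ⟨none, 0, by simp, by simp [baseHeight, h]⟩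
  · exact ⟨some (.inr ()), 0, by simp, by simp [baseHeight, h]⟩
  · exact ⟨some (.inl p), 0, by simp, by simp [baseHeight, h]⟩
  · rcases (abs_eq (h ▸ abs_nonneg _)).1 h with h | h
    · exact ⟨some (.inl p), -1, by simp, by simp only [baseHeight]; push_cast; linarith⟩
    · exact ⟨some (.inl p), 1, by simp, by simp only [baseHeight]; push_cast; linarith⟩

open Filter Topology in
/-- Every valid labeling can be made at most as long, with all heights among the candidates. -/
theorem Valid.exists_candidate_heights (h : L.Valid P cl Δ) (hΔ : 0 < Δ) :
    ∃ y : Fin L.numLabels → ℝ, (L.withHeights y).Valid P cl Δ ∧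
      (∀ obj, (L.withHeights y).totalLength P obj ≤ L.totalLength P obj) ∧
      ∀ l, ∃ b, ∃ j : ℤ, |j| ≤ n ∧ y l = baseHeight P b + j * Δ := by
  set S := L.heightSet P cl Δ with hS
  have hf : Continuous (L.vertLength P) := by unfold vertLength; fun_prop
  obtain ⟨y₀, hy₀, hmin₀⟩ := (isCompact_heightSet (L := L) (P := P) (cl := cl) (Δ := Δ)).exists_isMinOn
    ⟨L.y, h.mem_heightSet⟩ hf.continuousOn
  have hcl : IsCompact (S ∩ {y | L.vertLength P y = L.vertLength P y₀}) :=
    isCompact_heightSet.inter_right (isClosed_eq hf continuous_const)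
  obtain ⟨y, ⟨hy, hyeq⟩, hmin⟩ := hcl.exists_isMinOn ⟨y₀, hy₀, rfl⟩
    (f := fun y => ∑ l, y l) (by fun_prop)
  have hmin₁ : ∀ z ∈ S, L.vertLength P y ≤ L.vertLength P z := fun z hz => by
    have : L.vertLength P y = L.vertLength P y₀ := hyeq
    rw [this]; exact hmin₀ hz
  have hmin₂ : ∀ z ∈ S, L.vertLength P z = L.vertLength P y → ∑ l, y l ≤ ∑ l, z l :=
    fun z hz hz' => hmin ⟨hz, hz'.trans hyeq⟩
  refine ⟨y, valid_withHeights hΔ h.color_eq hy,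
    fun obj => totalLength_withHeights_le (hmin₁ _ h.mem_heightSet), fun l₀ => ?_⟩
  set G := tightGraph (L := L) y Δ with hG
  obtain ⟨l, hl, hrig⟩ : ∃ l, G.Reachable l₀ l ∧ IsRigid P Δ (y l) := by
    by_contra! hcon
    classical
    have hev := eventually_shift hΔ hy (fun l => if G.Reachable l₀ l then 1 else 0)
      (fun l => by by_cases h : G.Reachable l₀ l <;> simp [h])
      (fun l hl => hcon l (by by_contra h; simp [h] at hl)) (by
        intro l l' hll' hΔ'
        have hne : l ≠ l' := by rintro rfl; exact hll' rfl
        have hadj : G.Adj l l' := ⟨hne, hΔ'⟩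
        have : G.Reachable l₀ l ↔ G.Reachable l₀ l' :=
          ⟨fun h => h.trans hadj.reachable, fun h => h.trans hadj.symm.reachable⟩
        simp [this] at hll')
    have hneg : Tendsto (fun δ : ℝ => -δ) (𝓝 0) (𝓝 0) := by
      simpa using (continuous_neg (G := ℝ)).tendsto 0
    have hboth := (hev.and (hneg.eventually hev)).filter_mono (nhdsWithin_le_nhds (s := Set.Ioi 0))
    obtain ⟨δ, ⟨⟨hz, hsum⟩, hz', -⟩, hδ⟩ := (hboth.and self_mem_nhdsWithin).exists
    have hδ' : 0 < δ := hδ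
    have e1 := hmin₁ _ hz
    have e2 := hmin₁ _ hz'
    have e3 : L.vertLength P (fun l => y l + δ * if G.Reachable l₀ l then 1 else 0) +
        L.vertLength P (fun l => y l + -δ * if G.Reachable l₀ l then 1 else 0) =
        2 * L.vertLength P y := by
      simp only [vertLength, Finset.mul_sum, ← Finset.sum_add_distrib]
      refine Finset.sum_congr rfl fun p _ => ?_
      rw [← hsum p, neg_mul, ← sub_eq_add_neg]
    have e4 := hmin₂ _ hz' (by linarith)
    rw [Finset.sum_add_distrib, ← Finset.mul_sum] at e4
    have e5 : (1 : ℝ) ≤ ∑ l, if G.Reachable l₀ l then (1 : ℝ) else 0 := by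
      have := Finset.single_le_sum (f := fun l => if G.Reachable l₀ l then (1 : ℝ) else 0)
        (fun l _ => by positivity) (Finset.mem_univ l₀)
      simpa using this
    nlinarith
  obtain ⟨w, hw⟩ := hl.exists_isPath
  have hlen := hw.length_lt
  rw [Fintype.card_fin] at hlen
  have hn := L.numLabels_le
  obtain ⟨j, hj, hjy⟩ := exists_int_of_walk w
  obtain ⟨b, j', hj', hb⟩ := hrig.exists_baseHeight
  refine ⟨b, j + j', ?_, ?_⟩
  · rw [abs_le] at *
    omega
  · rw [hjy, hb]
    push_cast
    ring

end Labeling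

end BackboneLabeling

namespace BackboneLabeling

/-! ### The recurrence -/

/-- The data of the dynamic program. The points are indexed by their rank in the order of their
`x`-coordinates. A backbone is given by an identifier `j + c * M` of its candidate height `Y j` and
its color `c`; `C * M` and `C * M + 1` are virtual backbones above and below the rectangle. -/
structure Data where
  /-- number of points -/
  n : ℕ
  /-- number of colors -/
  C : ℕ
  /-- number of candidate heights -/
  M : ℕ
  /-- number of budgets -/
  B : ℕ
  /-- number of classes of colors whose labels are counted together -/
  D : ℕ
  Δ : ℝ
  bottom : ℝ
  top : ℝ
  /-- heights of the points -/
  py : ℕ → ℝ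
  /-- lengths of the backbones that start at the points -/
  bc : ℕ → ℝ
  /-- candidate heights -/
  Y : ℕ → ℝ
  /-- heights of the backbones -/
  hb : ℕ → ℝ
  /-- colors of the points -/
  pc : ℕ → ℕ
  /-- classes of the points -/
  cls : ℕ → ℕ
  /-- bounds on the numbers of labels of the classes -/
  k : ℕ → ℕ
  /-- weights of the classes in the codes of budgets -/
  W : ℕ → ℕ
  /-- codes of the labels that start at the points -/
  e : ℕ → ℕ
  /-- codes of the budgets -/
  cd : ℕ → ℕ
  /-- budgets with given codes -/
  ι : ℕ → ℕ
  /-- first point to which a candidate height is too close -/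
  fst : ℕ → ℕ
  /-- colors of the backbones -/
  cb : ℕ → ℕ

/-- Values and decisions for the subproblems. -/
structure Table where
  kind : ℕ → ℕ → ℕ → ℕ → ℕ
  cand : ℕ → ℕ → ℕ → ℕ → ℕ
  upper : ℕ → ℕ → ℕ → ℕ → ℕ
  lower : ℕ → ℕ → ℕ → ℕ → ℕ
  val : ℕ → ℕ → ℕ → ℕ → ℝ

namespace Data

variable (d : Data)

/-- The code of a vector. -/
def code (u : ℕ → ℕ) : ℕ := ∑ c ∈ Finset.range d.D, u c * d.W c

open Classical in
/-- `1` if `q` is a point of class `c`, but not the first one. -/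
noncomputable def notFirst (c q : ℕ) : ℕ := if d.cls q = c ∧ ∃ q' < q, d.cls q' = c then 1 else 0

def virtualTop : ℕ := d.C * d.M
def virtualBottom : ℕ := d.C * d.M + 1

/-- The point `r` lies in the strip below the backbone `b₁` and above the backbone `b₂`. -/
def InStrip (r b₁ b₂ : ℕ) : Prop := d.hb b₂ < d.py r ∧ d.py r ≤ d.hb b₁

/-- The properties of the data. -/
structure Ok (cl : Clearance) : Prop where
  Δ_pos : 0 < d.Δ
  cd_box : ∀ i, i < d.B → ∃ u, (∀ c, c < d.D → u c < d.k c) ∧ d.cd i = d.code u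
  ι_code : ∀ u, (∀ c, c < d.D → u c < d.k c) →
    d.ι (d.code u) < d.B ∧ d.cd (d.ι (d.code u)) = d.code u
  code_inj : ∀ u u', (∀ c, c < d.D → u c < 2 * d.k c) → (∀ c, c < d.D → u' c < 2 * d.k c) →
    d.code u = d.code u' → ∀ c, c < d.D → u c = u' c
  cls_eq : ∀ q q', q < d.n → q' < d.n → d.pc q = d.pc q' → d.cls q = d.cls q'
  e_eq : ∀ q, q < d.n → d.e q = d.code fun c => d.notFirst c q
  pc_lt : ∀ q, q < d.n → d.pc q < d.C
  py_mem : ∀ q, q < d.n → d.bottom ≤ d.py q ∧ d.py q ≤ d.top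
  hb_eq : ∀ c, c < d.C → ∀ j, j < d.M → d.hb (j + c * d.M) = d.Y j
  cb_eq : ∀ c, c < d.C → ∀ j, j < d.M → d.cb (j + c * d.M) = c
  hb_top : d.hb d.virtualTop = d.top + d.Δ
  hb_bottom : d.hb d.virtualBottom = d.bottom - d.Δ
  cb_top : d.cb d.virtualTop = d.C
  cb_bottom : d.cb d.virtualBottom = d.C
  le_fst : ∀ j, j < d.M → ∀ r, r < d.n →
    (r ≤ d.fst j ↔ (cl = .allPoints → ∀ q, q < r → d.Δ ≤ |d.py q - d.Y j|))

/-- The options for the leftmost point `r` of a subproblem with budget `i`, in terms of the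
subproblems for the points after `r`. -/
inductive Choice (T : Table) (r b₁ b₂ i : ℕ) : ℕ → ℕ → ℕ → ℕ → ℝ → Prop
  | pass {j i' i''} : ¬ d.InStrip r b₁ b₂ → T.kind (r + 1) b₁ b₂ i ≠ 0 →
      Choice T r b₁ b₂ i 1 j i' i'' (T.val (r + 1) b₁ b₂ i)
  | up {j i' i''} : d.InStrip r b₁ b₂ → d.pc r = d.cb b₁ → d.Δ ≤ d.py r - d.hb b₂ →
      T.kind (r + 1) b₁ b₂ i ≠ 0 →
      Choice T r b₁ b₂ i 2 j i' i'' (T.val (r + 1) b₁ b₂ i + (d.hb b₁ - d.py r))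
  | down {j i' i''} : d.InStrip r b₁ b₂ → d.pc r = d.cb b₂ → d.Δ ≤ d.hb b₁ - d.py r →
      T.kind (r + 1) b₁ b₂ i ≠ 0 →
      Choice T r b₁ b₂ i 3 j i' i'' (T.val (r + 1) b₁ b₂ i + (d.py r - d.hb b₂))
  | split {j i' i''} : d.InStrip r b₁ b₂ → d.Δ ≤ d.py r - d.hb b₂ → d.Δ ≤ d.hb b₁ - d.py r →
      j < d.M → r ≤ d.fst j → d.Δ ≤ d.hb b₁ - d.Y j → d.Δ ≤ d.Y j - d.hb b₂ →
      i' < d.B → i'' < d.B → d.cd (d.ι (d.cd i' + d.cd i'' + d.e r)) = d.cd i' + d.cd i'' + d.e r →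
      i = d.ι (d.cd i' + d.cd i'' + d.e r) →
      T.kind (r + 1) b₁ (j + d.pc r * d.M) i' ≠ 0 → T.kind (r + 1) (j + d.pc r * d.M) b₂ i'' ≠ 0 →
      Choice T r b₁ b₂ i 4 j i' i''
        (T.val (r + 1) b₁ (j + d.pc r * d.M) i' + T.val (r + 1) (j + d.pc r * d.M) b₂ i'' +
          (|d.py r - d.Y j| + d.bc r))

/-- The recorded decision is the best of the decisions in `S`, or `0` if there is none. -/
def IsBest (S : ℕ → ℕ → ℕ → ℕ → ℝ → Prop) (κ j i' i'' : ℕ) (v : ℝ) : Prop :=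
  (κ ≠ 0 → S κ j i' i'' v) ∧ ∀ κ' j' l l' v', S κ' j' l l' v' → κ ≠ 0 ∧ v ≤ v'

/-- The table solves the recurrence. -/
structure Solves (T : Table) : Prop where
  base_kind : ∀ b₁, b₁ < d.C * d.M + 2 → ∀ b₂, b₂ < d.C * d.M + 2 → ∀ i, i < d.B →
    (T.kind d.n b₁ b₂ i ≠ 0 ↔ d.cd i = 0)
  base_val : ∀ b₁, b₁ < d.C * d.M + 2 → ∀ b₂, b₂ < d.C * d.M + 2 → ∀ i, i < d.B →
    T.val d.n b₁ b₂ i = 0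
  step : ∀ r, r < d.n → ∀ b₁, b₁ < d.C * d.M + 2 → ∀ b₂, b₂ < d.C * d.M + 2 → ∀ i, i < d.B →
    IsBest (d.Choice T r b₁ b₂ i) (T.kind r b₁ b₂ i) (T.cand r b₁ b₂ i) (T.upper r b₁ b₂ i)
      (T.lower r b₁ b₂ i) (T.val r b₁ b₂ i)

/-- A crossing-free and separated labeling of the first `r` points with `m` labels: `a` assigns
the points to the labels, `birth` is the leftmost point of a label, `ly` its height and `lc` its
color. -/
structure Good (cl : Clearance) (r m : ℕ) (a birth : ℕ → ℕ) (ly : ℕ → ℝ) (lc : ℕ → ℕ) : Prop where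
  mem : ∀ l, l < m → d.bottom ≤ ly l ∧ ly l ≤ d.top
  sep : ∀ l, l < m → ∀ l', l' < m → l ≠ l' → d.Δ ≤ |ly l - ly l'|
  birth_lt : ∀ l, l < m → birth l < r
  a_birth : ∀ l, l < m → a (birth l) = l
  a_lt : ∀ q, q < r → a q < m
  a_col : ∀ q, q < r → lc (a q) = d.pc q
  birth_le : ∀ q, q < r → birth (a q) ≤ q
  clear : ∀ q, q < r → ∀ l, l < m → l ≠ a q → birth l ≤ q → d.Δ ≤ |d.py q - ly l|
  cross : ∀ q, q < r → ∀ l, l < m → l ≠ a q → birth l ≤ q →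
    (ly l < d.py q ∧ ly l < ly (a q)) ∨ (d.py q < ly l ∧ ly (a q) < ly l)
  clear_all : cl = .allPoints → ∀ q, q < r → ∀ l, l < m → q < birth l → d.Δ ≤ |d.py q - ly l|

/-- The length of a labeling of the first `r` points. -/
noncomputable def len (r m : ℕ) (a birth : ℕ → ℕ) (ly : ℕ → ℝ) : ℝ :=
  ∑ q ∈ Finset.range r, |d.py q - ly (a q)| + ∑ l ∈ Finset.range m, d.bc (birth l)

variable {d}

theorem code_add (u u' : ℕ → ℕ) : d.code (fun c => u c + u' c) = d.code u + d.code u' := by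
  simp only [code, add_mul, Finset.sum_add_distrib]

theorem code_congr {u u' : ℕ → ℕ} (h : ∀ c, c < d.D → u c = u' c) : d.code u = d.code u' :=
  Finset.sum_congr rfl fun c hc => by rw [h c (Finset.mem_range.1 hc)]

theorem code_zero : d.code (fun _ => 0) = 0 := by simp [code]

theorem Good.sum_birth {α : Type*} [AddCommMonoid α] {cl : Clearance} {r m : ℕ} {a birth : ℕ → ℕ}
    {ly : ℕ → ℝ} {lc : ℕ → ℕ} (g : d.Good cl r m a birth ly lc) (F : ℕ → α) :
    ∑ q ∈ Finset.range r, (if birth (a q) = q then F q else 0) =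
      ∑ l ∈ Finset.range m, F (birth l) := by
  rw [← Finset.sum_filter]
  refine Finset.sum_nbij' a birth ?_ ?_ ?_ ?_ ?_
  · intro q hq
    simp only [Finset.mem_filter, Finset.mem_range] at hq ⊢
    exact g.a_lt q hq.1
  · intro l hl
    simp only [Finset.mem_filter, Finset.mem_range] at hl ⊢
    exact ⟨g.birth_lt l hl, by rw [g.a_birth l hl]⟩
  · intro q hq
    exact (Finset.mem_filter.1 hq).2
  · intro l hl
    exact g.a_birth l (Finset.mem_range.1 hl)
  · intro q hq
    rw [(Finset.mem_filter.1 hq).2]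

/-- The labels of a class, except for the first one, are those that start at a point that is not the
first one of the class. -/
theorem Good.sum_notFirst {cl : Clearance} (ok : d.Ok cl) {m : ℕ} {a birth : ℕ → ℕ} {ly : ℕ → ℝ}
    {lc : ℕ → ℕ} (g : d.Good cl d.n m a birth ly lc) (c : ℕ) :
    ∑ l ∈ Finset.range m, d.notFirst c (birth l) =
      ((Finset.range m).filter fun l => d.cls (birth l) = c).card - 1 := by
  classical
  have hcls : ∀ q, q < d.n → d.cls (birth (a q)) = d.cls q := fun q hq => by
    have hl := g.a_lt q hq
    refine ok.cls_eq _ _ (g.birth_lt _ hl) hq ?_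
    rw [← g.a_col _ (g.birth_lt _ hl), g.a_birth _ hl, g.a_col q hq]
  by_cases hex : ∃ q, q < d.n ∧ d.cls q = c
  · obtain ⟨q₀, ⟨hq₀, hq₀c⟩, hmin⟩ : ∃ q, (q < d.n ∧ d.cls q = c) ∧
        ∀ q' < q, ¬ (q' < d.n ∧ d.cls q' = c) :=
      ⟨Nat.find hex, Nat.find_spec hex, fun q' h => Nat.find_min hex h⟩
    have hl₀ := g.a_lt q₀ hq₀
    have hb₀ : birth (a q₀) = q₀ := by
      by_contra h
      exact hmin _ (lt_of_le_of_ne (g.birth_le q₀ hq₀) h)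
        ⟨g.birth_lt _ hl₀, (hcls q₀ hq₀).trans hq₀c⟩
    have hmem : a q₀ ∈ (Finset.range m).filter fun l => d.cls (birth l) = c := by
      simp [hl₀, hb₀, hq₀c]
    rw [← Finset.card_erase_of_mem hmem, Finset.card_eq_sum_ones, ← Finset.filter_ne',
      Finset.filter_filter, Finset.sum_filter]
    refine Finset.sum_congr rfl fun l hl => ?_
    rw [Finset.mem_range] at hl
    unfold notFirst
    refine if_congr ⟨fun h => ⟨h.1, ?_⟩, fun h => ⟨h.1, q₀, ?_, hq₀c⟩⟩ rfl rfl
    · rintro rfl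
      obtain ⟨-, q', hq', hq'c⟩ := h
      rw [hb₀] at hq'
      exact hmin q' hq' ⟨hq'.trans hq₀, hq'c⟩
    · by_contra h'
      have : birth l = q₀ := by
        by_contra h''
        exact hmin _ (by omega) ⟨g.birth_lt l hl, h.1⟩
      exact h.2 (by rw [← this, g.a_birth l hl])
  · rw [Finset.filter_false_of_mem, Finset.card_empty]
    · refine Finset.sum_eq_zero fun l hl => ?_
      rw [Finset.mem_range] at hl
      exact if_neg fun h => hex ⟨_, g.birth_lt l hl, h.1⟩
    · intro l hl h
      rw [Finset.mem_range] at hl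
      exact hex ⟨_, g.birth_lt l hl, h⟩

/-! ### The table is a lower bound -/

open Classical in
/-- The sum of `f` over the points from `r` on between the heights `lo` and `hi`. -/
noncomputable def stripSum {α : Type*} [AddCommMonoid α] (d : Data) (f : ℕ → α) (r : ℕ)
    (lo hi : ℝ) : α :=
  ∑ q ∈ Finset.Ico r d.n, if lo < d.py q ∧ d.py q ≤ hi then f q else 0

section StripSum

variable {α : Type*} [AddCommMonoid α] {f : ℕ → α} {r : ℕ} {lo hi : ℝ}

theorem stripSum_end : d.stripSum f d.n lo hi = 0 := by simp [stripSum]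

theorem stripSum_of_not (hr : r < d.n) (h : ¬ (lo < d.py r ∧ d.py r ≤ hi)) :
    d.stripSum f r lo hi = d.stripSum f (r + 1) lo hi := by
  rw [stripSum, Finset.sum_eq_sum_Ico_succ_bot hr, if_neg h, zero_add, stripSum]

theorem stripSum_of_mem (hr : r < d.n) (h : lo < d.py r ∧ d.py r ≤ hi) :
    d.stripSum f r lo hi = f r + d.stripSum f (r + 1) lo hi := by
  rw [stripSum, Finset.sum_eq_sum_Ico_succ_bot hr, if_pos h, stripSum]

theorem stripSum_split {mid : ℝ} (h1 : lo < mid) (h2 : mid < hi) :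
    d.stripSum f r lo hi = d.stripSum f r mid hi + d.stripSum f r lo mid := by
  rw [stripSum, stripSum, stripSum, ← Finset.sum_add_distrib]
  refine Finset.sum_congr rfl fun q _ => ?_
  by_cases h3 : d.py q ≤ mid
  · have : ¬ mid < d.py q := not_lt.2 h3
    have h4 : d.py q ≤ hi := h3.trans h2.le
    simp [h3, this, h4]
  · have h4 : mid < d.py q := not_le.1 h3
    have h5 : lo < d.py q := h1.trans h4
    simp [h3, h4, h5]

theorem stripSum_le (f : ℕ → ℕ) (r : ℕ) (lo hi : ℝ) :
    d.stripSum f r lo hi ≤ ∑ q ∈ Finset.range d.n, f q := by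
  rw [stripSum, Finset.range_eq_Ico]
  calc _ ≤ ∑ q ∈ Finset.Ico r d.n, f q := Finset.sum_le_sum fun q _ => by split_ifs <;> simp
    _ ≤ _ := Finset.sum_le_sum_of_subset (Finset.Ico_subset_Ico_left (Nat.zero_le _))

end StripSum

/-- The height of the upper end of a strip; `none` stands for the virtual backbone. -/
noncomputable def hiOf (d : Data) (ly : ℕ → ℝ) : Option ℕ → ℝ
  | none => d.top + d.Δ
  | some l => ly l

/-- The height of the lower end of a strip. -/
noncomputable def loOf (d : Data) (ly : ℕ → ℝ) : Option ℕ → ℝ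
  | none => d.bottom - d.Δ
  | some l => ly l

/-- The identifier of a backbone with candidate height `jl l`; `v` for the virtual backbone. -/
def idOf (d : Data) (v : ℕ) (jl lc : ℕ → ℕ) : Option ℕ → ℕ
  | none => v
  | some l => jl l + lc l * d.M

namespace Good

variable {cl : Clearance} {m : ℕ} {a birth : ℕ → ℕ} {ly : ℕ → ℝ} {lc : ℕ → ℕ}

theorem above_or_below_hi (g : d.Good cl d.n m a birth ly lc) (ok : d.Ok cl) {q : ℕ}
    (hq : q < d.n) {t : Option ℕ} (ht : ∀ l, t = some l → l < m ∧ birth l ≤ q)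
    (hne : t ≠ some (a q)) :
    (d.Δ ≤ d.hiOf ly t - d.py q ∧ d.Δ ≤ d.hiOf ly t - ly (a q)) ∨
      (d.hiOf ly t < d.py q ∧ d.hiOf ly t < ly (a q)) := by
  have hΔ := ok.Δ_pos
  match t with
  | none =>
    have := (ok.py_mem q hq).2
    have := (g.mem _ (g.a_lt q hq)).2
    refine .inl ⟨?_, ?_⟩ <;> simp only [hiOf] <;> linarith
  | some l =>
    obtain ⟨hl, hbl⟩ := ht l rfl
    have hla : l ≠ a q := fun h => hne (by rw [h])
    have h1 := g.clear q hq l hl hla hbl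
    have h2 := g.sep l hl _ (g.a_lt q hq) hla
    simp only [hiOf]
    rcases g.cross q hq l hl hla hbl with h | h
    · exact .inr h
    · rw [abs_of_neg (by linarith)] at h1
      rw [abs_of_pos (by linarith)] at h2
      exact .inl ⟨by linarith, by linarith⟩

theorem above_or_below_lo (g : d.Good cl d.n m a birth ly lc) (ok : d.Ok cl) {q : ℕ}
    (hq : q < d.n) {t : Option ℕ} (ht : ∀ l, t = some l → l < m ∧ birth l ≤ q)
    (hne : t ≠ some (a q)) :
    (d.Δ ≤ d.py q - d.loOf ly t ∧ d.Δ ≤ ly (a q) - d.loOf ly t) ∨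
      (d.py q < d.loOf ly t ∧ ly (a q) < d.loOf ly t) := by
  have hΔ := ok.Δ_pos
  match t with
  | none =>
    have := (ok.py_mem q hq).1
    have := (g.mem _ (g.a_lt q hq)).1
    refine .inl ⟨?_, ?_⟩ <;> simp only [loOf] <;> linarith
  | some l =>
    obtain ⟨hl, hbl⟩ := ht l rfl
    have hla : l ≠ a q := fun h => hne (by rw [h])
    have h1 := g.clear q hq l hl hla hbl
    have h2 := g.sep l hl _ (g.a_lt q hq) hla
    simp only [loOf]
    rcases g.cross q hq l hl hla hbl with h | h
    · rw [abs_of_pos (by linarith)] at h1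
      rw [abs_of_neg (by linarith)] at h2
      exact .inl ⟨by linarith, by linarith⟩
    · exact .inr h

/-- The cost of the point `q` in a labeling. -/
noncomputable def pointCost (d : Data) (a birth : ℕ → ℕ) (ly : ℕ → ℝ) (q : ℕ) : ℝ :=
  |d.py q - ly (a q)| + if birth (a q) = q then d.bc q else 0

/-- The contribution of the point `q` to the budget of class `c`. -/
noncomputable def pointBudget (d : Data) (a birth : ℕ → ℕ) (c q : ℕ) : ℕ :=
  if birth (a q) = q then d.notFirst c q else 0

theorem val_le_of_strip (g : d.Good cl d.n m a birth ly lc) (ok : d.Ok cl) {T : Table}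
    (hT : d.Solves T) {jl : ℕ → ℕ} (hjl : ∀ l, l < m → jl l < d.M ∧ d.Y (jl l) = ly l)
    (hbud : ∀ c, c < d.D → ∑ l ∈ Finset.range m, d.notFirst c (birth l) < d.k c)
    (k r : ℕ) (hk : r + k = d.n) (t b : Option ℕ)
    (ht : ∀ l, t = some l → l < m ∧ birth l < r) (hb : ∀ l, b = some l → l < m ∧ birth l < r)
    (hlt : d.loOf ly b < d.hiOf ly t)
    (hno : ∀ l, l < m → birth l < r → ¬ (d.loOf ly b < ly l ∧ ly l < d.hiOf ly t)) :
    T.kind r (d.idOf d.virtualTop jl lc t) (d.idOf d.virtualBottom jl lc b) (d.ι (d.code fun c =>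
        d.stripSum (pointBudget d a birth c) r (d.loOf ly b) (d.hiOf ly t))) ≠ 0 ∧
      T.val r (d.idOf d.virtualTop jl lc t) (d.idOf d.virtualBottom jl lc b) (d.ι (d.code fun c =>
        d.stripSum (pointBudget d a birth c) r (d.loOf ly b) (d.hiOf ly t))) ≤
      d.stripSum (pointCost d a birth ly) r (d.loOf ly b) (d.hiOf ly t) := by
  have hΔ := ok.Δ_pos
  have hbox : ∀ r lo hi c, c < d.D → d.stripSum (pointBudget d a birth c) r lo hi < d.k c :=
    fun r lo hi c hc => (stripSum_le _ r lo hi).trans_lt (by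
      simp only [pointBudget]
      rw [g.sum_birth]
      exact hbud c hc)
  have hι := fun r lo hi => ok.ι_code _ (hbox r lo hi)
  have hid : ∀ l, l < m → jl l + lc l * d.M < d.C * d.M ∧ d.hb (jl l + lc l * d.M) = ly l ∧
      d.cb (jl l + lc l * d.M) = lc l := fun l hl => by
    have h1 := hjl l hl
    have h2 : lc l < d.C := by
      have := g.a_col _ (g.birth_lt l hl)
      rw [g.a_birth l hl] at this
      rw [this]
      exact ok.pc_lt _ (g.birth_lt l hl)
    refine ⟨?_, by rw [ok.hb_eq _ h2 _ h1.1, h1.2], ok.cb_eq _ h2 _ h1.1⟩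
    calc _ < d.M + lc l * d.M := by omega
      _ = (lc l + 1) * d.M := by ring
      _ ≤ _ := Nat.mul_le_mul_right _ h2
  have hidT : d.idOf d.virtualTop jl lc t < d.C * d.M + 2 := by
    match t with
    | none => simp only [idOf, virtualTop]; omega
    | some l => have := (hid l (ht l rfl).1).1; simp only [idOf]; omega
  have hidB : d.idOf d.virtualBottom jl lc b < d.C * d.M + 2 := by
    match b with
    | none => simp only [idOf, virtualBottom]; omega
    | some l => have := (hid l (hb l rfl).1).1; simp only [idOf]; omega
  have hhT : d.hb (d.idOf d.virtualTop jl lc t) = d.hiOf ly t := by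
    match t with
    | none => exact ok.hb_top
    | some l => exact (hid l (ht l rfl).1).2.1
  have hhB : d.hb (d.idOf d.virtualBottom jl lc b) = d.loOf ly b := by
    match b with
    | none => exact ok.hb_bottom
    | some l => exact (hid l (hb l rfl).1).2.1
  induction k generalizing r t b with
  | zero =>
    obtain rfl : r = d.n := by omega
    simp only [stripSum_end, code_zero]
    have h0 : d.ι (d.code fun _ => 0) < d.B ∧ d.cd (d.ι (d.code fun _ => 0)) = d.code fun _ => 0 := by
      refine ok.ι_code _ fun c hc => ?_
      exact (Nat.zero_le _).trans_lt (hbud c hc)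
    rw [code_zero] at h0
    exact ⟨(hT.base_kind _ hidT _ hidB _ h0.1).2 h0.2, (hT.base_val _ hidT _ hidB _ h0.1).le⟩
  | succ k ih =>
    have hr : r < d.n := by omega
    have ht' : ∀ l, t = some l → l < m ∧ birth l < r + 1 :=
      fun l hl => ⟨(ht l hl).1, (ht l hl).2.trans (Nat.lt_succ_self r)⟩
    have hb' : ∀ l, b = some l → l < m ∧ birth l < r + 1 :=
      fun l hl => ⟨(hb l hl).1, (hb l hl).2.trans (Nat.lt_succ_self r)⟩
    have har := g.a_lt r hr
    have hbest := hT.step r hr _ hidT _ hidB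
    have hborn : ∀ l, l < m → birth l < r + 1 → birth l < r ∨ l = a r := fun l hl h => by
      rcases Nat.lt_succ_iff_lt_or_eq.1 h with h | h
      · exact .inl h
      · exact .inr (by rw [← h, g.a_birth l hl])
    have hin : d.InStrip r (d.idOf d.virtualTop jl lc t) (d.idOf d.virtualBottom jl lc b) ↔
        d.loOf ly b < d.py r ∧ d.py r ≤ d.hiOf ly t := by rw [InStrip, hhT, hhB]
    have htop := fun h => g.above_or_below_hi ok hr (t := t)
      (fun l hl => ⟨(ht l hl).1, (ht l hl).2.le⟩) h
    have hbot := fun h => g.above_or_below_lo ok hr (t := b)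
      (fun l hl => ⟨(hb l hl).1, (hb l hl).2.le⟩) h
    rcases (g.birth_le r hr).lt_or_eq with hbr | hbr
    · have hpc : pointCost d a birth ly r = |d.py r - ly (a r)| := by
        simp [pointCost, hbr.ne]
      have hpb : ∀ c, pointBudget d a birth c r = 0 := fun c => by simp [pointBudget, hbr.ne]
      have hno' : ∀ l, l < m → birth l < r + 1 → ¬ (d.loOf ly b < ly l ∧ ly l < d.hiOf ly t) :=
        fun l hl h => by
          rcases hborn l hl h with h | rfl
          · exact hno l hl h
          · exact hno _ hl hbr
      obtain ⟨h1, h2⟩ := ih (r + 1) (by omega) t b ht' hb' hlt hno' hidT hidB hhT hhB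
      by_cases hs : d.loOf ly b < d.py r ∧ d.py r ≤ d.hiOf ly t
      · simp only [stripSum_of_mem hr hs, hpc, hpb, zero_add]
        by_cases hta : t = some (a r)
        · have hlo : b ≠ some (a r) := by
            rintro rfl
            rw [hta] at hlt
            exact lt_irrefl _ hlt
          obtain ⟨h3, -⟩ : d.Δ ≤ d.py r - d.loOf ly b ∧ _ :=
            (hbot hlo).resolve_right fun h => by linarith [h.1, hs.1]
          have := (hbest _ (hι _ _ _).1).2 _ 0 0 0 _ (.up (hin.2 hs) (by
            rw [hta]; exact ((hid _ har).2.2.trans (g.a_col r hr)).symm) (by rwa [hhB]) h1)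
          refine ⟨this.1, this.2.trans ?_⟩
          have h4 : d.hiOf ly t = ly (a r) := by rw [hta]; rfl
          rw [hhT, abs_of_nonpos (by rw [← h4]; linarith [hs.2])]
          linarith
        · by_cases hba : b = some (a r)
          · obtain ⟨h3, -⟩ : d.Δ ≤ d.hiOf ly t - d.py r ∧ _ :=
              (htop hta).resolve_right fun h => by linarith [h.1, hs.2]
            have := (hbest _ (hι _ _ _).1).2 _ 0 0 0 _ (.down (hin.2 hs) (by
              rw [hba]; exact ((hid _ har).2.2.trans (g.a_col r hr)).symm) (by rwa [hhT]) h1)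
            refine ⟨this.1, this.2.trans ?_⟩
            have h4 : d.loOf ly b = ly (a r) := by rw [hba]; rfl
            rw [hhB, abs_of_nonneg (by rw [← h4]; linarith [hs.1])]
            linarith
          · exfalso
            have h3 := (htop hta).resolve_right fun h => by linarith [h.1, hs.2]
            have h4 := (hbot hba).resolve_right fun h => by linarith [h.1, hs.1]
            exact hno _ har hbr ⟨by linarith [h4.2], by linarith [h3.2]⟩
      · simp only [stripSum_of_not hr hs]
        have := (hbest _ (hι _ _ _).1).2 _ 0 0 0 _ (.pass (mt hin.1 hs) h1)
        exact ⟨this.1, this.2.trans h2⟩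
    · have hta : t ≠ some (a r) := fun h => by have := (ht _ h).2; omega
      have hba : b ≠ some (a r) := fun h => by have := (hb _ h).2; omega
      by_cases hs : d.loOf ly b < d.py r ∧ d.py r ≤ d.hiOf ly t
      · have h3 := (htop hta).resolve_right fun h => by linarith [h.1, hs.2]
        have h4 := (hbot hba).resolve_right fun h => by linarith [h.1, hs.1]
        have hmid : d.loOf ly b < ly (a r) ∧ ly (a r) < d.hiOf ly t :=
          ⟨by linarith [h4.2], by linarith [h3.2]⟩
        have hsome : ∀ l, some (a r) = some l → l < m ∧ birth l < r + 1 := by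
          rintro l ⟨⟩
          exact ⟨har, by omega⟩
        have hidr := hid _ har
        have hlcr := g.a_col r hr
        rw [hlcr] at hidr
        obtain ⟨k1, v1⟩ := ih (r + 1) (by omega) t (some (a r)) ht' hsome hmid.2
          (fun l hl h => by
            rcases hborn l hl h with h | rfl
            · exact fun h' => hno l hl h ⟨hmid.1.trans h'.1, h'.2⟩
            · exact fun h' => lt_irrefl _ h'.1) hidT (by simp only [idOf, hlcr]; omega) hhT
            (by simp only [idOf, hlcr]; exact hidr.2.1)
        obtain ⟨k2, v2⟩ := ih (r + 1) (by omega) (some (a r)) b hsome hb' hmid.1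
          (fun l hl h => by
            rcases hborn l hl h with h | rfl
            · exact fun h' => hno l hl h ⟨h'.1, h'.2.trans hmid.2⟩
            · exact fun h' => lt_irrefl _ h'.2) (by simp only [idOf, hlcr]; omega) hidB
            (by simp only [idOf, hlcr]; exact hidr.2.1) hhB
        set i' := d.ι (d.code fun c => d.stripSum (pointBudget d a birth c) (r + 1)
          (d.loOf ly (some (a r))) (d.hiOf ly t)) with hi'
        set i'' := d.ι (d.code fun c => d.stripSum (pointBudget d a birth c) (r + 1)
          (d.loOf ly b) (d.hiOf ly (some (a r)))) with hi''
        have hsum : d.cd i' + d.cd i'' + d.e r = d.code fun c =>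
            d.stripSum (pointBudget d a birth c) r (d.loOf ly b) (d.hiOf ly t) := by
          rw [(hι _ _ _).2, (hι _ _ _).2, ok.e_eq r hr, ← code_add, ← code_add]
          refine code_congr fun c _ => ?_
          rw [stripSum_of_mem hr hs, stripSum_split hmid.1 hmid.2]
          simp only [pointBudget, hbr, if_true]
          exact add_comm _ _
        have hj := hjl _ har
        have := (hbest _ (hι r (d.loOf ly b) (d.hiOf ly t)).1).2 _ _ _ _ _
          (.split (j := jl (a r)) (i' := i') (i'' := i'') (hin.2 hs) (by rw [hhB]; exact h4.1)
            (by rw [hhT]; exact h3.1) hj.1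
            ((ok.le_fst _ hj.1 r hr).2 fun hcl q hq => by
              rw [hj.2]
              exact g.clear_all hcl q (hq.trans hr) _ har (by omega))
            (by rw [hhT, hj.2]; exact h3.2) (by rw [hhB, hj.2]; exact h4.2)
            (hι _ _ _).1 (hι _ _ _).1 (by rw [hsum]; exact (hι _ _ _).2) (by rw [hsum])
            (by simpa only [idOf, hlcr] using k1) (by simpa only [idOf, hlcr] using k2))
        refine ⟨this.1, this.2.trans ?_⟩
        simp only [idOf, hlcr] at v1 v2
        rw [stripSum_of_mem hr hs, stripSum_split hmid.1 hmid.2, hj.2]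
        simp only [pointCost, hbr, if_true]
        simp only [idOf]
        change _ ≤ d.stripSum (pointCost d a birth ly) (r + 1) (ly (a r)) (d.hiOf ly t) at v1
        change _ ≤ d.stripSum (pointCost d a birth ly) (r + 1) (d.loOf ly b) (ly (a r)) at v2
        linarith
      · have hno' : ∀ l, l < m → birth l < r + 1 → ¬ (d.loOf ly b < ly l ∧ ly l < d.hiOf ly t) :=
          fun l hl h => by
            rcases hborn l hl h with h | rfl
            · exact hno l hl h
            · rintro ⟨h5, h6⟩
              have h3 := (htop hta).resolve_right fun h => by linarith [h.2]
              have h4 := (hbot hba).resolve_right fun h => by linarith [h.2]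
              exact hs ⟨by linarith [h4.1], by linarith [h3.1]⟩
        obtain ⟨h1, h2⟩ := ih (r + 1) (by omega) t b ht' hb' hlt hno' hidT hidB hhT hhB
        simp only [stripSum_of_not hr hs]
        have := (hbest _ (hι _ _ _).1).2 _ 0 0 0 _ (.pass (mt hin.1 hs) h1)
        exact ⟨this.1, this.2.trans h2⟩

theorem exists_val_le (g : d.Good cl d.n m a birth ly lc) (ok : d.Ok cl) (hn : 0 < d.n) {T : Table}
    (hT : d.Solves T) (hcand : ∀ l, l < m → ∃ j, j < d.M ∧ d.Y j = ly l)
    (hbud : ∀ c, c < d.D → ∑ l ∈ Finset.range m, d.notFirst c (birth l) < d.k c) :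
    ∃ i, i < d.B ∧ T.kind 0 d.virtualTop d.virtualBottom i ≠ 0 ∧
      T.val 0 d.virtualTop d.virtualBottom i ≤ d.len d.n m a birth ly := by
  have hΔ := ok.Δ_pos
  have hmem := ok.py_mem 0 hn
  choose! jl hjl using hcand
  obtain ⟨h1, h2⟩ := g.val_le_of_strip ok hT hjl hbud d.n 0 (by omega) none none
    (by simp) (by simp) (by simp only [loOf, hiOf]; linarith) (by simp)
  refine ⟨_, (ok.ι_code _ fun c hc => ?_).1, h1, h2.trans (le_of_eq ?_)⟩
  · refine (stripSum_le _ _ _ _).trans_lt ?_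
    simp only [pointBudget]
    rw [g.sum_birth]
    exact hbud c hc
  · rw [len, ← g.sum_birth, ← Finset.sum_add_distrib, stripSum, ← Finset.range_eq_Ico]
    refine Finset.sum_congr rfl fun q hq => ?_
    have := ok.py_mem q (Finset.mem_range.1 hq)
    exact if_pos ⟨by simp only [loOf]; linarith [this.1], by simp only [hiOf]; linarith [this.2]⟩

end Good

end Data

end BackboneLabeling

namespace BackboneLabeling

theorem sum_add_of_eq_of_ne {α ι : Type*} [AddCommMonoid α] [DecidableEq ι] {s : Finset ι} {k : ι}
    (hk : k ∈ s) {f f' : ι → α} (h : ∀ x ∈ s, x ≠ k → f' x = f x) :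
    ∑ x ∈ s, f' x + f k = ∑ x ∈ s, f x + f' k := by
  rw [← Finset.add_sum_erase s f' hk, ← Finset.add_sum_erase s f hk,
    Finset.sum_congr rfl fun x hx => h x (Finset.mem_of_mem_erase hx) (Finset.ne_of_mem_erase hx)]
  abel

namespace Data

variable {d : Data} {cl : Clearance} {r m : ℕ} {a birth : ℕ → ℕ} {ly : ℕ → ℝ} {lc : ℕ → ℕ}

theorem Good.connect (g : d.Good cl r m a birth ly lc) {l : ℕ} (hl : l < m) (hc : lc l = d.pc r)
    (hclear : ∀ l', l' < m → l' ≠ l → d.Δ ≤ |d.py r - ly l'|)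
    (hcross : ∀ l', l' < m → l' ≠ l →
      (ly l' < d.py r ∧ ly l' < ly l) ∨ (d.py r < ly l' ∧ ly l < ly l')) :
    d.Good cl (r + 1) m (Function.update a r l) birth ly lc := by
  have hq : ∀ q, q < r → Function.update a r l q = a q := fun q h => Function.update_of_ne h.ne _ _
  have hself : Function.update a r l r = l := Function.update_self ..
  have hcases : ∀ q, q < r + 1 → q < r ∨ q = r := fun q h => by omega
  refine ⟨g.mem, g.sep, fun l' h => (g.birth_lt l' h).trans (Nat.lt_succ_self r),
    fun l' h => by rw [hq _ (g.birth_lt l' h), g.a_birth l' h], ?_, ?_, ?_, ?_, ?_, ?_⟩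
  · intro q h
    rcases hcases q h with h | rfl
    · rw [hq q h]; exact g.a_lt q h
    · rwa [hself]
  · intro q h
    rcases hcases q h with h | rfl
    · rw [hq q h]; exact g.a_col q h
    · rwa [hself]
  · intro q h
    rcases hcases q h with h | rfl
    · rw [hq q h]; exact g.birth_le q h
    · rw [hself]; exact (g.birth_lt l hl).le
  · intro q h
    rcases hcases q h with h | rfl
    · rw [hq q h]; exact g.clear q h
    · rw [hself]; exact fun l' h1 h2 _ => hclear l' h1 h2
  · intro q h
    rcases hcases q h with h | rfl
    · rw [hq q h]; exact g.cross q h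
    · rw [hself]; exact fun l' h1 h2 _ => hcross l' h1 h2
  · intro hcl q h l' hl' hb
    have := g.birth_lt l' hl'
    exact g.clear_all hcl q (by omega) l' hl' hb

theorem Good.connect_new (g : d.Good cl r m a birth ly lc) {y : ℝ}
    (hy : d.bottom ≤ y ∧ y ≤ d.top) (hsep : ∀ l, l < m → d.Δ ≤ |y - ly l|)
    (hclear : ∀ l, l < m → d.Δ ≤ |d.py r - ly l|)
    (hcross : ∀ l, l < m → (ly l < d.py r ∧ ly l < y) ∨ (d.py r < ly l ∧ y < ly l))
    (hall : cl = .allPoints → ∀ q, q < r → d.Δ ≤ |d.py q - y|) :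
    d.Good cl (r + 1) (m + 1) (Function.update a r m) (Function.update birth m r)
      (Function.update ly m y) (Function.update lc m (d.pc r)) := by
  have hq : ∀ q, q < r → Function.update a r m q = a q := fun q h => Function.update_of_ne h.ne _ _
  have hself : Function.update a r m r = m := Function.update_self ..
  have hB : ∀ l, l < m → Function.update birth m r l = birth l :=
    fun q h => Function.update_of_ne h.ne _ _
  have hBs : Function.update birth m r m = r := Function.update_self ..
  have hY : ∀ l, l < m → Function.update ly m y l = ly l :=
    fun q h => Function.update_of_ne h.ne _ _
  have hYs : Function.update ly m y m = y := Function.update_self ..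
  have hC : ∀ l, l < m → Function.update lc m (d.pc r) l = lc l :=
    fun q h => Function.update_of_ne h.ne _ _
  have hCs : Function.update lc m (d.pc r) m = d.pc r := Function.update_self ..
  have hcases : ∀ q, q < r + 1 → q < r ∨ q = r := fun q h => by omega
  have hcases' : ∀ q, q < m + 1 → q < m ∨ q = m := fun q h => by omega
  refine ⟨?_, ?_, ?_, ?_, ?_, ?_, ?_, ?_, ?_, ?_⟩
  · intro l h
    rcases hcases' l h with h | rfl
    · rw [hY l h]; exact g.mem l h
    · rwa [hYs]
  · intro l h l' h' hne
    rcases hcases' l h with h | rfl <;> rcases hcases' l' h' with h' | rfl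
    · rw [hY l h, hY l' h']; exact g.sep l h l' h' hne
    · rw [hY l h, hYs, abs_sub_comm]; exact hsep l h
    · rw [hYs, hY l' h']; exact hsep l' h'
    · exact absurd rfl hne
  · intro l h
    rcases hcases' l h with h | rfl
    · rw [hB l h]; have := g.birth_lt l h; omega
    · rw [hBs]; omega
  · intro l h
    rcases hcases' l h with h | rfl
    · rw [hB l h, hq _ (g.birth_lt l h)]; exact g.a_birth l h
    · rw [hBs, hself]
  · intro q h
    rcases hcases q h with h | rfl
    · rw [hq q h]; have := g.a_lt q h; omega
    · rw [hself]; omega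
  · intro q h
    rcases hcases q h with h | rfl
    · rw [hq q h, hC _ (g.a_lt q h)]; exact g.a_col q h
    · rw [hself, hCs]
  · intro q h
    rcases hcases q h with h | rfl
    · rw [hq q h, hB _ (g.a_lt q h)]; exact g.birth_le q h
    · rw [hself, hBs]
  · intro q h l hl hne hb
    rcases hcases q h with h | rfl <;> rcases hcases' l hl with hl | rfl
    · rw [hq q h] at hne; rw [hB l hl] at hb; rw [hY l hl]; exact g.clear q h l hl hne hb
    · rw [hBs] at hb; omega
    · rw [hY l hl]; exact hclear l hl
    · exact absurd hself.symm hne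
  · intro q h l hl hne hb
    rcases hcases q h with h | rfl <;> rcases hcases' l hl with hl | rfl
    · rw [hq q h] at hne ⊢; rw [hB l hl] at hb; rw [hY l hl, hY _ (g.a_lt q h)]
      exact g.cross q h l hl hne hb
    · rw [hBs] at hb; omega
    · rw [hY l hl, hself, hYs]; exact hcross l hl
    · exact absurd hself.symm hne
  · intro hcl q h l hl hb
    rcases hcases' l hl with hl | rfl
    · rw [hB l hl] at hb
      have := g.birth_lt l hl
      rw [hY l hl]
      exact g.clear_all hcl q (by omega) l hl hb
    · rw [hBs] at hb
      rw [hYs]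
      exact hall hcl q hb

theorem len_connect {l : ℕ} :
    d.len (r + 1) m (Function.update a r l) birth ly =
      d.len r m a birth ly + |d.py r - ly l| := by
  rw [len, len, Finset.sum_range_succ, Function.update_self,
    Finset.sum_congr rfl fun q hq => by
      rw [Function.update_of_ne (Finset.mem_range.1 hq).ne]]
  ring

theorem Good.len_connect_new (g : d.Good cl r m a birth ly lc) {y : ℝ} :
    d.len (r + 1) (m + 1) (Function.update a r m) (Function.update birth m r)
      (Function.update ly m y) = d.len r m a birth ly + (|d.py r - y| + d.bc r) := by
  rw [len, len, Finset.sum_range_succ, Finset.sum_range_succ, Function.update_self,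
    Function.update_self, Function.update_self,
    Finset.sum_congr rfl fun q hq => by
      rw [Function.update_of_ne (Finset.mem_range.1 hq).ne,
        Function.update_of_ne (g.a_lt q (Finset.mem_range.1 hq)).ne],
    Finset.sum_congr (s₁ := Finset.range m) rfl fun l hl => by
      rw [Function.update_of_ne (Finset.mem_range.1 hl).ne]]
  ring

end Data

/-- A state of the reconstruction of a labeling: a labeling of the first points, and the strips
between its backbones, each with its upper and lower backbone, their labels and a budget. -/
structure Sweep where
  numLabels : ℕ
  numStrips : ℕ
  assign : ℕ → ℕ
  birth : ℕ → ℕ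
  height : ℕ → ℝ
  color : ℕ → ℕ
  upper : ℕ → ℕ
  lower : ℕ → ℕ
  upperLabel : ℕ → ℕ
  lowerLabel : ℕ → ℕ
  budget : ℕ → ℕ

namespace Sweep

variable {d : Data} {cl : Clearance} {T : Table} {vec : ℕ → ℕ → ℕ} {V : ℝ} {U : ℕ → ℕ} {r k : ℕ}
  {σ : Sweep}

/-- The next state if the point `r` is connected to the label `l`. -/
def connect (σ : Sweep) (r l : ℕ) : Sweep := { σ with assign := Function.update σ.assign r l }

/-- The next state if the point `r` is connected to a new label of color `c` with the backbone `b`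
at height `y`, which splits the strip `k` into strips with budgets `i'` and `i''`. -/
noncomputable def split (σ : Sweep) (r k b c : ℕ) (y : ℝ) (i' i'' : ℕ) : Sweep where
  numLabels := σ.numLabels + 1
  numStrips := σ.numStrips + 1
  assign := Function.update σ.assign r σ.numLabels
  birth := Function.update σ.birth σ.numLabels r
  height := Function.update σ.height σ.numLabels y
  color := Function.update σ.color σ.numLabels c
  upper := Function.update σ.upper σ.numStrips b
  lower := Function.update (Function.update σ.lower σ.numStrips (σ.lower k)) k b
  upperLabel := Function.update σ.upperLabel σ.numStrips σ.numLabels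
  lowerLabel :=
    Function.update (Function.update σ.lowerLabel σ.numStrips (σ.lowerLabel k)) k σ.numLabels
  budget := Function.update (Function.update σ.budget σ.numStrips i'') k i'

/-- The state describes an initial part of an optimal solution: `V` is the optimal value and `U`
the budget. -/
structure Inv (d : Data) (cl : Clearance) (T : Table) (vec : ℕ → ℕ → ℕ) (V : ℝ) (U : ℕ → ℕ) (r : ℕ)
    (σ : Sweep) : Prop where
  good : d.Good cl r σ.numLabels σ.assign σ.birth σ.height σ.color
  upper_lt : ∀ k, k < σ.numStrips → σ.upper k < d.C * d.M + 2
  lower_lt : ∀ k, k < σ.numStrips → σ.lower k < d.C * d.M + 2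
  upper_eq : ∀ k, k < σ.numStrips → σ.upper k = d.virtualTop ∨
    (σ.upperLabel k < σ.numLabels ∧ d.hb (σ.upper k) = σ.height (σ.upperLabel k) ∧
      d.cb (σ.upper k) = σ.color (σ.upperLabel k))
  lower_eq : ∀ k, k < σ.numStrips → σ.lower k = d.virtualBottom ∨
    (σ.lowerLabel k < σ.numLabels ∧ d.hb (σ.lower k) = σ.height (σ.lowerLabel k) ∧
      d.cb (σ.lower k) = σ.color (σ.lowerLabel k))
  no_label : ∀ k, k < σ.numStrips → ∀ l, l < σ.numLabels →
    ¬ (d.hb (σ.lower k) < σ.height l ∧ σ.height l < d.hb (σ.upper k))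
  cover : ∀ h, d.bottom - d.Δ < h → h ≤ d.top + d.Δ →
    ∃ k, k < σ.numStrips ∧ d.hb (σ.lower k) < h ∧ h ≤ d.hb (σ.upper k)
  disj : ∀ k, k < σ.numStrips → ∀ k', k' < σ.numStrips → ∀ h,
    d.hb (σ.lower k) < h ∧ h ≤ d.hb (σ.upper k) →
    d.hb (σ.lower k') < h ∧ h ≤ d.hb (σ.upper k') → k = k'
  budget_lt : ∀ k, k < σ.numStrips → σ.budget k < d.B
  feasible : ∀ k, k < σ.numStrips → T.kind r (σ.upper k) (σ.lower k) (σ.budget k) ≠ 0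
  value : ∑ k ∈ Finset.range σ.numStrips, T.val r (σ.upper k) (σ.lower k) (σ.budget k) +
    d.len r σ.numLabels σ.assign σ.birth σ.height = V
  count : ∀ c, c < d.D → ∑ k ∈ Finset.range σ.numStrips, vec (σ.budget k) c +
    ∑ l ∈ Finset.range σ.numLabels, d.notFirst c (σ.birth l) = U c

namespace Inv

/-- Labels are far above or below a strip, unless they bound it. -/
theorem label_cases (h : Inv d cl T vec V U r σ) (ok : d.Ok cl) (hk : k < σ.numStrips) {l : ℕ}
    (hl : l < σ.numLabels) :
    (d.hb (σ.upper k) ≤ σ.height l ∧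
      (l = σ.upperLabel k ∨ d.hb (σ.upper k) + d.Δ ≤ σ.height l)) ∨
    (σ.height l ≤ d.hb (σ.lower k) ∧
      (l = σ.lowerLabel k ∨ σ.height l + d.Δ ≤ d.hb (σ.lower k))) := by
  have hΔ := ok.Δ_pos
  have hm := h.good.mem l hl
  have := h.no_label k hk l hl
  rw [not_and_or, not_lt, not_lt] at this
  rcases this with h1 | h1
  · refine .inr ⟨h1, ?_⟩
    rcases h.lower_eq k hk with h2 | ⟨h2, h3, -⟩
    · rw [h2, ok.hb_bottom] at h1
      linarith
    · by_cases hne : l = σ.lowerLabel k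
      · exact .inl hne
      · have := h.good.sep l hl _ h2 hne
        rw [← h3, abs_of_nonpos (by linarith)] at this
        exact .inr (by linarith)
  · refine .inl ⟨h1, ?_⟩
    rcases h.upper_eq k hk with h2 | ⟨h2, h3, -⟩
    · rw [h2, ok.hb_top] at h1
      linarith
    · by_cases hne : l = σ.upperLabel k
      · exact .inl hne
      · have := h.good.sep l hl _ h2 hne
        rw [← h3, abs_of_nonneg (by linarith)] at this
        exact .inr (by linarith)

/-- Strips that do not contain the point `r` do not change. -/
theorem pass (h : Inv d cl T vec V U r σ) (hT : d.Solves T) (hr : r < d.n)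
    (hk : k < σ.numStrips) (hin : ¬ d.InStrip r (σ.upper k) (σ.lower k)) :
    T.kind (r + 1) (σ.upper k) (σ.lower k) (σ.budget k) ≠ 0 ∧
      T.val (r + 1) (σ.upper k) (σ.lower k) (σ.budget k) =
        T.val r (σ.upper k) (σ.lower k) (σ.budget k) := by
  have := (hT.step r hr _ (h.upper_lt k hk) _ (h.lower_lt k hk) _ (h.budget_lt k hk)).1
    (h.feasible k hk)
  generalize T.val r (σ.upper k) (σ.lower k) (σ.budget k) = v at this ⊢
  generalize T.kind r (σ.upper k) (σ.lower k) (σ.budget k) = κ at this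
  cases this with
  | pass h1 h2 => exact ⟨h2, rfl⟩
  | up h1 => exact absurd h1 hin
  | down h1 => exact absurd h1 hin
  | split h1 => exact absurd h1 hin

theorem exists_strip (h : Inv d cl T vec V U r σ) (ok : d.Ok cl) (hr : r < d.n) :
    ∃ k, k < σ.numStrips ∧ d.InStrip r (σ.upper k) (σ.lower k) ∧
      ∀ k', k' < σ.numStrips → d.InStrip r (σ.upper k') (σ.lower k') → k' = k := by
  have hΔ := ok.Δ_pos
  have hm := ok.py_mem r hr
  obtain ⟨k, hk, hin⟩ := h.cover (d.py r) (by linarith) (by linarith)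
  exact ⟨k, hk, hin, fun k' hk' h' => h.disj k' hk' k hk _ h' hin⟩

theorem connect (h : Inv d cl T vec V U r σ) (hT : d.Solves T) (hr : r < d.n)
    (hk : k < σ.numStrips) (hin : d.InStrip r (σ.upper k) (σ.lower k)) {l : ℕ}
    (g : d.Good cl (r + 1) σ.numLabels (Function.update σ.assign r l) σ.birth σ.height σ.color)
    (hkind : T.kind (r + 1) (σ.upper k) (σ.lower k) (σ.budget k) ≠ 0)
    (hval : T.val r (σ.upper k) (σ.lower k) (σ.budget k) =
      T.val (r + 1) (σ.upper k) (σ.lower k) (σ.budget k) + |d.py r - σ.height l|) :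
    Inv d cl T vec V U (r + 1) (σ.connect r l) := by
  have hpass : ∀ k', k' < σ.numStrips → k' ≠ k → _ := fun k' hk' hne =>
    h.pass hT hr hk' fun h' => hne (h.disj k' hk' k hk _ h' hin)
  refine ⟨g, h.upper_lt, h.lower_lt, h.upper_eq, h.lower_eq, h.no_label, h.cover, h.disj,
    h.budget_lt, ?_, ?_, h.count⟩
  · intro k' hk'
    by_cases hne : k' = k
    · rw [hne]; exact hkind
    · exact (hpass k' hk' hne).1
  · have e1 := sum_add_of_eq_of_ne (Finset.mem_range.2 hk)
      (f := fun k => T.val r (σ.upper k) (σ.lower k) (σ.budget k))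
      (f' := fun k => T.val (r + 1) (σ.upper k) (σ.lower k) (σ.budget k))
      fun k' hk' hne => (hpass k' (Finset.mem_range.1 hk') hne).2
    simp only [Sweep.connect]
    rw [Data.len_connect, ← h.value]
    simp only [hval] at e1
    linarith

theorem connect_up (h : Inv d cl T vec V U r σ) (ok : d.Ok cl) (hT : d.Solves T) (hr : r < d.n)
    (hk : k < σ.numStrips) (hin : d.InStrip r (σ.upper k) (σ.lower k))
    (hkind : T.kind r (σ.upper k) (σ.lower k) (σ.budget k) = 2) :
    Inv d cl T vec V U (r + 1) (σ.connect r (σ.upperLabel k)) := by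
  have hΔ := ok.Δ_pos
  have hc := (hT.step r hr _ (h.upper_lt k hk) _ (h.lower_lt k hk) _ (h.budget_lt k hk)).1
    (h.feasible k hk)
  rw [hkind] at hc
  generalize hv : T.val r (σ.upper k) (σ.lower k) (σ.budget k) = v at hc
  cases hc with
  | up _ hcol hcl hk' =>
    obtain ⟨h1, h2, h3⟩ := (h.upper_eq k hk).resolve_left fun h' => by
      rw [h', ok.cb_top] at hcol
      exact (ok.pc_lt r hr).ne hcol
    have hlab : ∀ l, l < σ.numLabels → l ≠ σ.upperLabel k →
        d.hb (σ.upper k) + d.Δ ≤ σ.height l ∨ σ.height l ≤ d.hb (σ.lower k) := fun l hl hne =>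
      (h.label_cases ok hk hl).imp (fun h' => h'.2.resolve_left hne) fun h' => h'.1
    have ⟨hin1, hin2⟩ := hin
    refine h.connect hT hr hk hin (h.good.connect h1 (h3.symm.trans hcol.symm) ?_ ?_) hk' ?_
    · intro l hl hne
      rcases hlab l hl hne with h4 | h4
      · rw [abs_of_nonpos (by linarith)]; linarith
      · rw [abs_of_nonneg (by linarith)]; linarith
    · intro l hl hne
      rcases hlab l hl hne with h4 | h4
      · exact .inr ⟨by linarith, by linarith⟩
      · exact .inl ⟨by linarith, by linarith⟩
    · rw [hv, ← h2, abs_of_nonpos (by linarith)]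
      ring

theorem connect_down (h : Inv d cl T vec V U r σ) (ok : d.Ok cl) (hT : d.Solves T) (hr : r < d.n)
    (hk : k < σ.numStrips) (hin : d.InStrip r (σ.upper k) (σ.lower k))
    (hkind : T.kind r (σ.upper k) (σ.lower k) (σ.budget k) = 3) :
    Inv d cl T vec V U (r + 1) (σ.connect r (σ.lowerLabel k)) := by
  have hΔ := ok.Δ_pos
  have hc := (hT.step r hr _ (h.upper_lt k hk) _ (h.lower_lt k hk) _ (h.budget_lt k hk)).1
    (h.feasible k hk)
  rw [hkind] at hc
  generalize hv : T.val r (σ.upper k) (σ.lower k) (σ.budget k) = v at hc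
  cases hc with
  | down _ hcol hcl hk' =>
    obtain ⟨h1, h2, h3⟩ := (h.lower_eq k hk).resolve_left fun h' => by
      rw [h', ok.cb_bottom] at hcol
      exact (ok.pc_lt r hr).ne hcol
    have hlab : ∀ l, l < σ.numLabels → l ≠ σ.lowerLabel k →
        d.hb (σ.upper k) ≤ σ.height l ∨ σ.height l + d.Δ ≤ d.hb (σ.lower k) := fun l hl hne =>
      (h.label_cases ok hk hl).imp (fun h' => h'.1) fun h' => h'.2.resolve_left hne
    have ⟨hin1, hin2⟩ := hin
    refine h.connect hT hr hk hin (h.good.connect h1 (h3.symm.trans hcol.symm) ?_ ?_) hk' ?_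
    · intro l hl hne
      rcases hlab l hl hne with h4 | h4
      · rw [abs_of_nonpos (by linarith)]; linarith
      · rw [abs_of_nonneg (by linarith)]; linarith
    · intro l hl hne
      rcases hlab l hl hne with h4 | h4
      · exact .inr ⟨by linarith, by linarith⟩
      · exact .inl ⟨by linarith, by linarith⟩
    · rw [hv, ← h2, abs_of_nonneg (by linarith)]

theorem split (h : Inv d cl T vec V U r σ) (ok : d.Ok cl) (hT : d.Solves T)
    (hvec : ∀ i, i < d.B → (∀ c, c < d.D → vec i c < d.k c) ∧ d.cd i = d.code (vec i))
    (hr : r < d.n) (hk : k < σ.numStrips) (hin : d.InStrip r (σ.upper k) (σ.lower k))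
    (h2 : T.kind r (σ.upper k) (σ.lower k) (σ.budget k) ≠ 2)
    (h3 : T.kind r (σ.upper k) (σ.lower k) (σ.budget k) ≠ 3) :
    Inv d cl T vec V U (r + 1) (σ.split r k
      (T.cand r (σ.upper k) (σ.lower k) (σ.budget k) + d.pc r * d.M) (d.pc r)
      (d.Y (T.cand r (σ.upper k) (σ.lower k) (σ.budget k)))
      (T.upper r (σ.upper k) (σ.lower k) (σ.budget k))
      (T.lower r (σ.upper k) (σ.lower k) (σ.budget k))) := by
  have hΔ := ok.Δ_pos
  have hc := (hT.step r hr _ (h.upper_lt k hk) _ (h.lower_lt k hk) _ (h.budget_lt k hk)).1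
    (h.feasible k hk)
  have hpass : ∀ k', k' < σ.numStrips → k' ≠ k → _ := fun k' hk' hne =>
    h.pass hT hr hk' fun h' => hne (h.disj k' hk' k hk _ h' hin)
  have hbig := h.budget_lt k hk
  generalize hv : T.val r (σ.upper k) (σ.lower k) (σ.budget k) = v at hc
  generalize T.cand r (σ.upper k) (σ.lower k) (σ.budget k) = j at hc ⊢
  generalize T.upper r (σ.upper k) (σ.lower k) (σ.budget k) = i' at hc ⊢
  generalize T.lower r (σ.upper k) (σ.lower k) (σ.budget k) = i'' at hc ⊢
  generalize T.kind r (σ.upper k) (σ.lower k) (σ.budget k) = κ at hc h2 h3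
  cases hc with
  | pass h1 => exact absurd hin h1
  | up => exact absurd rfl h2
  | down => exact absurd rfl h3
  | split _ g1 g2 g3 g4 g5 g6 g7 g8 g9 g10 g11 g12 =>
    have hpc := ok.pc_lt r hr
    have hhb := ok.hb_eq _ hpc _ g3
    have hcb := ok.cb_eq _ hpc _ g3
    have hid : j + d.pc r * d.M < d.C * d.M + 2 := by
      have : (d.pc r + 1) * d.M ≤ d.C * d.M := Nat.mul_le_mul_right _ hpc
      rw [add_mul] at this
      omega
    set b := j + d.pc r * d.M with hb
    have hlab : ∀ l, l < σ.numLabels →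
        d.hb (σ.upper k) ≤ σ.height l ∨ σ.height l ≤ d.hb (σ.lower k) := fun l hl =>
      (h.label_cases ok hk hl).imp And.left And.left
    have hmem : d.bottom ≤ d.Y j ∧ d.Y j ≤ d.top := by
      constructor
      · rcases h.lower_eq k hk with h4 | ⟨h4, h5, -⟩
        · rw [h4, ok.hb_bottom] at g6; linarith
        · have := (h.good.mem _ h4).1; linarith
      · rcases h.upper_eq k hk with h4 | ⟨h4, h5, -⟩
        · rw [h4, ok.hb_top] at g5; linarith
        · have := (h.good.mem _ h4).2; linarith
    have hsum : ∀ c, c < d.D →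
        vec (σ.budget k) c = vec i' c + vec i'' c + d.notFirst c r := by
      refine ok.code_inj _ _ (fun c hc => ?_) (fun c hc => ?_) ?_
      · have := (hvec _ hbig).1 c hc; omega
      · have e1 := (hvec _ g7).1 c hc
        have e2 := (hvec _ g8).1 c hc
        have e3 : d.notFirst c r ≤ 1 := by unfold Data.notFirst; split_ifs <;> simp
        omega
      · rw [← (hvec _ hbig).2, g10, g9, Data.code_add (fun c => vec i' c + vec i'' c),
          Data.code_add, ← (hvec _ g7).2, ← (hvec _ g8).2, ok.e_eq r hr]
    have hcases : ∀ k', k' < σ.numStrips + 1 → k' = k ∨ (k' < σ.numStrips ∧ k' ≠ k) ∨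
        k' = σ.numStrips := fun k' hk' => by omega
    have hkn : k ≠ σ.numStrips := hk.ne
    have su : ∀ k', k' < σ.numStrips → Function.update σ.upper σ.numStrips b k' = σ.upper k' :=
      fun k' hk' => Function.update_of_ne hk'.ne _ _
    have lu : ∀ k', k' < σ.numStrips → k' ≠ k →
        Function.update (Function.update σ.lower σ.numStrips (σ.lower k)) k b k' = σ.lower k' :=
      fun k' hk' hne => by rw [Function.update_of_ne hne, Function.update_of_ne hk'.ne]
    have bu : ∀ k', k' < σ.numStrips → k' ≠ k →
        Function.update (Function.update σ.budget σ.numStrips i'') k i' k' = σ.budget k' :=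
      fun k' hk' hne => by rw [Function.update_of_ne hne, Function.update_of_ne hk'.ne]
    have hh : ∀ l, l < σ.numLabels →
        Function.update σ.height σ.numLabels (d.Y j) l = σ.height l :=
      fun l hl => Function.update_of_ne hl.ne _ _
    have hcu : ∀ l, l < σ.numLabels →
        Function.update σ.color σ.numLabels (d.pc r) l = σ.color l :=
      fun l hl => Function.update_of_ne hl.ne _ _
    refine ⟨?_, ?_, ?_, ?_, ?_, ?_, ?_, ?_, ?_, ?_, ?_, ?_⟩
    · refine h.good.connect_new hmem ?_ ?_ ?_ ?_
      · intro l hl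
        rcases hlab l hl with h4 | h4
        · rw [abs_of_nonpos (by linarith)]; linarith
        · rw [abs_of_nonneg (by linarith)]; linarith
      · intro l hl
        rcases hlab l hl with h4 | h4
        · rw [abs_of_nonpos (by linarith)]; linarith
        · rw [abs_of_nonneg (by linarith)]; linarith
      · intro l hl
        rcases hlab l hl with h4 | h4
        · exact .inr ⟨by linarith, by linarith⟩
        · exact .inl ⟨by linarith, by linarith⟩
      · exact (ok.le_fst j g3 r hr).1 g4
    · intro k' hk'
      simp only [Sweep.split]
      rcases hcases k' hk' with rfl | ⟨h4, h5⟩ | rfl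
      · rw [su _ hk]; exact h.upper_lt _ hk
      · rw [su _ h4]; exact h.upper_lt _ h4
      · rw [Function.update_self]; exact hid
    · intro k' hk'
      simp only [Sweep.split]
      rcases hcases k' hk' with rfl | ⟨h4, h5⟩ | rfl
      · rw [Function.update_self]; exact hid
      · rw [lu _ h4 h5]; exact h.lower_lt _ h4
      · rw [Function.update_of_ne hkn.symm, Function.update_self]; exact h.lower_lt _ hk
    · have key : ∀ k', k' < σ.numStrips → σ.upper k' = d.virtualTop ∨
          (σ.upperLabel k' < σ.numLabels + 1 ∧ d.hb (σ.upper k') =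
            Function.update σ.height σ.numLabels (d.Y j) (σ.upperLabel k') ∧
          d.cb (σ.upper k') =
            Function.update σ.color σ.numLabels (d.pc r) (σ.upperLabel k')) := fun k' h4 => by
        refine (h.upper_eq k' h4).imp id fun h6 => ?_
        rw [hh _ h6.1, hcu _ h6.1]
        exact ⟨by omega, h6.2⟩
      intro k' hk'
      replace hk' : k' < σ.numStrips + 1 := hk'
      simp only [Sweep.split]
      by_cases h4 : k' = σ.numStrips
      · subst h4
        rw [Function.update_self, Function.update_self, Function.update_self, Function.update_self]
        exact .inr ⟨by omega, hhb, hcb⟩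
      · rw [Function.update_of_ne h4, Function.update_of_ne h4]
        exact key k' (by omega)
    · have key : ∀ k', k' < σ.numStrips → σ.lower k' = d.virtualBottom ∨
          (σ.lowerLabel k' < σ.numLabels + 1 ∧ d.hb (σ.lower k') =
            Function.update σ.height σ.numLabels (d.Y j) (σ.lowerLabel k') ∧
          d.cb (σ.lower k') =
            Function.update σ.color σ.numLabels (d.pc r) (σ.lowerLabel k')) := fun k' h4 => by
        refine (h.lower_eq k' h4).imp id fun h6 => ?_
        rw [hh _ h6.1, hcu _ h6.1]
        exact ⟨by omega, h6.2⟩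
      intro k' hk'
      simp only [Sweep.split]
      rcases hcases k' hk' with rfl | ⟨h4, h5⟩ | rfl
      · rw [Function.update_self, Function.update_self, Function.update_self, Function.update_self]
        exact .inr ⟨by omega, hhb, hcb⟩
      · rw [lu _ h4 h5, Function.update_of_ne h5, Function.update_of_ne h4.ne]
        exact key k' h4
      · rw [Function.update_of_ne hkn.symm, Function.update_self, Function.update_of_ne hkn.symm,
          Function.update_self]
        exact key k hk
    · intro k' hk' l hl
      simp only [Sweep.split] at hl ⊢
      rcases Nat.lt_succ_iff_lt_or_eq.1 hl with hl | rfl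
      · rw [hh l hl]
        rcases hcases k' hk' with rfl | ⟨h4, h5⟩ | rfl
        · rw [su _ hk, Function.update_self, hhb]
          exact fun h' => h.no_label _ hk l hl ⟨by linarith [h'.1], h'.2⟩
        · rw [su _ h4, lu _ h4 h5]; exact h.no_label _ h4 l hl
        · rw [Function.update_self, Function.update_of_ne hkn.symm, Function.update_self, hhb]
          exact fun h' => h.no_label _ hk l hl ⟨h'.1, by linarith [h'.2]⟩
      · rw [Function.update_self]
        rcases hcases k' hk' with rfl | ⟨h4, h5⟩ | rfl
        · rw [Function.update_self, hhb]
          exact fun h' => lt_irrefl _ h'.1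
        · rw [su _ h4, lu _ h4 h5]
          exact fun h' => h5 (h.disj k' h4 k hk _ ⟨h'.1, h'.2.le⟩ ⟨by linarith, by linarith⟩)
        · rw [Function.update_self, hhb]
          exact fun h' => lt_irrefl _ h'.2
    · intro y h4 h5
      obtain ⟨k', hk', h6, h7⟩ := h.cover y h4 h5
      simp only [Sweep.split]
      by_cases hne : k' = k
      · subst hne
        by_cases hy : y ≤ d.Y j
        · refine ⟨σ.numStrips, by omega, ?_⟩
          rw [Function.update_self, Function.update_of_ne hkn.symm, Function.update_self, hhb]
          exact ⟨h6, hy⟩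
        · refine ⟨k', by omega, ?_⟩
          rw [su _ hk, Function.update_self, hhb]
          exact ⟨not_le.1 hy, h7⟩
      · refine ⟨k', by omega, ?_⟩
        rw [su _ hk', lu _ hk' hne]
        exact ⟨h6, h7⟩
    · have key : ∀ k', k' < σ.numStrips + 1 → ∀ y,
          d.hb (Function.update (Function.update σ.lower σ.numStrips (σ.lower k)) k b k') < y ∧
            y ≤ d.hb (Function.update σ.upper σ.numStrips b k') →
          (k' = k ∧ d.Y j < y ∧ d.hb (σ.lower k) < y ∧ y ≤ d.hb (σ.upper k)) ∨
          (k' = σ.numStrips ∧ y ≤ d.Y j ∧ d.hb (σ.lower k) < y ∧ y ≤ d.hb (σ.upper k)) ∨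
          (k' < σ.numStrips ∧ k' ≠ k ∧ d.hb (σ.lower k') < y ∧ y ≤ d.hb (σ.upper k')) := by
        intro k' hk' y
        rcases hcases k' hk' with rfl | ⟨h4, h5⟩ | rfl
        · rw [su _ hk, Function.update_self, hhb]
          exact fun h' => .inl ⟨rfl, h'.1, by linarith [h'.1], h'.2⟩
        · rw [su _ h4, lu _ h4 h5]; exact fun h' => .inr (.inr ⟨h4, h5, h'⟩)
        · rw [Function.update_self, Function.update_of_ne hkn.symm, Function.update_self, hhb]
          exact fun h' => .inr (.inl ⟨rfl, h'.2, h'.1, by linarith [h'.2]⟩)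
      intro k₁ hk₁ k₂ hk₂ y h4 h5
      rcases key k₁ hk₁ y h4 with ⟨e, e1, e2⟩ | ⟨e, e1, e2⟩ | ⟨e, e1, e2⟩ <;>
        rcases key k₂ hk₂ y h5 with ⟨f, f1, f2⟩ | ⟨f, f1, f2⟩ | ⟨f, f1, f2⟩
      · rw [e, f]
      · linarith
      · exact absurd (h.disj _ f _ hk y f2 e2) f1
      · linarith
      · rw [e, f]
      · exact absurd (h.disj _ f _ hk y f2 e2) f1
      · exact absurd (h.disj _ e _ hk y e2 f2) e1
      · exact absurd (h.disj _ e _ hk y e2 f2) e1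
      · exact h.disj _ e _ f y e2 f2
    · intro k' hk'
      simp only [Sweep.split]
      rcases hcases k' hk' with rfl | ⟨h4, h5⟩ | rfl
      · rw [Function.update_self]; exact g7
      · rw [bu _ h4 h5]; exact h.budget_lt _ h4
      · rw [Function.update_of_ne hkn.symm, Function.update_self]; exact g8
    · intro k' hk'
      simp only [Sweep.split]
      rcases hcases k' hk' with rfl | ⟨h4, h5⟩ | rfl
      · rw [su _ hk, Function.update_self, Function.update_self]; exact g11
      · rw [su _ h4, lu _ h4 h5, bu _ h4 h5]; exact (hpass _ h4 h5).1
      · rw [Function.update_self, Function.update_of_ne hkn.symm, Function.update_self,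
          Function.update_of_ne hkn.symm, Function.update_self]
        exact g12
    · have e1 := sum_add_of_eq_of_ne (Finset.mem_range.2 hk)
        (f := fun k => T.val r (σ.upper k) (σ.lower k) (σ.budget k))
        (f' := fun k' => T.val (r + 1) (Function.update σ.upper σ.numStrips b k')
          (Function.update (Function.update σ.lower σ.numStrips (σ.lower k)) k b k')
          (Function.update (Function.update σ.budget σ.numStrips i'') k i' k'))
        fun k' hk' hne => by
          rw [Finset.mem_range] at hk'
          rw [su _ hk', lu _ hk' hne, bu _ hk' hne]
          exact (hpass k' hk' hne).2
      simp only [Sweep.split]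
      rw [h.good.len_connect_new, ← h.value, Finset.sum_range_succ]
      simp only [su _ hk, Function.update_self, Function.update_of_ne hkn.symm, hv] at e1 ⊢
      linarith
    · intro c hc
      have e1 := sum_add_of_eq_of_ne (Finset.mem_range.2 hk)
        (f := fun k => vec (σ.budget k) c)
        (f' := fun k' => vec (Function.update (Function.update σ.budget σ.numStrips i'') k i' k') c)
        fun k' hk' hne => by
          rw [Finset.mem_range] at hk'
          rw [bu _ hk' hne]
      have e2 := hsum c hc
      simp only [Sweep.split]
      rw [← h.count c hc, Finset.sum_range_succ, Finset.sum_range_succ, Function.update_self,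
        Finset.sum_congr (s₁ := Finset.range σ.numLabels) rfl fun l hl => by
          rw [Function.update_of_ne (Finset.mem_range.1 hl).ne]]
      simp only [Function.update_self, Function.update_of_ne hkn.symm] at e1 ⊢
      omega

/-- The initial state satisfies the invariant. -/
theorem init (ok : d.Ok cl) {i : ℕ} (hi : i < d.B)
    (hkind : T.kind 0 d.virtualTop d.virtualBottom i ≠ 0) (hσl : σ.numLabels = 0)
    (hσs : σ.numStrips = 1) (hu : σ.upper 0 = d.virtualTop) (hl : σ.lower 0 = d.virtualBottom)
    (hb : σ.budget 0 = i) :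
    Inv d cl T vec (T.val 0 d.virtualTop d.virtualBottom i) (vec i) 0 σ := by
  have hz : ∀ {k}, k < σ.numStrips → k = 0 := fun h => by omega
  refine ⟨⟨?_, ?_, ?_, ?_, ?_, ?_, ?_, ?_, ?_, ?_⟩, ?_, ?_, ?_, ?_, ?_, ?_, ?_, ?_, ?_, ?_, ?_⟩
  all_goals try (intro l hl; omega)
  · intro k hk
    rw [hz hk, hu, Data.virtualTop]; omega
  · intro k hk
    rw [hz hk, hl, Data.virtualBottom]; omega
  · intro k hk
    rw [hz hk]; exact .inl hu
  · intro k hk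
    rw [hz hk]; exact .inl hl
  · intro h h1 h2
    exact ⟨0, by omega, by rw [hl, ok.hb_bottom]; exact h1, by rw [hu, ok.hb_top]; exact h2⟩
  · intro k hk
    rw [hz hk, hb]; exact hi
  · intro k hk
    rw [hz hk, hu, hl, hb]; exact hkind
  · simp [hσs, hσl, hu, hl, hb, Data.len]
  · simp [hσs, hσl, hb]

/-- The final state describes an optimal labeling. -/
theorem final (h : Inv d cl T vec V U d.n σ) (hT : d.Solves T) :
    d.len d.n σ.numLabels σ.assign σ.birth σ.height = V ∧
      ∀ c, c < d.D → ∑ l ∈ Finset.range σ.numLabels, d.notFirst c (σ.birth l) ≤ U c := by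
  refine ⟨?_, fun c hc => by have := h.count c hc; omega⟩
  rw [← h.value, Finset.sum_eq_zero, zero_add]
  intro k hk
  rw [Finset.mem_range] at hk
  exact hT.base_val _ (h.upper_lt k hk) _ (h.lower_lt k hk) _ (h.budget_lt k hk)

end Inv

end Sweep

end BackboneLabeling

namespace BackboneLabeling

/-! ### Labelings and the data of the dynamic program -/

/-- The horizontal length of a backbone from `x` to `right`, if it counts. -/
def Objective.backboneLength (right x : ℝ) : Objective → ℝ
  | .withBackbones => right - x
  | .withoutBackbones => 0

theorem Labeling.totalLength_eq {n C : ℕ} (L : Labeling n C) (P : PointSet n C) (obj : Objective) :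
    L.totalLength P obj = ∑ p, |P.y p - L.y (L.assign p)| +
      ∑ l, obj.backboneLength P.right (L.leftEnd P l) := by
  cases obj
  · rfl
  · simp [Labeling.totalLength, Objective.backboneLength]

namespace Data

/-- The data describe the points of `P`; `σ r` is the point of rank `r`. -/
structure Fits {n C : ℕ} (d : Data) (P : PointSet n C) (Δ : ℝ) (obj : Objective) (γ : ℕ → ℕ)
    (σ : Equiv.Perm (Fin n)) : Prop where
  n_eq : d.n = n
  C_eq : d.C = C
  Δ_eq : d.Δ = Δ
  bottom_eq : d.bottom = P.bottom
  top_eq : d.top = P.top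
  mono : StrictMono fun r => P.x (σ r)
  py_eq : ∀ r : Fin n, d.py r = P.y (σ r)
  pc_eq : ∀ r : Fin n, d.pc r = P.color (σ r)
  bc_eq : ∀ r : Fin n, d.bc r = obj.backboneLength P.right (P.x (σ r))
  cls_eq : ∀ r : Fin n, d.cls r = γ (P.color (σ r))
  exists_candidate : ∀ b, ∀ j : ℤ, |j| ≤ n →
    ∃ m, m < d.M ∧ d.Y m = Labeling.baseHeight P b + j * Δ

variable {n C : ℕ} {d : Data} {P : PointSet n C} {Δ : ℝ} {obj : Objective} {γ : ℕ → ℕ}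
  {σ : Equiv.Perm (Fin n)} {cl : Clearance}

namespace Fits

theorem le_iff (hf : d.Fits P Δ obj γ σ) (r q : Fin n) :
    P.x (σ r) ≤ P.x (σ q) ↔ (r : ℕ) ≤ q := hf.mono.le_iff_le

/-- The lengths of a labeling and of its description agree. -/
theorem totalLength_eq (hf : d.Fits P Δ obj γ σ) {L : Labeling n C} {a birth : ℕ → ℕ} {ly : ℕ → ℝ}
    (ha : ∀ q : Fin n, a q = L.assign (σ q)) (hly : ∀ l : Fin L.numLabels, ly l = L.y l)
    {bt : Fin L.numLabels → Fin n} (hbirth : ∀ l : Fin L.numLabels, birth l = bt l)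
    (hbt : ∀ l, L.leftEnd P l = P.x (σ (bt l))) :
    L.totalLength P obj = d.len d.n L.numLabels a birth ly := by
  rw [L.totalLength_eq, len, hf.n_eq, Finset.sum_range, Finset.sum_range, ← Equiv.sum_comp σ]
  congr 1
  · refine Finset.sum_congr rfl fun q _ => ?_
    rw [hf.py_eq, ha, hly]
  · refine Finset.sum_congr rfl fun l _ => ?_
    rw [hbirth, hf.bc_eq, hbt]

/-- The numbers of labels of the classes. -/
theorem card_class_eq (hf : d.Fits P Δ obj γ σ) {L : Labeling n C} {birth : ℕ → ℕ}
    {bt : Fin L.numLabels → Fin n} (hbirth : ∀ l : Fin L.numLabels, birth l = bt l)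
    (hbt : ∀ l, L.assign (σ (bt l)) = l) (hc : ∀ p, L.color (L.assign p) = P.color p) (c : ℕ) :
    ((Finset.range L.numLabels).filter fun l => d.cls (birth l) = c).card =
      (Finset.univ.filter fun l => γ (L.color l) = c).card := by
  rw [Finset.card_filter, Finset.card_filter, Finset.sum_range]
  refine Finset.sum_congr rfl fun l _ => ?_
  rw [hbirth, hf.cls_eq, ← hc, hbt]

/-- Valid labelings of the points are described by good labelings of the data. -/
theorem exists_good (hf : d.Fits P Δ obj γ σ) {L : Labeling n C}
    (hL : L.Valid P cl Δ) :
    ∃ a birth ly lc, d.Good cl d.n L.numLabels a birth ly lc ∧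
      (∀ l : Fin L.numLabels, ly l = L.y l) ∧
      L.totalLength P obj = d.len d.n L.numLabels a birth ly ∧
      ∀ c, ((Finset.range L.numLabels).filter fun l => d.cls (birth l) = c).card =
        (Finset.univ.filter fun l => γ (L.color l) = c).card := by
  have hex : ∀ l, ∃ r, L.assign (σ r) = l ∧ L.leftEnd P l = P.x (σ r) := fun l => by
    obtain ⟨p, h1, h2⟩ := L.exists_leftEnd P l
    exact ⟨σ.symm p, by simpa using h1, by simpa using h2⟩
  choose bt hbt hbt' using hex
  set a : ℕ → ℕ := fun q => if h : q < n then L.assign (σ ⟨q, h⟩) else 0 with ha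
  set birth : ℕ → ℕ := fun l => if h : l < L.numLabels then bt ⟨l, h⟩ else 0 with hbirth
  set ly : ℕ → ℝ := fun l => if h : l < L.numLabels then L.y ⟨l, h⟩ else 0 with hly
  set lc : ℕ → ℕ := fun l => if h : l < L.numLabels then L.color ⟨l, h⟩ else 0 with hlc
  have ha' : ∀ q : Fin n, a q = L.assign (σ q) := fun q => by simp [ha]
  have hb' : ∀ l : Fin L.numLabels, birth l = bt l := fun q => by simp [hbirth]
  have hly' : ∀ l : Fin L.numLabels, ly l = L.y l := fun q => by simp [hly]
  have hlc' : ∀ l : Fin L.numLabels, lc l = L.color l := fun q => by simp [hlc]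
  have hle : ∀ (q : Fin n) (l : Fin L.numLabels), birth l ≤ q ↔ L.leftEnd P l ≤ P.x (σ q) :=
    fun q l => by rw [hb', hbt', hf.le_iff]
  have hne : ∀ (q : Fin n) (l : Fin L.numLabels), (l : ℕ) ≠ a q → L.assign (σ q) ≠ l :=
    fun q l h h' => h (by rw [ha', h'])
  refine ⟨a, birth, ly, lc, ⟨?_, ?_, ?_, ?_, ?_, ?_, ?_, ?_, ?_, ?_⟩, hly',
    hf.totalLength_eq ha' hly' hb' hbt', hf.card_class_eq hb' hbt hL.color_eq⟩
  · intro l hl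
    have := hL.on_boundary ⟨l, hl⟩
    rw [← hly'] at this
    rwa [hf.bottom_eq, hf.top_eq]
  · intro l hl l' hl' h
    have := hL.separated.1 ⟨l, hl⟩ ⟨l', hl'⟩ (by simpa using h)
    rwa [← hly', ← hly', ← hf.Δ_eq] at this
  · intro l hl
    have := hb' ⟨l, hl⟩
    rw [hf.n_eq]
    exact this ▸ (bt ⟨l, hl⟩).2
  · intro l hl
    have := hb' ⟨l, hl⟩
    simp only at this
    rw [this, ha', hbt]
  · intro q hq
    rw [hf.n_eq] at hq
    rw [show a q = _ from ha' ⟨q, hq⟩]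
    exact Fin.is_lt _
  · intro q hq
    rw [hf.n_eq] at hq
    rw [show a q = _ from ha' ⟨q, hq⟩, hlc', hL.color_eq, ← hf.pc_eq]
  · intro q hq
    rw [hf.n_eq] at hq
    rw [show a q = _ from ha' ⟨q, hq⟩]
    exact (hle ⟨q, hq⟩ _).2 (L.leftEnd_le P _)
  · intro q hq l hl h1 h2
    rw [hf.n_eq] at hq
    have h3 := (hle ⟨q, hq⟩ ⟨l, hl⟩).1 h2
    have := hL.separated.2 ⟨l, hl⟩ (σ ⟨q, hq⟩) (hne ⟨q, hq⟩ ⟨l, hl⟩ h1)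
      (by cases cl; exacts [trivial, h3])
    rwa [← hly', ← hf.Δ_eq, ← hf.py_eq] at this
  · intro q hq l hl h1 h2
    rw [hf.n_eq] at hq
    have h3 := (hle ⟨q, hq⟩ ⟨l, hl⟩).1 h2
    have := hL.crossingFree.outside (hne ⟨q, hq⟩ ⟨l, hl⟩ h1) h3
    rwa [← hly', ← hly', ← hf.py_eq, ← ha'] at this
  · rintro rfl q hq l hl h1
    rw [hf.n_eq] at hq
    have h2 : ¬ L.leftEnd P ⟨l, hl⟩ ≤ P.x (σ ⟨q, hq⟩) := fun h => by
      have := (hle ⟨q, hq⟩ ⟨l, hl⟩).2 h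
      simp only at this
      omega
    have := hL.separated.2 ⟨l, hl⟩ (σ ⟨q, hq⟩) (fun h => h2 (h ▸ L.leftEnd_le P _)) trivial
    rwa [← hly', ← hf.Δ_eq, ← hf.py_eq] at this

/-- Good labelings of the data describe valid labelings of the points. -/
theorem exists_labeling (hf : d.Fits P Δ obj γ σ) (hΔ : 0 < Δ) {m : ℕ} {a birth : ℕ → ℕ}
    {ly : ℕ → ℝ} {lc : ℕ → ℕ} (g : d.Good cl d.n m a birth ly lc) :
    ∃ L : Labeling n C, L.numLabels = m ∧ (∀ l, (L.color l : ℕ) = lc l) ∧ (∀ l, L.y l = ly l) ∧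
      (∀ q, (L.assign (σ q) : ℕ) = a q) ∧ L.Valid P cl Δ ∧
      L.totalLength P obj = d.len d.n m a birth ly ∧
      ∀ c, ((Finset.range m).filter fun l => d.cls (birth l) = c).card =
        (Finset.univ.filter fun l => γ (L.color l) = c).card := by
  have hn := hf.n_eq
  have hblt : ∀ l : Fin m, birth l < n := fun l => hn ▸ g.birth_lt l l.2
  have hlc : ∀ l : Fin m, lc l < C := fun l => by
    have h1 := g.a_col _ (g.birth_lt l l.2)
    rw [g.a_birth l l.2, hf.pc_eq ⟨birth l, hblt l⟩] at h1
    exact h1 ▸ Fin.is_lt _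
  have halt : ∀ q : Fin n, a q < m := fun q => g.a_lt q (hn ▸ q.2)
  let L : Labeling n C :=
    { numLabels := m
      color := fun l => ⟨lc l, hlc l⟩
      y := fun l => ly l
      assign := fun p => ⟨a (σ.symm p), halt _⟩
      assign_surj := fun l => ⟨σ ⟨birth l, hblt l⟩, by
        apply Fin.ext
        simp [g.a_birth l l.2]⟩ }
  have hac : ∀ q : Fin n, (L.assign (σ q) : ℕ) = a q := fun q => by simp [L]
  have hcol : ∀ p, L.color (L.assign p) = P.color p := fun p => by
    apply Fin.ext
    have h1 := g.a_col (σ.symm p) (hn ▸ (σ.symm p).2)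
    rw [hf.pc_eq, Equiv.apply_symm_apply] at h1
    exact h1
  have hbt : ∀ l : Fin m, L.assign (σ ⟨birth l, hblt l⟩) = l := fun l => by
    apply Fin.ext
    rw [hac]
    exact g.a_birth l l.2
  have hleft : ∀ l : Fin m, L.leftEnd P l = P.x (σ ⟨birth l, hblt l⟩) := fun l => by
    refine le_antisymm ?_ ?_
    · have := L.leftEnd_le P (σ ⟨birth l, hblt l⟩)
      rwa [hbt] at this
    · obtain ⟨p, h1, h2⟩ := L.exists_leftEnd P l
      rw [h2, ← σ.apply_symm_apply p, hf.le_iff]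
      have h3 := g.birth_le (σ.symm p) (hn ▸ (σ.symm p).2)
      rw [← h1]
      exact h3
  have hle : ∀ (q : Fin n) (l : Fin m), L.leftEnd P l ≤ P.x (σ q) ↔ birth l ≤ q := fun q l => by
    rw [hleft, hf.le_iff]
  have hne : ∀ (p : Fin n) (l : Fin m), L.assign p ≠ l → (l : ℕ) ≠ a (σ.symm p) :=
    fun p l h h' => h (Fin.ext h'.symm)
  have hpy : ∀ p, P.y p = d.py (σ.symm p) := fun p => by rw [hf.py_eq, Equiv.apply_symm_apply]
  have hsep : ∀ l l' : Fin m, l ≠ l' → Δ ≤ |L.y l - L.y l'| := fun l l' h => by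
    rw [← hf.Δ_eq]
    exact g.sep l l.2 l' l'.2 (fun h' => h (Fin.ext h'))
  refine ⟨L, rfl, fun _ => rfl, fun _ => rfl, hac, ⟨hcol, ?_, ?_, hsep, ?_⟩, ?_, ?_⟩
  · intro l
    have := g.mem l l.2
    rw [hf.bottom_eq, hf.top_eq] at this
    exact this
  · refine Labeling.crossingFree_of_outside (fun l l' h h' => ?_) fun p l hpl hx => ?_
    · have := hsep l l' h
      rw [h', sub_self, abs_zero] at this
      linarith
    · rw [← σ.apply_symm_apply p, hle] at hx
      rw [hpy]
      exact g.cross _ (hn ▸ (σ.symm p).2) l l.2 (hne p l hpl) hx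
  · intro l p hpl hm
    rw [hpy, ← hf.Δ_eq]
    have hq : (σ.symm p : ℕ) < d.n := hn ▸ (σ.symm p).2
    rcases Nat.lt_or_ge (σ.symm p : ℕ) (birth l) with h | h
    · cases cl with
      | allPoints => exact g.clear_all rfl _ hq l l.2 h
      | alongBackbone =>
        have hx : L.leftEnd P l ≤ P.x p := hm
        rw [← σ.apply_symm_apply p, hle] at hx
        omega
    · exact g.clear _ hq l l.2 (hne p l hpl) h
  · exact hf.totalLength_eq (L := L) (fun q => (hac q).symm) (fun _ => rfl)
      (bt := fun l => ⟨birth l, hblt l⟩) (fun _ => rfl) hleft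
  · exact hf.card_class_eq (L := L) (bt := fun l => ⟨birth l, hblt l⟩) (fun _ => rfl) hbt hcol

variable (d) in
/-- Feasibility with bounds on the numbers of labels of the classes. -/
def Feasible (P : PointSet n C) (cl : Clearance) (Δ : ℝ) (γ : ℕ → ℕ) (L : Labeling n C) : Prop :=
  L.Valid P cl Δ ∧ ∀ c, c < d.D → (Finset.univ.filter fun l => γ (L.color l) = c).card ≤ d.k c

/-- The table bounds the length of every feasible labeling from below. -/
theorem exists_val_le (hf : d.Fits P Δ obj γ σ) (ok : d.Ok cl) (hn : 0 < n) (hΔ : 0 < Δ)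
    (hk : ∀ c, c < d.D → 0 < d.k c) {T : Table} (hT : d.Solves T) {L : Labeling n C}
    (hL : Feasible d P cl Δ γ L) :
    ∃ i, i < d.B ∧ T.kind 0 d.virtualTop d.virtualBottom i ≠ 0 ∧
      T.val 0 d.virtualTop d.virtualBottom i ≤ L.totalLength P obj := by
  obtain ⟨y, hv, hlen, hy⟩ := hL.1.exists_candidate_heights hΔ
  obtain ⟨a, birth, ly, lc, g, hly, htot, hcard⟩ := hf.exists_good hv
  have hcand : ∀ l, l < (L.withHeights y).numLabels → ∃ j, j < d.M ∧ d.Y j = ly l := fun l hl => by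
    obtain ⟨b, j, hj, hb⟩ := hy ⟨l, hl⟩
    obtain ⟨m, hm, hm'⟩ := hf.exists_candidate b j hj
    refine ⟨m, hm, ?_⟩
    rw [hm', ← hb]
    exact (hly ⟨l, hl⟩).symm
  have hbud : ∀ c, c < d.D → ∑ l ∈ Finset.range (L.withHeights y).numLabels,
      d.notFirst c (birth l) < d.k c := fun c hc => by
    rw [g.sum_notFirst ok, hcard]
    have h1 : (Finset.univ.filter fun l => γ ((L.withHeights y).color l) = c).card ≤ d.k c :=
      hL.2 c hc
    have := hk c hc
    omega
  obtain ⟨i, hi, h1, h2⟩ := g.exists_val_le ok (hf.n_eq ▸ hn) hT hcand hbud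
  exact ⟨i, hi, h1, h2.trans (htot ▸ hlen obj)⟩

/-- A final state of the reconstruction describes an optimal labeling. -/
theorem exists_optimal (hf : d.Fits P Δ obj γ σ) (ok : d.Ok cl) (hn : 0 < n) (hΔ : 0 < Δ)
    (hk : ∀ c, c < d.D → 0 < d.k c) {T : Table} (hT : d.Solves T) {i : ℕ} (hi : i < d.B)
    {vec : ℕ → ℕ → ℕ}
    (hvec : ∀ i, i < d.B → (∀ c, c < d.D → vec i c < d.k c) ∧ d.cd i = d.code (vec i))
    (hmin : ∀ i', i' < d.B → T.kind 0 d.virtualTop d.virtualBottom i' ≠ 0 →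
      T.val 0 d.virtualTop d.virtualBottom i ≤ T.val 0 d.virtualTop d.virtualBottom i')
    {τ : Sweep} (hτ : τ.Inv d cl T vec (T.val 0 d.virtualTop d.virtualBottom i) (vec i) d.n) :
    ∃ L : Labeling n C, L.numLabels = τ.numLabels ∧ (∀ l, (L.color l : ℕ) = τ.color l) ∧
      (∀ l, L.y l = τ.height l) ∧ (∀ q, (L.assign (σ q) : ℕ) = τ.assign q) ∧
      Feasible d P cl Δ γ L ∧
      ∀ L', Feasible d P cl Δ γ L' → L.totalLength P obj ≤ L'.totalLength P obj := by
  obtain ⟨hlen, hcount⟩ := hτ.final hT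
  obtain ⟨L, h1, h2, h3, h4, hv, htot, hcard⟩ := hf.exists_labeling hΔ hτ.good
  refine ⟨L, h1, h2, h3, h4, ⟨hv, fun c hc => ?_⟩, fun L' hL' => ?_⟩
  · have e1 := hcount c hc
    rw [hτ.good.sum_notFirst ok, hcard] at e1
    have e2 := (hvec i hi).1 c hc
    omega
  · obtain ⟨i', hi', hk', hle⟩ := hf.exists_val_le ok hn hΔ hk hT hL'
    rw [htot, hlen]
    exact (hmin i' hi' hk').trans hle

end Fits

end Data

end BackboneLabeling

namespace BackboneLabeling

/-! ### The registers of the program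

The names of variables start with `v` (natural numbers) or `x` (real numbers), the names of arrays
with `a` (natural numbers) or `f` (real numbers), those of the counters of loops with `l`. -/

namespace Reg

abbrev vn : ℕ := 0
abbrev vC : ℕ := 1
abbrev vK : ℕ := 2
abbrev xΔ : ℕ := 0
abbrev xRight : ℕ := 2
abbrev xBottom : ℕ := 3
abbrev xTop : ℕ := 4
abbrev aColor : ℕ := 0
abbrev aVector : ℕ := 1
abbrev fX : ℕ := 0
abbrev fY : ℕ := 1

/-- number of classes of colors -/
abbrev vD : ℕ := 6
/-- classes of the colors -/
abbrev aClass : ℕ := 6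
/-- bounds of the classes -/
abbrev aK : ℕ := 7

/-- points in the order of their `x`-coordinates -/
abbrev aPts : ℕ := 10
/-- heights of the points by rank -/
abbrev fPy : ℕ := 12
/-- colors of the points by rank -/
abbrev aPc : ℕ := 12
/-- classes of the points by rank -/
abbrev aCls : ℕ := 13
/-- lengths of the backbones that start at the points -/
abbrev fBc : ℕ := 13

/-- number of budgets -/
abbrev vB : ℕ := 17
/-- weights of the classes -/
abbrev aW : ℕ := 20
/-- codes of the budgets -/
abbrev aCd : ℕ := 23
/-- budgets of the codes -/
abbrev aInv : ℕ := 25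
/-- codes of labels that start at the points -/
abbrev aE : ℕ := 28

/-- number of candidate heights -/
abbrev vM : ℕ := 34
/-- candidate heights -/
abbrev fCand : ℕ := 36
/-- first points to which the candidate heights are too close -/
abbrev aFst : ℕ := 39

/-- multiples of the number of candidate heights -/
abbrev aMulM : ℕ := 41
/-- the virtual backbones and the number of all backbones -/
abbrev vTop : ℕ := 42
abbrev vBottom : ℕ := 43
abbrev vNB : ℕ := 44
/-- heights of the backbones -/
abbrev fHb : ℕ := 46
/-- colors of the backbones -/
abbrev aCb : ℕ := 46

/-- a bound on all indices, and the multiples of its powers -/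
abbrev vZ : ℕ := 47
abbrev aZ₁ : ℕ := 49
abbrev aZ₂ : ℕ := 52
abbrev aZ₃ : ℕ := 55

end Reg

open Reg

/-- Equality of natural numbers. -/
def Test.natEq (e f : NatExp) : Test := .conj (.neg (.natLT e f)) (.neg (.natLT f e))

@[simp] theorem Test.holds_natEq {s : Store} {e f : NatExp} :
    (Test.natEq e f).Holds s ↔ e.eval s = f.eval s := by
  simp only [natEq, Test.Holds]
  omega

/-- The store holds an instance: `D` classes `γ` of colors with the bounds `k`. -/
structure Holds {n C : ℕ} (P : PointSet n C) (Δ : ℝ) (D : ℕ) (γ k : ℕ → ℕ) (s : Store) : Prop where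
  n_eq : s.natVar vn = n
  C_eq : s.natVar vC = C
  Δ_eq : s.realVar xΔ = Δ
  right_eq : s.realVar xRight = P.right
  bottom_eq : s.realVar xBottom = P.bottom
  top_eq : s.realVar xTop = P.top
  color_eq : ∀ p : Fin n, s.natArr aColor p = P.color p
  x_eq : ∀ p : Fin n, s.realArr fX p = P.x p
  y_eq : ∀ p : Fin n, s.realArr fY p = P.y p
  D_eq : s.natVar vD = D
  class_eq : ∀ c, c < C → s.natArr aClass c = γ c
  k_eq : ∀ c, c < D → s.natArr aK c = k c

section

variable {n C : ℕ} {P : PointSet n C} {Δ : ℝ} {D : ℕ} {γ k : ℕ → ℕ} {s s' : Store}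

theorem Holds.of_agree (h : Holds P Δ D γ k s) (ha : AgreeBelow 8 s s') : Holds P Δ D γ k s' where
  n_eq := by rw [ha.natVar _ (by decide), h.n_eq]
  C_eq := by rw [ha.natVar _ (by decide), h.C_eq]
  Δ_eq := by rw [ha.realVar _ (by decide), h.Δ_eq]
  right_eq := by rw [ha.realVar _ (by decide), h.right_eq]
  bottom_eq := by rw [ha.realVar _ (by decide), h.bottom_eq]
  top_eq := by rw [ha.realVar _ (by decide), h.top_eq]
  color_eq := by rw [ha.natArr _ (by decide)]; exact h.color_eq
  x_eq := by rw [ha.realArr _ (by decide)]; exact h.x_eq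
  y_eq := by rw [ha.realArr _ (by decide)]; exact h.y_eq
  D_eq := by rw [ha.natVar _ (by decide), h.D_eq]
  class_eq := by rw [ha.natArr _ (by decide)]; exact h.class_eq
  k_eq := by rw [ha.natArr _ (by decide)]; exact h.k_eq

/-! ### Sorting the points -/

/-- The number of points to the left of `i`. -/
noncomputable def rank (x : ℕ → ℝ) (n i : ℕ) : ℕ :=
  ((Finset.range n).filter fun q => x q < x i).card

theorem rank_lt {x : ℕ → ℝ} {n i : ℕ} (hi : i < n) : rank x n i < n := by
  have h : (Finset.range n).filter (fun q => x q < x i) ⊂ Finset.range n :=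
    Finset.filter_ssubset.2 ⟨i, Finset.mem_range.2 hi, lt_irrefl _⟩
  simpa [rank] using Finset.card_lt_card h

theorem rank_lt_rank {x : ℕ → ℝ} {n i j : ℕ} (hi : i < n) (h : x i < x j) :
    rank x n i < rank x n j := by
  refine Finset.card_lt_card ⟨fun q hq => ?_, fun h' => ?_⟩
  · rw [Finset.mem_filter] at hq ⊢
    exact ⟨hq.1, hq.2.trans h⟩
  · have := h' (Finset.mem_filter.2 ⟨Finset.mem_range.2 hi, h⟩)
    exact lt_irrefl _ (Finset.mem_filter.1 this).2

theorem exists_perm_of_rank {x : ℕ → ℝ} (hx : ∀ p : Fin n, x p = P.x p) {a : ℕ → ℕ}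
    (ha : ∀ i, i < n → a (rank x n i) = i) :
    ∃ σ : Equiv.Perm (Fin n), StrictMono (fun r => P.x (σ r)) ∧ ∀ r : Fin n, a r = σ r := by
  have hlt : ∀ i j : Fin n, P.x i < P.x j → rank x n i < rank x n j := fun i j h =>
    rank_lt_rank i.2 (by rwa [hx, hx])
  let f : Fin n → Fin n := fun i => ⟨rank x n i, rank_lt i.2⟩
  have hinj : Function.Injective f := fun i j h => by
    by_contra hne
    have h' : rank x n i = rank x n j := congrArg Fin.val h
    rcases lt_or_gt_of_ne (P.x_inj.ne hne) with h1 | h1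
    · exact (hlt i j h1).ne h'
    · exact (hlt j i h1).ne' h'
  let τ := Equiv.ofBijective f (Finite.injective_iff_bijective.1 hinj)
  have hτ : ∀ r, rank x n (τ.symm r) = r := fun r => congrArg Fin.val (τ.apply_symm_apply r)
  refine ⟨τ.symm, fun r q hrq => ?_, fun r => ?_⟩
  · by_contra hle
    rcases (not_lt.1 hle).lt_or_eq with h1 | h1
    · have := hlt _ _ h1
      rw [hτ, hτ] at this
      exact absurd hrq (by simpa using this.le)
    · exact hrq.ne (τ.symm.injective (P.x_inj h1)).symm
  · have := ha (τ.symm r) (Fin.is_lt _)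
    rwa [hτ] at this

def sortPoints : Program :=
  .forUp 8 vn (
    .setNat 10 (.const 0) ;;
    .forUp 9 vn (
      .ite (.realLT (.cell fX (.var 9)) (.cell fX (.var 8)))
        (.setNat 10 (.add (.var 10) (.const 1))) .skip) ;;
    .storeNat aPts (.var 10) (.var 8))

theorem sortPoints_runs (h : Holds P Δ D γ k s) :
    RunsWithin sortPoints s (n * (n * 30 + 30) + 6) fun s' => AgreeBelow 8 s s' ∧
      ∃ σ : Equiv.Perm (Fin n), StrictMono (fun r => P.x (σ r)) ∧
        ∀ r : Fin n, s'.natArr aPts r = σ r := by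
  set x := s.realArr fX with hx
  refine (RunsWithin.forUp (T := n * 30 + 22)
    (fun i s' => ∀ j, j < i → s'.natArr aPts (rank x n j) = j) (by decide) h.n_eq rfl
    (by intro j hj; omega) ?_).mono (by rfl)
    (fun s' h' => ⟨h'.1, exists_perm_of_rank h.x_eq h'.2⟩)
  intro i hi s₁ ha₁ hv hI
  have hn₁ : s₁.natVar vn = n := (ha₁.natVar _ (by decide)).trans h.n_eq
  have hx₁ : s₁.realArr fX = x := ha₁.realArr _ (by decide)
  refine (RunsWithin.seq (T := 2) (T' := n * 30 + 20) ?_).mono_time (by omega)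
  refine .of_loopFree rfl (by decide) ?_
  refine (RunsWithin.seq (T := n * (20 + 8) + 6) (T' := 10) ?_).mono_time (by omega)
  refine (RunsWithin.forUp (T := 20)
    (fun q s' => s'.natVar 10 = ((Finset.range q).filter fun q => x q < x i).card ∧
      s'.natArr aPts = s₁.natArr aPts) (by decide) (by simpa using hn₁) rfl (by simp)
      ?_).mono le_rfl ?_
  · rintro q hq s₂ ha₂ hv₂ ⟨h1, h2⟩
    have hi₂ : s₂.natVar 8 = i := (ha₂.natVar 8 (by decide)).trans (by simpa using hv)
    have hx₂ : s₂.realArr fX = x := (ha₂.realArr _ (by decide)).trans hx₁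
    refine .of_loopFree rfl (by decide) ?_
    simp only [Program.run, Test.Holds, RealExp.eval, NatExp.eval, hx₂, hv₂, hi₂,
      Finset.range_add_one, Finset.filter_insert]
    split_ifs with hlt
    · simp [h1, h2]
    · simp [h1, h2]
  · rintro s₂ ⟨ha₂, h1, h2⟩
    have hi₂ : s₂.natVar 8 = i := (ha₂.natVar 8 (by decide)).trans (by simpa using hv)
    refine .of_loopFree rfl (by decide) ?_
    intro j hj
    simp only [Program.run, NatExp.eval, Store.natArr_setNat, Store.natArr_storeNat_self, h1, h2,
      hi₂]
    change Function.update (s₁.natArr aPts) (rank x n i) i (rank x n j) = j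
    rcases Nat.lt_succ_iff_lt_or_eq.1 hj with hj | rfl
    · rw [Function.update_of_ne, hI j hj]
      have hne : P.x ⟨j, hj.trans hi⟩ ≠ P.x ⟨i, hi⟩ := P.x_inj.ne (by simpa using hj.ne)
      have e1 : x j = _ := h.x_eq ⟨j, hj.trans hi⟩
      have e2 : x i = _ := h.x_eq ⟨i, hi⟩
      rw [← e1, ← e2] at hne
      rcases lt_or_gt_of_ne hne with h' | h'
      · exact (rank_lt_rank (hj.trans hi) h').ne
      · exact (rank_lt_rank hi h').ne'
    · rw [Function.update_self]

/-- The horizontal length of the backbone that starts at the point of rank `lr`. -/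
def backboneLengthExp (lr : ℕ) : Objective → RealExp
  | .withBackbones => .sub (.var xRight) (.cell fX (.cell aPts (.var lr)))
  | .withoutBackbones => .zero

def gatherPoints (obj : Objective) : Program :=
  .forUp 11 vn (
    .storeReal fPy (.var 11) (.cell fY (.cell aPts (.var 11))) ;;
    .storeNat aPc (.var 11) (.cell aColor (.cell aPts (.var 11))) ;;
    .storeNat aCls (.var 11) (.cell aClass (.cell aColor (.cell aPts (.var 11)))) ;;
    .storeReal fBc (.var 11) (backboneLengthExp 11 obj))

/-- The store holds the points in the order of their `x`-coordinates. -/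
structure SortedPoints (P : PointSet n C) (obj : Objective) (γ : ℕ → ℕ) (σ : Equiv.Perm (Fin n))
    (s : Store) : Prop where
  pts_eq : ∀ r : Fin n, s.natArr aPts r = σ r
  py_eq : ∀ r : Fin n, s.realArr fPy r = P.y (σ r)
  pc_eq : ∀ r : Fin n, s.natArr aPc r = P.color (σ r)
  cls_eq : ∀ r : Fin n, s.natArr aCls r = γ (P.color (σ r))
  bc_eq : ∀ r : Fin n, s.realArr fBc r = obj.backboneLength P.right (P.x (σ r))

theorem SortedPoints.of_agree {obj : Objective} {σ : Equiv.Perm (Fin n)}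
    (h : SortedPoints P obj γ σ s) (ha : AgreeBelow 14 s s') : SortedPoints P obj γ σ s' where
  pts_eq := by rw [ha.natArr _ (by decide)]; exact h.pts_eq
  py_eq := by rw [ha.realArr _ (by decide)]; exact h.py_eq
  pc_eq := by rw [ha.natArr _ (by decide)]; exact h.pc_eq
  cls_eq := by rw [ha.natArr _ (by decide)]; exact h.cls_eq
  bc_eq := by rw [ha.realArr _ (by decide)]; exact h.bc_eq

theorem gatherPoints_runs (obj : Objective) (h : Holds P Δ D γ k s) {σ : Equiv.Perm (Fin n)}
    (hσ : ∀ r : Fin n, s.natArr aPts r = σ r) :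
    RunsWithin (gatherPoints obj) s (n * 48 + 6) fun s' => AgreeBelow 11 s s' ∧
      SortedPoints P obj γ σ s' := by
  refine (RunsWithin.forUp (T := 40)
    (fun i s' => s'.natArr aPts = s.natArr aPts ∧ ∀ r : Fin n, (r : ℕ) < i →
      s'.realArr fPy r = P.y (σ r) ∧ s'.natArr aPc r = P.color (σ r) ∧
      s'.natArr aCls r = γ (P.color (σ r)) ∧
      s'.realArr fBc r = obj.backboneLength P.right (P.x (σ r)))
    (by decide) h.n_eq (by cases obj <;> rfl) (by simp) ?_).mono (by rfl)
    (fun s' h' => ⟨h'.1, fun r => by rw [h'.2.1, hσ], fun r => (h'.2.2 r r.2).1,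
      fun r => (h'.2.2 r r.2).2.1, fun r => (h'.2.2 r r.2).2.2.1, fun r => (h'.2.2 r r.2).2.2.2⟩)
  rintro i hi s₁ ha₁ hv ⟨hp, hI⟩
  have h₁ := h.of_agree (ha₁.mono (by decide))
  have hσ₁ : s₁.natArr aPts i = σ ⟨i, hi⟩ := by rw [hp]; exact hσ ⟨i, hi⟩
  refine .of_loopFree (by cases obj <;> rfl) (by cases obj <;> decide) ⟨?_, fun r hr => ?_⟩
  · cases obj <;> simpa [Program.run] using hp
  · have hγ := h₁.class_eq (P.color (σ ⟨i, hi⟩)) (Fin.is_lt _)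
    rcases Nat.lt_succ_iff_lt_or_eq.1 hr with hr | hr
    · obtain ⟨h1, h2, h3, h4⟩ := hI r hr
      cases obj <;> simp [hv, hr.ne, h1, h2, h3, h4, backboneLengthExp]
    · obtain rfl : r = ⟨i, hi⟩ := Fin.ext hr
      cases obj <;>
        simp [hv, hσ₁, h₁.x_eq, h₁.y_eq, h₁.color_eq, hγ, h₁.right_eq, backboneLengthExp,
          Objective.backboneLength]

end

end BackboneLabeling

namespace BackboneLabeling

open Reg

/-! ### Enumerating the budgets -/

/-- The number of budgets for the first `c` classes. -/
def boxCard (k : ℕ → ℕ) (c : ℕ) : ℕ := ∏ i ∈ Finset.range c, k i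

/-- The weight of class `c`. It leaves room for the sum of two budgets and one more label. -/
def weight (k : ℕ → ℕ) (c : ℕ) : ℕ := ∏ i ∈ Finset.range c, (2 * k i)

/-- The code of the first `c` entries of `u`. -/
def codeOf (k : ℕ → ℕ) (c : ℕ) (u : ℕ → ℕ) : ℕ := ∑ i ∈ Finset.range c, u i * weight k i

section Codes

variable {k : ℕ → ℕ} {c : ℕ} {u u' : ℕ → ℕ}

theorem codeOf_succ : codeOf k (c + 1) u = codeOf k c u + u c * weight k c :=
  Finset.sum_range_succ ..

theorem weight_succ : weight k (c + 1) = weight k c * (2 * k c) := Finset.prod_range_succ ..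

theorem codeOf_congr (h : ∀ i, i < c → u i = u' i) : codeOf k c u = codeOf k c u' :=
  Finset.sum_congr rfl fun i hi => by rw [h i (Finset.mem_range.1 hi)]

theorem codeOf_lt (h : ∀ i, i < c → u i < 2 * k i) : codeOf k c u < weight k c := by
  induction c with
  | zero => simp [codeOf, weight]
  | succ c ih =>
    rw [codeOf_succ, weight_succ]
    have h1 := ih fun i hi => h i (hi.trans (Nat.lt_succ_self c))
    have h2 : u c + 1 ≤ 2 * k c := h c (Nat.lt_succ_self c)
    calc codeOf k c u + u c * weight k c < weight k c + u c * weight k c := by omega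
      _ = weight k c * (u c + 1) := by ring
      _ ≤ _ := Nat.mul_le_mul_left _ h2

theorem codeOf_inj (h : ∀ i, i < c → u i < 2 * k i) (h' : ∀ i, i < c → u' i < 2 * k i)
    (he : codeOf k c u = codeOf k c u') : ∀ i, i < c → u i = u' i := by
  induction c with
  | zero => intro i hi; omega
  | succ c ih =>
    have hs : ∀ i, i < c → i < c + 1 := fun i hi => hi.trans (Nat.lt_succ_self c)
    have h1 := codeOf_lt fun i hi => h i (hs i hi)
    have h2 := codeOf_lt fun i hi => h' i (hs i hi)
    rw [codeOf_succ, codeOf_succ] at he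
    have hpos : 0 < weight k c := by omega
    have e1 : u c = u' c := by
      have := congrArg (· / weight k c) he
      simpa [Nat.add_mul_div_right _ _ hpos, Nat.div_eq_of_lt h1, Nat.div_eq_of_lt h2] using this
    have e2 : codeOf k c u = codeOf k c u' := by
      rw [e1] at he
      omega
    intro i hi
    rcases Nat.lt_succ_iff_lt_or_eq.1 hi with hi | rfl
    · exact ih (fun i hi => h i (hs i hi)) (fun i hi => h' i (hs i hi)) e2 i hi
    · exact e1

/-- `cd` lists the codes of the budgets for the first `c` classes. -/
def Enumerates (k : ℕ → ℕ) (c : ℕ) (cd : ℕ → ℕ) : Prop :=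
  (∀ t, t < boxCard k c → ∃ u, (∀ i, i < c → u i < k i) ∧ cd t = codeOf k c u) ∧
  ∀ u, (∀ i, i < c → u i < k i) → ∃ t, t < boxCard k c ∧ cd t = codeOf k c u

theorem boxCard_pos (hk : ∀ i, i < c → 0 < k i) : 0 < boxCard k c :=
  Finset.prod_pos fun i hi => hk i (Finset.mem_range.1 hi)

theorem boxCard_succ : boxCard k (c + 1) = k c * boxCard k c := by
  rw [boxCard, Finset.prod_range_succ, mul_comm, boxCard]

theorem boxCard_le {c' : ℕ} (h : c ≤ c') (hk : ∀ i, i < c' → 0 < k i) :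
    boxCard k c ≤ boxCard k c' :=
  Finset.prod_le_prod_of_subset_of_one_le' (Finset.range_subset_range.2 h)
    fun i hi _ => hk i (Finset.mem_range.1 hi)

theorem Enumerates.zero {cd : ℕ → ℕ} (h : cd 0 = 0) : Enumerates k 0 cd := by
  refine ⟨fun t ht => ⟨fun _ => 0, by simp, ?_⟩, fun u _ => ⟨0, by simp [boxCard], by
    simp [codeOf, h]⟩⟩
  obtain rfl : t = 0 := by simpa [boxCard] using ht
  simp [codeOf, h]

theorem Enumerates.succ {cd cd' : ℕ → ℕ} (h : Enumerates k c cd) (hB : 0 < boxCard k c)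
    (h1 : ∀ t, t < boxCard k c → cd' t = cd t)
    (h2 : ∀ t, t < k c * boxCard k c - boxCard k c →
      cd' (t + boxCard k c) = cd' t + weight k c) :
    Enumerates k (c + 1) cd' := by
  set B := boxCard k c
  have key : ∀ x, x < k c → ∀ t, t < B → cd' (t + x * B) = cd t + x * weight k c := by
    intro x
    induction x with
    | zero => intro _ t ht; simpa using h1 t ht
    | succ x ih =>
      intro hx t ht
      have hlt : t + x * B < k c * B - B := by
        have : (x + 2) * B ≤ k c * B := Nat.mul_le_mul_right _ hx
        have e : (x + 2) * B = x * B + B + B := by ring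
        omega
      have := h2 _ hlt
      rw [ih (by omega) t ht] at this
      rw [add_mul, one_mul, ← add_assoc, this]
      ring
  refine ⟨fun t ht => ?_, fun u hu => ?_⟩
  · rw [boxCard_succ] at ht
    obtain ⟨u, hu, hcd⟩ := h.1 (t % B) (Nat.mod_lt _ hB)
    have hx : t / B < k c := Nat.div_lt_of_lt_mul (by rwa [mul_comm])
    have hc : codeOf k c (Function.update u c (t / B)) = codeOf k c u :=
      codeOf_congr fun i hi => Function.update_of_ne hi.ne _ _
    refine ⟨Function.update u c (t / B), fun i hi => ?_, ?_⟩
    · rcases Nat.lt_succ_iff_lt_or_eq.1 hi with hi | rfl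
      · rw [Function.update_of_ne hi.ne]; exact hu i hi
      · rwa [Function.update_self]
    · rw [codeOf_succ, hc, Function.update_self, ← hcd, ← key _ hx _ (Nat.mod_lt _ hB),
        mul_comm, Nat.mod_add_div]
  · obtain ⟨t, ht, hcd⟩ := h.2 u fun i hi => hu i (hi.trans (Nat.lt_succ_self c))
    have hx := hu c (Nat.lt_succ_self c)
    refine ⟨t + u c * B, ?_, ?_⟩
    · rw [boxCard_succ]
      calc t + u c * B < B + u c * B := by omega
        _ = (u c + 1) * B := by ring
        _ ≤ _ := Nat.mul_le_mul_right _ hx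
    · rw [key _ hx t ht, hcd, codeOf_succ]

end Codes

def enumBudgets : Program :=
  .setNat 16 (.const 1) ;; .setNat vB (.const 1) ;; .storeNat aCd (.const 0) (.const 0) ;;
  .forUp 14 vD (
    (.setNat 15 (.cell aK (.var 14)) ;; .storeNat aW (.var 14) (.var 16) ;;
      .setNat 20 (.const 0) ;; .setNat 21 (.const 0)) ;;
    .forUp 19 15 (
      .setNat 20 (.add (.var 20) (.var vB)) ;;
      .setNat 21 (.add (.var 21) (.add (.var 16) (.var 16)))) ;;
    .setNat 18 (.sub (.var 20) (.var vB)) ;;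
    .forUp 22 18 (
      .storeNat aCd (.add (.var 22) (.var vB)) (.add (.cell aCd (.var 22)) (.var 16))) ;;
    .setNat vB (.var 20) ;; .setNat 16 (.var 21))

variable {n C : ℕ} {P : PointSet n C} {Δ : ℝ} {D : ℕ} {γ k : ℕ → ℕ} {s s' : Store}

/-- The store holds the budgets and the weights of the classes. -/
structure Budgets (D : ℕ) (k : ℕ → ℕ) (s : Store) : Prop where
  B_eq : s.natVar vB = boxCard k D
  W_eq : ∀ c, c < D → s.natArr aW c = weight k c
  enum : Enumerates k D (s.natArr aCd)

theorem Budgets.of_agree (h : Budgets D k s) (ha : AgreeBelow 24 s s') : Budgets D k s' where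
  B_eq := by rw [ha.natVar _ (by decide), h.B_eq]
  W_eq := by rw [ha.natArr _ (by decide)]; exact h.W_eq
  enum := by rw [ha.natArr _ (by decide)]; exact h.enum

theorem enumBudgets_runs (h : Holds P Δ D γ k s) (hk : ∀ c, c < D → 0 < k c) :
    RunsWithin enumBudgets s (D * (boxCard k D * 100) + 20) fun s' =>
      AgreeBelow 14 s s' ∧ Budgets D k s' := by
  set B := boxCard k D with hBdef
  have hBpos : 0 < B := boxCard_pos hk
  refine (RunsWithin.seq (T := 2) (T' := 2 + (3 + (D * (B * 100) + 6))) ?_).mono_time (by omega)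
  refine .of_loopFree rfl (by decide) (.seq (.of_loopFree rfl (by decide)
    (.seq (.of_loopFree rfl (by decide) ?_))))
  set s₀ := ((((s.setNat 16 1).setNat vB 1).storeNat aCd 0 0) : Store) with hs₀
  have ha₀ : AgreeBelow 14 s s₀ :=
    ((AgreeBelow.setNat (by decide)).trans (.setNat (by decide))).trans (.storeNat (by decide))
  have h₀ := h.of_agree (ha₀.mono (by decide))
  refine (RunsWithin.forUp (T := B * 92) (fun c s' => s'.natVar 16 = weight k c ∧
    s'.natVar vB = boxCard k c ∧ (∀ i, i < c → s'.natArr aW i = weight k i) ∧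
      Enumerates k c (s'.natArr aCd)) (by decide) h₀.D_eq rfl ?_ ?_).mono ?_ ?_
  · exact ⟨by simp [hs₀, weight], by simp [hs₀, boxCard], by simp, .zero (by simp [hs₀])⟩
  · rintro c hc s₁ ha₁ hv ⟨hW, hB, hWt, hE⟩
    have h₁ := h₀.of_agree (ha₁.mono (by decide))
    have hBc : 0 < boxCard k c := boxCard_pos fun i hi => hk i (hi.trans hc)
    have hkc := hk c hc
    have hle : k c * boxCard k c ≤ B := by
      rw [← boxCard_succ]
      exact boxCard_le hc hk
    have hkle : k c ≤ B := (Nat.le_mul_of_pos_right _ hBc).trans hle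
    refine (RunsWithin.seq (T := 10) (T' := (k c * (10 + 8) + 6) + (4 +
      (((k c * boxCard k c - boxCard k c) * (8 + 8) + 6) + 4))) ?_).mono_time (by omega)
    refine .of_loopFree rfl (by decide) (.seq ?_)
    refine (RunsWithin.forUp (fun i s' => s'.natVar 20 = i * boxCard k c ∧
      s'.natVar 21 = i * (2 * weight k c) ∧ s'.natArr aCd = s₁.natArr aCd ∧
      s'.natArr aW = Function.update (s₁.natArr aW) c (weight k c)) (by decide)
      (by simp [hv, h₁.k_eq c hc]) rfl (by simp [hv, hW]) ?_).mono le_rfl ?_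
    · rintro i hi s₂ ha₂ hv₂ ⟨i1, i2, i3, i4⟩
      refine .of_loopFree rfl (by decide) ?_
      have e1 : s₂.natVar 17 = boxCard k c := (ha₂.natVar 17 (by decide)).trans (by simp [hB])
      have e2 : s₂.natVar 16 = weight k c := (ha₂.natVar 16 (by decide)).trans (by simp [hW])
      refine ⟨?_, ?_, by simpa using i3, by simpa using i4⟩
      · simp [i1, e1]; ring
      · simp [i2, e2]; ring
    · rintro s₂ ⟨ha₂, i1, i2, i3, i4⟩
      have e1 : s₂.natVar 17 = boxCard k c := (ha₂.natVar 17 (by decide)).trans (by simp [hB])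
      have e2 : s₂.natVar 16 = weight k c := (ha₂.natVar 16 (by decide)).trans (by simp [hW])
      refine .seq (.of_loopFree rfl (by decide) (.seq ?_))
      refine (RunsWithin.forUp (fun i s' =>
        (∀ t, t < boxCard k c → s'.natArr aCd t = s₁.natArr aCd t) ∧
        ∀ t, t < i → s'.natArr aCd (t + boxCard k c) = s'.natArr aCd t + weight k c) (by decide)
        (by simp [i1, e1]) rfl (by simp [i3]) ?_).mono le_rfl ?_
      · rintro i hi s₃ ha₃ hv₃ ⟨j1, j2⟩
        have f1 : s₃.natVar 17 = boxCard k c := (ha₃.natVar 17 (by decide)).trans (by simp [e1])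
        have f2 : s₃.natVar 16 = weight k c := (ha₃.natVar 16 (by decide)).trans (by simp [e2])
        refine .of_loopFree rfl (by decide) ?_
        simp only [Program.run, NatExp.eval, Store.natArr_setNat, Store.natArr_storeNat_self, hv₃,
          f1, f2, Function.update_apply]
        refine ⟨fun t ht => ?_, fun t ht => ?_⟩
        · rw [if_neg (by omega), j1 t ht]
        · by_cases hti : t = i
          · subst hti
            rw [if_pos rfl, if_neg (by omega)]
          · rw [if_neg (by omega), if_neg (by omega), j2 t (by omega)]
      · rintro s₃ ⟨ha₃, j1, j2⟩
        have f3 : s₃.natVar 20 = k c * boxCard k c := (ha₃.natVar 20 (by decide)).trans (by simp [i1])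
        have f4 : s₃.natVar 21 = k c * (2 * weight k c) := (ha₃.natVar 21 (by decide)).trans (by simp [i2])
        have f5 : s₃.natArr aW = Function.update (s₁.natArr aW) c (weight k c) :=
          (ha₃.natArr aW (by decide)).trans (by simp [i4])
        refine .of_loopFree rfl (by decide) ⟨?_, ?_, ?_, ?_⟩
        · rw [weight_succ, mul_comm (weight k c), mul_assoc, mul_left_comm, ← f4]
          simp
        · simp [f3, boxCard_succ]
        · intro i hi
          simp only [Program.run, Store.natArr_setNat, f5, Function.update_apply]
          split_ifs with hic
          · rw [hic]
          · exact hWt i (by omega)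
        · simp only [Program.run, Store.natArr_setNat]
          exact hE.succ hBc j1 j2
  · gcongr
    omega
  · rintro s' ⟨ha, -, h2, h3, h4⟩
    exact ⟨ha₀.trans ha, h2, h3, h4⟩

/-- `aInv` inverts the list of codes. -/
def invertCodes : Program := .forUp 24 vB (.storeNat aInv (.cell aCd (.var 24)) (.var 24))

theorem invertCodes_runs {B : ℕ} (hB : s.natVar vB = B) :
    RunsWithin invertCodes s (B * 20 + 6) fun s' => AgreeBelow 24 s s' ∧
      ∀ t, t < B → s'.natArr aInv (s.natArr aCd t) < B ∧
        s.natArr aCd (s'.natArr aInv (s.natArr aCd t)) = s.natArr aCd t := by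
  refine (RunsWithin.forUp (T := 4) (fun i s' => ∀ t, t < i →
    s'.natArr aInv (s.natArr aCd t) < B ∧
        s.natArr aCd (s'.natArr aInv (s.natArr aCd t)) = s.natArr aCd t) (by decide) hB rfl
    (by simp) ?_).mono (by omega) (fun _ h => h)
  intro i hi s₁ ha₁ hv hI
  have hcd : s₁.natArr aCd = s.natArr aCd := ha₁.natArr _ (by decide)
  refine .of_loopFree rfl (by decide) fun t ht => ?_
  simp only [Program.run, NatExp.eval, Store.natArr_setNat, Store.natArr_storeNat_self, hv, hcd,
    Function.update_apply]
  split_ifs with h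
  · exact ⟨hi, h.symm⟩
  · exact hI t ((Nat.lt_succ_iff_lt_or_eq.1 ht).resolve_right fun h' => h (by rw [h']))

/-- The codes of labels that start at the points. -/
def birthCodes : Program :=
  .forUp 26 vn (
    .storeNat aE (.var 26) (.const 0) ;;
    .forUp 27 26 (
      .ite (.natEq (.cell aCls (.var 27)) (.cell aCls (.var 26)))
        (.storeNat aE (.var 26) (.cell aW (.cell aCls (.var 26)))) .skip))

open Classical in
theorem birthCodes_runs (hn : s.natVar vn = n) :
    RunsWithin birthCodes s (n * (n * 40 + 40) + 6) fun s' => AgreeBelow 26 s s' ∧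
      ∀ r, r < n → s'.natArr aE r =
        if ∃ q < r, s.natArr aCls q = s.natArr aCls r then s.natArr aW (s.natArr aCls r) else 0 := by
  refine (RunsWithin.forUp (T := 3 + (n * (30 + 8) + 6)) (fun i s' => ∀ r, r < i → s'.natArr aE r =
    if ∃ q < r, s.natArr aCls q = s.natArr aCls r then s.natArr aW (s.natArr aCls r) else 0)
    (by decide) hn rfl (by simp) ?_).mono ?_ (fun _ h => h)
  · intro i hi s₁ ha₁ hv hI
    refine .seq (.of_loopFree rfl (by decide) ?_)
    refine (RunsWithin.forUp (T := 30) (n := i) (fun q' s' => ∀ r, r < i + 1 → s'.natArr aE r =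
      if ∃ q < r, (r = i → q < q') ∧ s.natArr aCls q = s.natArr aCls r
      then s.natArr aW (s.natArr aCls r) else 0) (by decide) (by simpa using hv) rfl ?_ ?_).mono
      (by gcongr) ?_
    · intro r hr
      simp only [Program.run, NatExp.eval, Store.natArr_setNat, Store.natArr_storeNat_self, hv,
        Function.update_apply]
      split_ifs with h1 h2 h2
      · obtain ⟨q, -, h3, -⟩ := h2
        exact absurd (h3 h1) (by omega)
      · rfl
      · rw [hI r (by omega)]
        obtain ⟨q, h3, h4, h5⟩ := h2
        exact if_pos ⟨q, h3, h5⟩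
      · rw [hI r (by omega)]
        exact if_neg fun ⟨q, h3, h4⟩ => h2 ⟨q, h3, fun h => absurd h h1, h4⟩
    · intro q' hq' s₂ ha₂ hv₂ hI₂
      have hcl : s₂.natArr aCls = s.natArr aCls :=
        (ha₂.natArr _ (by decide)).trans (by simpa using ha₁.natArr aCls (by decide))
      have hw : s₂.natArr aW = s.natArr aW :=
        (ha₂.natArr _ (by decide)).trans (by simpa using ha₁.natArr aW (by decide))
      have hv' : s₂.natVar 26 = i := (ha₂.natVar 26 (by decide)).trans (by simpa using hv)
      refine .of_loopFree rfl (by decide) fun r hr => ?_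
      have hiff : (∃ q < r, (r = i → q < q' + 1) ∧ s.natArr aCls q = s.natArr aCls r) ↔
          (∃ q < r, (r = i → q < q') ∧ s.natArr aCls q = s.natArr aCls r) ∨
            (r = i ∧ s.natArr aCls q' = s.natArr aCls i) := by
        constructor
        · rintro ⟨q, h1, h2, h3⟩
          by_cases h4 : r = i ∧ q = q'
          · obtain ⟨rfl, rfl⟩ := h4
            exact .inr ⟨rfl, h3⟩
          · exact .inl ⟨q, h1, fun h => by have := h2 h; omega, h3⟩
        · rintro (⟨q, h1, h2, h3⟩ | ⟨rfl, h1⟩)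
          · exact ⟨q, h1, fun h => by have := h2 h; omega, h3⟩
          · exact ⟨q', hq', fun _ => by omega, h1⟩
      simp only [Program.run, Test.holds_natEq, NatExp.eval, hcl, hv₂, hv', hw]
      by_cases hc : s.natArr aCls q' = s.natArr aCls i
      · rw [if_pos hc]
        simp only [Store.natArr_setNat, Store.natArr_storeNat_self, Function.update_apply]
        by_cases hri : r = i
        · subst hri
          rw [if_pos rfl, if_pos (hiff.2 (.inr ⟨rfl, hc⟩))]
        · rw [if_neg hri, hI₂ r hr]
          exact if_congr (hiff.trans (by simp [hri])).symm rfl rfl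
      · rw [if_neg hc, Store.natArr_setNat, hI₂ r hr]
        exact if_congr (hiff.trans (by simp [hc])).symm rfl rfl
    · rintro s₂ ⟨-, hI₂⟩ r hr
      rw [Store.natArr_setNat, hI₂ r hr]
      refine if_congr ⟨?_, ?_⟩ rfl rfl
      · rintro ⟨q, h1, -, h3⟩
        exact ⟨q, h1, h3⟩
      · rintro ⟨q, h1, h3⟩
        exact ⟨q, h1, fun h => by omega, h3⟩
  · gcongr ?_ + _
    exact Nat.mul_le_mul_left _ (by omega)

end BackboneLabeling

namespace BackboneLabeling

open Reg

variable {n C : ℕ} {P : PointSet n C} {Δ : ℝ} {D : ℕ} {γ k : ℕ → ℕ} {s s' : Store}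

/-! ### Candidate heights and backbones -/

/-- The base heights of the candidates: the heights of the points and of the horizontal sides. -/
noncomputable def base (P : PointSet n C) (i : ℕ) : ℝ :=
  if h : i < n then P.y ⟨i, h⟩ else if i = n then P.bottom else P.top

def candidates : Program :=
  (.setNat 29 (.add (.var vn) (.const 2)) ;;
    .setNat 30 (.add (.add (.var vn) (.var vn)) (.const 3)) ;; .setReal 32 (.var xΔ)) ;;
  .forUp 31 vn (.setReal 32 (.add (.var 32) (.var xΔ))) ;;
  .setNat vM (.const 0) ;;
  .forUp 33 30 (.setNat vM (.add (.var vM) (.var 29))) ;;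
  .forUp 35 vM (
    .ite (.natLT (.var 35) (.var vn))
      (.storeReal fCand (.var 35) (.sub (.cell fY (.var 35)) (.var 32)))
      (.ite (.natEq (.var 35) (.var vn))
        (.storeReal fCand (.var 35) (.sub (.var xBottom) (.var 32)))
        (.ite (.natLT (.var 35) (.var 29))
          (.storeReal fCand (.var 35) (.sub (.var xTop) (.var 32)))
          (.storeReal fCand (.var 35)
            (.add (.cell fCand (.sub (.var 35) (.var 29))) (.var xΔ))))))

/-- The number of candidate heights. -/
def numCand (n : ℕ) : ℕ := (2 * n + 3) * (n + 2)

theorem candidates_runs (h : Holds P Δ D γ k s) :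
    RunsWithin candidates s (numCand n * 100 + 100) fun s' => AgreeBelow 29 s s' ∧
      s'.natVar vM = numCand n ∧ ∀ i, i < n + 2 → ∀ x, x < 2 * n + 3 →
        s'.realArr fCand (i + x * (n + 2)) = base P i + ((x : ℝ) - (n + 1)) * Δ := by
  have hM : n ≤ numCand n ∧ 2 * n + 3 ≤ numCand n := by
    constructor <;> simp only [numCand] <;> nlinarith
  refine (RunsWithin.seq (T := 12) (T' := (n * (4 + 8) + 6) + (2 + (((2 * n + 3) * (4 + 8) + 6) +
    (numCand n * (60 + 8) + 6)))) ?_).mono_time (by omega)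
  refine .of_loopFree rfl (by decide) (.seq ?_)
  refine (RunsWithin.forUp (fun i s' => s'.realVar 32 = (i + 1) * Δ) (by decide)
    (by simp [h.n_eq]) rfl (by simp [h.Δ_eq]) ?_).mono le_rfl ?_
  · intro i hi s₁ ha₁ hv hI
    have e1 : s₁.realVar xΔ = Δ := (ha₁.realVar _ (by decide)).trans (by simp [h.Δ_eq])
    refine .of_loopFree rfl (by decide) ?_
    simp [hI, e1]
    ring
  · rintro s₁ ⟨ha₁, hsh⟩
    have h29 : s₁.natVar 29 = n + 2 := (ha₁.natVar _ (by decide)).trans (by simp [h.n_eq])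
    have h30 : s₁.natVar 30 = 2 * n + 3 :=
      (ha₁.natVar _ (by decide)).trans (by simp [h.n_eq]; omega)
    have ha₁' : AgreeBelow 29 s s₁ := .trans (by
      simp only [Program.run]
      exact ((AgreeBelow.setNat (by decide)).trans (.setNat (by decide))).trans
        (.setReal (by decide))) (ha₁.mono (by decide))
    refine .seq (.of_loopFree rfl (by decide) (.seq ?_))
    refine (RunsWithin.forUp (fun i s' => s'.natVar vM = i * (n + 2)) (by decide)
      (by simpa using h30) rfl (by simp) ?_).mono le_rfl ?_
    · intro i hi s₂ ha₂ hv hI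
      have e1 : s₂.natVar 29 = n + 2 := (ha₂.natVar _ (by decide)).trans (by simp [h29])
      refine .of_loopFree rfl (by decide) ?_
      simp [hI, e1]
      ring
    · rintro s₂ ⟨ha₂, hM₂⟩
      have e29 : s₂.natVar 29 = n + 2 := (ha₂.natVar _ (by decide)).trans (by simp [h29])
      have e32 : s₂.realVar 32 = (n + 1) * Δ := (ha₂.realVar _ (by decide)).trans (by simp [hsh])
      have ha₂' : AgreeBelow 29 s s₂ := (ha₁'.trans (.setNat (by decide))).trans
        (ha₂.mono (by decide))
      refine (RunsWithin.forUp (fun i s' => s'.natVar vM = numCand n ∧ ∀ a, a < n + 2 → ∀ x,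
        a + x * (n + 2) < i →
        s'.realArr fCand (a + x * (n + 2)) = base P a + ((x : ℝ) - (n + 1)) * Δ) (by decide)
        hM₂ rfl ⟨by simpa [numCand] using hM₂, by simp⟩ ?_).mono le_rfl ?_
      · rintro i hi s₃ ha₃ hv ⟨hM₃, hI⟩
        have h₃ := h.of_agree ((ha₂'.trans (ha₃.mono (by decide))).mono (by decide))
        have f29 : s₃.natVar 29 = n + 2 := (ha₃.natVar _ (by decide)).trans e29
        have f32 : s₃.realVar 32 = (n + 1) * Δ := (ha₃.realVar _ (by decide)).trans e32
        refine .of_loopFree rfl (by decide) ?_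
        suffices hs : ∃ z, (∀ a, a < n + 2 → ∀ x, a + x * (n + 2) = i →
            z = base P a + ((x : ℝ) - (n + 1)) * Δ) ∧ Program.run (
            .ite (.natLT (.var 35) (.var vn))
              (.storeReal fCand (.var 35) (.sub (.cell fY (.var 35)) (.var 32)))
              (.ite (.natEq (.var 35) (.var vn))
                (.storeReal fCand (.var 35) (.sub (.var xBottom) (.var 32)))
                (.ite (.natLT (.var 35) (.var 29))
                  (.storeReal fCand (.var 35) (.sub (.var xTop) (.var 32)))
                  (.storeReal fCand (.var 35)
                    (.add (.cell fCand (.sub (.var 35) (.var 29))) (.var xΔ)))))) s₃ =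
              s₃.storeReal fCand i z by
          obtain ⟨z, hz, hrun⟩ := hs
          rw [hrun]
          refine ⟨by simpa using hM₃, fun a ha x hx => ?_⟩
          simp only [Store.realArr_setNat, Store.realArr_storeReal_self, Function.update_apply]
          split_ifs with h'
          · exact hz a ha x h'
          · exact hI a ha x (by omega)
        have hzero : ∀ a x, i < n + 2 → a + x * (n + 2) = i → x = 0 ∧ a = i := fun a x hi' hx => by
          rcases Nat.eq_zero_or_pos x with rfl | hx'
          · simpa using hx
          · have := Nat.le_mul_of_pos_left (n + 2) hx'
            omega
        simp only [Program.run, Test.Holds, Test.holds_natEq, NatExp.eval, RealExp.eval, hv,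
          h₃.n_eq, f29, f32, h₃.bottom_eq, h₃.top_eq, h₃.Δ_eq]
        by_cases c1 : i < n
        · refine ⟨_, fun a ha x hx => ?_, if_pos c1⟩
          obtain ⟨rfl, rfl⟩ := hzero a x (by omega) hx
          rw [show s₃.realArr fY a = _ from h₃.y_eq ⟨a, c1⟩]
          simp [base, c1]
          ring
        · rw [if_neg c1]
          by_cases c2 : i = n
          · refine ⟨_, fun a ha x hx => ?_, if_pos c2⟩
            obtain ⟨rfl, rfl⟩ := hzero a x (by omega) hx
            simp [base, c2]
            ring
          · rw [if_neg c2]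
            by_cases c3 : i < n + 2
            · refine ⟨_, fun a ha x hx => ?_, if_pos c3⟩
              obtain ⟨rfl, rfl⟩ := hzero a x (by omega) hx
              simp [base, c1, c2]
              ring
            · refine ⟨_, fun a ha x hx => ?_, if_neg c3⟩
              obtain ⟨x, rfl⟩ : ∃ x', x = x' + 1 := ⟨x - 1, by
                rcases Nat.eq_zero_or_pos x with rfl | hx'
                · simp at hx; omega
                · omega⟩
              have e : (x + 1) * (n + 2) = x * (n + 2) + (n + 2) := by ring
              rw [show i - (n + 2) = a + x * (n + 2) by omega, hI a ha x (by omega)]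
              push_cast
              ring
      · rintro s₃ ⟨ha₃, hM₃, hI⟩
        refine ⟨ha₂'.trans (ha₃.mono (by decide)), hM₃, fun i hi x hx => hI i hi x ?_⟩
        calc i + x * (n + 2) < (n + 2) + x * (n + 2) := by omega
          _ = (x + 1) * (n + 2) := by ring
          _ ≤ _ := Nat.mul_le_mul_right _ hx

theorem exists_candidate_index {Y : ℕ → ℝ} (hY : ∀ i, i < n + 2 → ∀ x, x < 2 * n + 3 →
      Y (i + x * (n + 2)) = base P i + ((x : ℝ) - (n + 1)) * Δ)
    (b : Option (Fin n ⊕ Unit)) (j : ℤ) (hj : |j| ≤ n) :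
    ∃ m, m < numCand n ∧ Y m = Labeling.baseHeight P b + j * Δ := by
  rw [abs_le] at hj
  obtain ⟨i, hi, hb⟩ : ∃ i, i < n + 2 ∧ base P i = Labeling.baseHeight P b := by
    rcases b with _ | p | _
    · exact ⟨n, by omega, by simp [base, Labeling.baseHeight]⟩
    · exact ⟨p, by omega, by simp [base, Labeling.baseHeight]⟩
    · exact ⟨n + 1, by omega, by simp [base, Labeling.baseHeight]⟩
  obtain ⟨x, hx⟩ : ∃ x : ℕ, (x : ℤ) = j + n + 1 := ⟨(j + n + 1).toNat, by omega⟩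
  refine ⟨i + x * (n + 2), ?_, ?_⟩
  · calc i + x * (n + 2) < (n + 2) + x * (n + 2) := by omega
      _ = (x + 1) * (n + 2) := by ring
      _ ≤ _ := Nat.mul_le_mul_right _ (by omega)
  · rw [hY i hi x (by omega), hb]
    have : (x : ℝ) = j + n + 1 := by exact_mod_cast hx
    rw [this]
    ring

/-- The body of the search for the first point to which a candidate height is too close. -/
def closenessTest : Clearance → Program
  | .allPoints =>
    .forUp 38 vn (
      .ite (.conj
          (.realLT (.sub (.cell fPy (.sub (.sub (.var vn) (.const 1)) (.var 38)))
            (.cell fCand (.var 37))) (.var xΔ))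
          (.realLT (.sub (.cell fCand (.var 37))
            (.cell fPy (.sub (.sub (.var vn) (.const 1)) (.var 38)))) (.var xΔ)))
        (.storeNat aFst (.var 37) (.sub (.sub (.var vn) (.const 1)) (.var 38))) .skip)
  | .alongBackbone => .skip

def firstClose (cl : Clearance) : Program :=
  .forUp 37 vM (.storeNat aFst (.var 37) (.var vn) ;; closenessTest cl)

theorem firstClose_runs (cl : Clearance) {M : ℕ} (h : Holds P Δ D γ k s) (hM : s.natVar vM = M) :
    RunsWithin (firstClose cl) s (M * (n * 50 + 30) + 6) fun s' => AgreeBelow 37 s s' ∧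
      ∀ j, j < M → ∀ r, r < n → (r ≤ s'.natArr aFst j ↔ (cl = .allPoints →
        ∀ q, q < r → Δ ≤ |s.realArr fPy q - s.realArr fCand j|)) := by
  refine (RunsWithin.forUp (T := n * 50 + 22) (fun i s' => ∀ j, j < i → ∀ r, r < n →
    (r ≤ s'.natArr aFst j ↔ (cl = .allPoints →
        ∀ q, q < r → Δ ≤ |s.realArr fPy q - s.realArr fCand j|))) (by decide) hM
    (by cases cl <;> rfl) (by simp) ?_).mono (by rfl) (fun _ h => h)
  intro i hi s₁ ha₁ hv hI
  have h₁ := h.of_agree (ha₁.mono (by decide))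
  cases cl with
  | alongBackbone =>
    refine (RunsWithin.seq (T := 3) (T' := 2) (.of_loopFree rfl (by decide)
      (.of_loopFree rfl (by decide) ?_))).mono_time (by omega)
    intro j hj r hr
    simp only [closenessTest, Program.run, NatExp.eval, Store.natArr_setNat,
      Store.natArr_storeNat_self, hv, h₁.n_eq, Function.update_apply]
    split_ifs with h'
    · simp [hr.le]
    · simpa using hI j (by omega) r hr
  | allPoints =>
    set close : ℕ → Prop := fun q => |s.realArr fPy q - s.realArr fCand i| < Δ with hclose
    refine (RunsWithin.seq (T := 3) (T' := n * (42 + 8) + 6) (.of_loopFree rfl (by decide)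
      ?_)).mono_time (by omega)
    refine (RunsWithin.forUp (n := n) (fun t s' =>
      (∀ j, j < i → s'.natArr aFst j = s₁.natArr aFst j) ∧ n - t ≤ s'.natArr aFst i ∧
      (s'.natArr aFst i < n → close (s'.natArr aFst i)) ∧
      ∀ q, n - t ≤ q → q < s'.natArr aFst i → ¬ close q) (by decide)
      (by simpa using h₁.n_eq) rfl ?_ ?_).mono le_rfl ?_
    · simp only [Program.run, NatExp.eval, Store.natArr_setNat,
        Store.natArr_storeNat_self, hv, h₁.n_eq, Function.update_apply, if_true]
      refine ⟨fun j hj => if_neg hj.ne, by omega, by omega, by omega⟩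
    · rintro t ht s₂ ha₂ hv₂ ⟨j1, j2, j3, j4⟩
      have hp : s₂.realArr fPy = s.realArr fPy :=
        (ha₂.realArr _ (by decide)).trans (by simpa using ha₁.realArr fPy (by decide))
      have hc : s₂.realArr fCand = s.realArr fCand :=
        (ha₂.realArr _ (by decide)).trans (by simpa using ha₁.realArr fCand (by decide))
      have h37 : s₂.natVar 37 = i := (ha₂.natVar _ (by decide)).trans (by simpa using hv)
      have hn₂ : s₂.natVar vn = n := (ha₂.natVar _ (by decide)).trans (by simpa using h₁.n_eq)
      have hΔ₂ : s₂.realVar xΔ = Δ := (ha₂.realVar _ (by decide)).trans (by simpa using h₁.Δ_eq)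
      refine .of_loopFree rfl (by decide) ?_
      have hiff : (s.realArr fPy (n - 1 - t) - s.realArr fCand i < Δ ∧
          s.realArr fCand i - s.realArr fPy (n - 1 - t) < Δ) ↔ close (n - 1 - t) := by
        rw [hclose]
        simp only [abs_lt]
        constructor <;> rintro ⟨a, b⟩ <;> constructor <;> linarith
      simp only [Program.run, Test.Holds, NatExp.eval, RealExp.eval, hp, hc, h37, hn₂, hΔ₂, hv₂,
        hiff]
      by_cases hcl : close (n - 1 - t)
      · rw [if_pos hcl]
        simp only [Store.natArr_setNat, Store.natArr_storeNat_self, Function.update_apply, if_true]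
        refine ⟨fun j hj => by rw [if_neg hj.ne, j1 j hj], by omega, fun _ => hcl, ?_⟩
        intro q h1 h2
        omega
      · rw [if_neg hcl]
        simp only [Store.natArr_setNat]
        refine ⟨j1, by omega, j3, fun q h1 h2 => ?_⟩
        by_cases hq : q = n - 1 - t
        · rwa [hq]
        · exact j4 q (by omega) h2
    · rintro s₂ ⟨-, j1, j2, j3, j4⟩ j hj r hr
      simp only [Store.natArr_setNat]
      rcases Nat.lt_succ_iff_lt_or_eq.1 hj with hj | rfl
      · rw [j1 j hj]
        simpa using hI j hj r hr
      · refine ⟨fun h1 _ q hq => not_lt.1 (j4 q (by omega) (by omega)), fun h1 => ?_⟩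
        by_contra h2
        exact absurd (j3 (by omega)) (not_lt.2 (h1 trivial _ (not_le.1 h2)))

def backbones : Program :=
  mulTable 40 vC vM aMulM ;;
  (.setNat vTop (.cell aMulM (.var vC)) ;; .setNat vBottom (.add (.var vTop) (.const 1)) ;;
    .setNat vNB (.add (.var vTop) (.const 2))) ;;
  .forUp 45 vTop (
    .ite (.natLT (.var 45) (.var vM))
      (.storeReal fHb (.var 45) (.cell fCand (.var 45)) ;; .storeNat aCb (.var 45) (.const 0))
      (.storeReal fHb (.var 45) (.cell fHb (.sub (.var 45) (.var vM))) ;;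
        .storeNat aCb (.var 45) (.add (.cell aCb (.sub (.var 45) (.var vM))) (.const 1)))) ;;
  .storeReal fHb (.var vTop) (.add (.var xTop) (.var xΔ)) ;;
  .storeReal fHb (.var vBottom) (.sub (.var xBottom) (.var xΔ)) ;;
  .storeNat aCb (.var vTop) (.var vC) ;; .storeNat aCb (.var vBottom) (.var vC)

/-- The store holds the backbones. -/
structure Backbones (P : PointSet n C) (Δ : ℝ) (M : ℕ) (s : Store) : Prop where
  mulM_eq : ∀ c, c ≤ C → s.natArr aMulM c = c * M
  top_eq : s.natVar vTop = C * M
  bottom_eq : s.natVar vBottom = C * M + 1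
  NB_eq : s.natVar vNB = C * M + 2
  hb_eq : ∀ c, c < C → ∀ j, j < M → s.realArr fHb (j + c * M) = s.realArr fCand j
  cb_eq : ∀ c, c < C → ∀ j, j < M → s.natArr aCb (j + c * M) = c
  hb_top : s.realArr fHb (C * M) = P.top + Δ
  hb_bottom : s.realArr fHb (C * M + 1) = P.bottom - Δ
  cb_top : s.natArr aCb (C * M) = C
  cb_bottom : s.natArr aCb (C * M + 1) = C

theorem Backbones.of_agree {M : ℕ} (h : Backbones P Δ M s) (ha : AgreeBelow 47 s s') :
    Backbones P Δ M s' where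
  mulM_eq := by rw [ha.natArr _ (by decide)]; exact h.mulM_eq
  top_eq := by rw [ha.natVar _ (by decide)]; exact h.top_eq
  bottom_eq := by rw [ha.natVar _ (by decide)]; exact h.bottom_eq
  NB_eq := by rw [ha.natVar _ (by decide)]; exact h.NB_eq
  hb_eq := by rw [ha.realArr _ (by decide), ha.realArr _ (by decide)]; exact h.hb_eq
  cb_eq := by rw [ha.natArr _ (by decide)]; exact h.cb_eq
  hb_top := by rw [ha.realArr _ (by decide)]; exact h.hb_top
  hb_bottom := by rw [ha.realArr _ (by decide)]; exact h.hb_bottom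
  cb_top := by rw [ha.natArr _ (by decide)]; exact h.cb_top
  cb_bottom := by rw [ha.natArr _ (by decide)]; exact h.cb_bottom

theorem add_mul_lt {c j C M : ℕ} (hc : c < C) (hj : j < M) : j + c * M < C * M :=
  calc j + c * M < M + c * M := by omega
    _ = (c + 1) * M := by ring
    _ ≤ _ := Nat.mul_le_mul_right _ hc

theorem backbones_runs {M : ℕ} (h : Holds P Δ D γ k s) (hM : s.natVar vM = M) :
    RunsWithin backbones s (C * 16 + C * M * 60 + 60) fun s' => AgreeBelow 40 s s' ∧
      Backbones P Δ M s' := by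
  refine (RunsWithin.seq (T := C * 16 + 9) (T' := 12 + ((C * M * (30 + 8) + 6) + (20)))
    ?_).mono_time (by omega)
  refine (mulTable_runs (by decide) (by decide) (by decide) h.C_eq hM).mono le_rfl ?_
  rintro s₁ ⟨ha₁, hmul⟩
  refine .seq (.of_loopFree rfl (by decide) (.seq ?_))
  have h₁ := h.of_agree (ha₁.mono (by decide))
  have hM₁ : s₁.natVar vM = M := (ha₁.natVar _ (by decide)).trans hM
  set s₂ := Program.run (.setNat vTop (.cell aMulM (.var vC)) ;;
    .setNat vBottom (.add (.var vTop) (.const 1)) ;;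
    .setNat vNB (.add (.var vTop) (.const 2))) s₁ with hs₂
  have ha₂ : AgreeBelow 42 s₁ s₂ := by
    simp only [hs₂, Program.run]
    exact ((AgreeBelow.setNat (by decide)).trans (.setNat (by decide))).trans (.setNat (by decide))
  have h₂ := h₁.of_agree (ha₂.mono (by decide))
  have hM₂ : s₂.natVar vM = M := (ha₂.natVar _ (by decide)).trans hM₁
  have hT₂ : s₂.natVar vTop = C * M := by simp [hs₂, h₁.C_eq, hmul]
  have hBo₂ : s₂.natVar vBottom = C * M + 1 := by simp [hs₂, h₁.C_eq, hmul]
  have hN₂ : s₂.natVar vNB = C * M + 2 := by simp [hs₂, h₁.C_eq, hmul]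
  have hmul₂ : s₂.natArr aMulM = s₁.natArr aMulM := ha₂.natArr _ (by decide)
  refine (RunsWithin.forUp (fun i s' => ∀ c j, j < M → j + c * M < i →
    s'.realArr fHb (j + c * M) = s₂.realArr fCand j ∧ s'.natArr aCb (j + c * M) = c) (by decide)
    hT₂ rfl (by simp) ?_).mono le_rfl ?_
  · intro i hi s₃ ha₃ hv hI
    have hM₃ : s₃.natVar vM = M := (ha₃.natVar _ (by decide)).trans hM₂
    have hY₃ : s₃.realArr fCand = s₂.realArr fCand := ha₃.realArr _ (by decide)
    refine .of_loopFree rfl (by decide) ?_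
    intro c j hj hlt
    simp only [Program.run, Test.Holds, NatExp.eval, RealExp.eval, hv, hM₃, hY₃]
    by_cases hne : j + c * M = i
    · by_cases hiM : i < M
      · rw [if_pos hiM]
        obtain rfl : c = 0 := by
          rcases Nat.eq_zero_or_pos c with h' | h'
          · exact h'
          · have := Nat.le_mul_of_pos_left M h'
            omega
        obtain rfl : j = i := by simpa using hne
        simp [hv]
      · rw [if_neg hiM]
        obtain ⟨c, rfl⟩ : ∃ c', c = c' + 1 := ⟨c - 1, by
          rcases Nat.eq_zero_or_pos c with rfl | h'
          · simp at hne; omega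
          · omega⟩
        have e : (c + 1) * M = c * M + M := by ring
        obtain ⟨i1, i2⟩ := hI c j hj (by omega)
        have e' : i - M = j + c * M := by omega
        simp [hv, hM₃, hne, e', i1, i2]
    · obtain ⟨i1, i2⟩ := hI c j hj (by omega)
      split_ifs
      · simp [hv, hne, i1, i2]
      · simp [hv, hne, i1, i2]
  · rintro s₃ ⟨ha₃, hI⟩
    have h₃ := h₂.of_agree (ha₃.mono (by decide))
    have hT₃ : s₃.natVar vTop = C * M := (ha₃.natVar _ (by decide)).trans hT₂
    have hBo₃ : s₃.natVar vBottom = C * M + 1 := (ha₃.natVar _ (by decide)).trans hBo₂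
    have hN₃ : s₃.natVar vNB = C * M + 2 := (ha₃.natVar _ (by decide)).trans hN₂
    have hY₃ : s₃.realArr fCand = s₂.realArr fCand := ha₃.realArr _ (by decide)
    have hmul₃ : s₃.natArr aMulM = s₁.natArr aMulM := (ha₃.natArr _ (by decide)).trans hmul₂
    refine .of_loopFree rfl (by decide) ⟨?_, ?_⟩
    · refine (ha₁.trans (ha₂.mono (by decide))).trans ((ha₃.mono (by decide)).trans ?_)
      exact ((AgreeBelow.storeReal (by decide)).trans (.storeReal (by decide))).trans
        ((AgreeBelow.storeNat (by decide)).trans (.storeNat (by decide)))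
    · refine ⟨?_, ?_, ?_, ?_, ?_, ?_, ?_, ?_, ?_, ?_⟩
      · intro c hc
        simp [hmul₃, hmul c hc]
      · simp [hT₃]
      · simp [hBo₃]
      · simp [hN₃]
      · intro c hc j hj
        have := add_mul_lt hc hj
        have e1 : j + c * M ≠ C * M := by omega
        have e2 : j + c * M ≠ C * M + 1 := by omega
        simp [hT₃, hBo₃, e1, e2, hY₃, (hI c j hj this).1]
      · intro c hc j hj
        have := add_mul_lt hc hj
        have e1 : j + c * M ≠ C * M := by omega
        have e2 : j + c * M ≠ C * M + 1 := by omega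
        simp [hT₃, hBo₃, e1, e2, (hI c j hj this).2]
      · simp [hT₃, hBo₃, h₃.top_eq, h₃.Δ_eq]
      · simp [hT₃, hBo₃, h₃.bottom_eq, h₃.Δ_eq]
      · simp [hT₃, hBo₃, h₃.C_eq]
      · simp [hT₃, hBo₃, h₃.C_eq]

def strides : Program :=
  .setNat vZ (.add (.add (.add (.var vn) (.const 1)) (.var vNB)) (.var vB)) ;;
  mulTable 48 vZ vZ aZ₁ ;; .setNat 50 (.cell aZ₁ (.var vZ)) ;;
  mulTable 51 vZ 50 aZ₂ ;; .setNat 53 (.cell aZ₂ (.var vZ)) ;;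
  mulTable 54 vZ 53 aZ₃

/-- The store holds the strides of a table with indices below `Z`. -/
structure Strides (Z : ℕ) (s : Store) : Prop where
  Z₁_eq : ∀ i, i ≤ Z → s.natArr aZ₁ i = i * Z
  Z₂_eq : ∀ i, i ≤ Z → s.natArr aZ₂ i = i * (Z * Z)
  Z₃_eq : ∀ i, i ≤ Z → s.natArr aZ₃ i = i * (Z * (Z * Z))

theorem Strides.of_agree {Z : ℕ} (h : Strides Z s) (ha : AgreeBelow 56 s s') : Strides Z s' where
  Z₁_eq := by rw [ha.natArr _ (by decide)]; exact h.Z₁_eq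
  Z₂_eq := by rw [ha.natArr _ (by decide)]; exact h.Z₂_eq
  Z₃_eq := by rw [ha.natArr _ (by decide)]; exact h.Z₃_eq

theorem strides_runs {Z : ℕ} (hZ : s.natVar vn + 1 + s.natVar vNB + s.natVar vB = Z) :
    RunsWithin strides s (Z * 48 + 60) fun s' => AgreeBelow 47 s s' ∧ s'.natVar vZ = Z ∧
      Strides Z s' := by
  refine (RunsWithin.seq (T := 8) (T' := (Z * 16 + 9) + (3 + ((Z * 16 + 9) + (3 + (Z * 16 + 9)))))
    ?_).mono_time (by omega)
  refine .of_loopFree rfl (by decide) (.seq ?_)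
  have hZ₀ : (Program.run (.setNat vZ (.add (.add (.add (.var vn) (.const 1)) (.var vNB))
    (.var vB))) s).natVar vZ = Z := by simp [hZ]
  refine (mulTable_runs (by decide) (by decide) (by decide) hZ₀ hZ₀).mono le_rfl ?_
  rintro s₁ ⟨ha₁, h1⟩
  have hZ₁ : s₁.natVar vZ = Z := (ha₁.natVar _ (by decide)).trans hZ₀
  refine .seq (.of_loopFree rfl (by decide) (.seq ?_))
  refine (mulTable_runs (n := Z) (k := Z * Z) (by decide) (by decide) (by decide)
    (by simp [hZ₁]) (by simp [hZ₁, h1])).mono le_rfl ?_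
  rintro s₂ ⟨ha₂, h2⟩
  have hZ₂ : s₂.natVar vZ = Z := (ha₂.natVar _ (by decide)).trans (by simp [hZ₁])
  refine .seq (.of_loopFree rfl (by decide) ?_)
  refine (mulTable_runs (n := Z) (k := Z * (Z * Z)) (by decide) (by decide) (by decide)
    (by simp [hZ₂]) (by simp [hZ₂, h2])).mono le_rfl ?_
  rintro s₃ ⟨ha₃, h3⟩
  have b₁ : AgreeBelow 50 s₁ s₂ := (AgreeBelow.setNat (by decide)).trans (ha₂.mono (by decide))
  have b₂ : AgreeBelow 53 s₂ s₃ := (AgreeBelow.setNat (by decide)).trans (ha₃.mono (by decide))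
  refine ⟨(AgreeBelow.setNat (by decide)).trans ((ha₁.mono (by decide)).trans
    ((b₁.mono (by decide)).trans (b₂.mono (by decide)))), ?_, ?_, ?_, h3⟩
  · rw [b₂.natVar _ (by decide), hZ₂]
  · rw [b₂.natArr _ (by decide), b₁.natArr _ (by decide)]
    exact h1
  · rw [b₂.natArr _ (by decide)]
    exact h2

end BackboneLabeling

namespace BackboneLabeling

open Reg

variable {n C : ℕ} {P : PointSet n C} {Δ : ℝ} {D : ℕ} {γ k : ℕ → ℕ} {s s' : Store}

/-! ### The preparation of the dynamic program -/

/-- The data of the dynamic program that are in the store. -/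
noncomputable def dataOf (s : Store) : Data where
  n := s.natVar vn
  C := s.natVar vC
  M := s.natVar vM
  B := s.natVar vB
  D := s.natVar vD
  Δ := s.realVar xΔ
  bottom := s.realVar xBottom
  top := s.realVar xTop
  py := s.realArr fPy
  bc := s.realArr fBc
  Y := s.realArr fCand
  hb := s.realArr fHb
  pc := s.natArr aPc
  cls := s.natArr aCls
  k := s.natArr aK
  W := s.natArr aW
  e := s.natArr aE
  cd := s.natArr aCd
  ι := s.natArr aInv
  fst := s.natArr aFst
  cb := s.natArr aCb

theorem dataOf_of_agree (h : AgreeBelow 56 s s') : dataOf s' = dataOf s := by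
  simp only [dataOf]
  congr 1
  all_goals first
    | exact h.natVar _ (by decide) | exact h.realVar _ (by decide)
    | exact h.natArr _ (by decide) | exact h.realArr _ (by decide)

/-- The store holds the data `d`, and strides for tables with indices below `Z`. -/
structure Ready (d : Data) (Z : ℕ) (s : Store) : Prop where
  data_eq : dataOf s = d
  mulM_eq : ∀ c, c ≤ d.C → s.natArr aMulM c = c * d.M
  top_eq : s.natVar vTop = d.virtualTop
  bottom_eq : s.natVar vBottom = d.virtualBottom
  NB_eq : s.natVar vNB = d.C * d.M + 2
  strides : Strides Z s
  n_lt : d.n < Z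
  NB_le : d.C * d.M + 2 ≤ Z
  B_le : d.B ≤ Z

theorem Ready.of_agree {d : Data} {Z : ℕ} (h : Ready d Z s) (ha : AgreeBelow 56 s s') :
    Ready d Z s' where
  data_eq := (dataOf_of_agree ha).trans h.data_eq
  mulM_eq := by rw [ha.natArr _ (by decide)]; exact h.mulM_eq
  top_eq := by rw [ha.natVar _ (by decide)]; exact h.top_eq
  bottom_eq := by rw [ha.natVar _ (by decide)]; exact h.bottom_eq
  NB_eq := by rw [ha.natVar _ (by decide)]; exact h.NB_eq
  strides := h.strides.of_agree ha
  n_lt := h.n_lt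
  NB_le := h.NB_le
  B_le := h.B_le

def setup (cl : Clearance) (obj : Objective) : Program :=
  sortPoints ;; gatherPoints obj ;; enumBudgets ;; invertCodes ;; birthCodes ;; candidates ;;
  firstClose cl ;; backbones ;; strides

/-- The order of the running time. -/
def timeOrder (n C B : ℕ) : ℕ := n ^ 7 * C ^ 2 * B ^ 2

theorem le_timeOrder {n C B a b c : ℕ} (hn : 0 < n) (hC : 0 < C) (hB : 0 < B) (ha : a ≤ 7)
    (hb : b ≤ 2) (hc : c ≤ 2) : n ^ a * C ^ b * B ^ c ≤ timeOrder n C B :=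
  Nat.mul_le_mul (Nat.mul_le_mul (Nat.pow_le_pow_right hn ha) (Nat.pow_le_pow_right hC hb))
    (Nat.pow_le_pow_right hB hc)

theorem numCand_le (hn : 0 < n) : numCand n ≤ 15 * n ^ 2 := by
  simp only [numCand]
  nlinarith

theorem setup_runs (cl : Clearance) (obj : Objective) (h : Holds P Δ D γ k s) (hn : 0 < n)
    (hΔ : 0 < Δ) (hk : ∀ c, c < D → 0 < k c) (hγ : ∀ c, c < C → γ c < D) (hDC : D ≤ C) :
    RunsWithin (setup cl obj) s (20000 * timeOrder n C (boxCard k D)) fun s' =>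
      AgreeBelow 8 s s' ∧ ∃ σ : Equiv.Perm (Fin n), (∀ r : Fin n, s'.natArr aPts r = σ r) ∧
        ∃ d Z, Ready d Z s' ∧ d.Ok cl ∧ d.Fits P Δ obj γ σ ∧ d.M = numCand n ∧
          d.B = boxCard k D ∧ d.D = D ∧ ∀ c, c < D → d.k c = k c := by
  set B := boxCard k D with hBdef
  have hB : 0 < B := boxCard_pos hk
  have hC : 0 < C := (Fin.pos (P.color ⟨0, hn⟩))
  set Z := n + 1 + (C * numCand n + 2) + B with hZ
  refine (RunsWithin.seq (T := n * (n * 30 + 30) + 6) (T' := (n * 48 + 6) + ((D * (B * 100) + 20) +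
    ((B * 20 + 6) + ((n * (n * 40 + 40) + 6) + ((numCand n * 100 + 100) +
    ((numCand n * (n * 50 + 30) + 6) + ((C * 16 + C * numCand n * 60 + 60) +
    (Z * 48 + 60)))))))) ?_).mono_time ?_
  rotate_left
  · have hM := numCand_le hn
    have hMn : numCand n * n ≤ 15 * n ^ 3 := by
      calc numCand n * n ≤ 15 * n ^ 2 * n := Nat.mul_le_mul_right _ hM
        _ = _ := by ring
    have hCM : C * numCand n ≤ 15 * (n ^ 2 * C) := by
      calc C * numCand n ≤ C * (15 * n ^ 2) := Nat.mul_le_mul_left _ hM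
        _ = _ := by ring
    have hDB : D * B ≤ C * B := Nat.mul_le_mul_right _ hDC
    have g0 := le_timeOrder (a := 0) (b := 0) (c := 0) hn hC hB (by simp) (by simp) (by simp)
    have g1 := le_timeOrder (a := 1) (b := 0) (c := 0) hn hC hB (by simp) (by simp) (by simp)
    have g2 := le_timeOrder (a := 2) (b := 0) (c := 0) hn hC hB (by simp) (by simp) (by simp)
    have g3 := le_timeOrder (a := 3) (b := 0) (c := 0) hn hC hB (by simp) (by simp) (by simp)
    have g4 := le_timeOrder (a := 2) (b := 1) (c := 0) hn hC hB (by simp) (by simp) (by simp)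
    have g5 := le_timeOrder (a := 0) (b := 1) (c := 1) hn hC hB (by simp) (by simp) (by simp)
    have g6 := le_timeOrder (a := 0) (b := 0) (c := 1) hn hC hB (by simp) (by simp) (by simp)
    have g7 := le_timeOrder (a := 0) (b := 1) (c := 0) hn hC hB (by simp) (by simp) (by simp)
    simp only [pow_zero, one_mul, mul_one, pow_one] at g0 g1 g2 g3 g4 g5 g6 g7
    rw [hZ]
    nlinarith
  refine ((sortPoints_runs h).mono le_rfl ?_)
  rintro s₁ ⟨a₁, σ, hmono, hσ⟩
  have h₁ := h.of_agree a₁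
  refine .seq ((gatherPoints_runs obj h₁ hσ).mono le_rfl ?_)
  rintro s₂ ⟨a₂, hsort⟩
  have h₂ := h₁.of_agree (a₂.mono (by decide))
  refine .seq ((enumBudgets_runs h₂ hk).mono le_rfl ?_)
  rintro s₃ ⟨a₃, hbud⟩
  have h₃ := h₂.of_agree (a₃.mono (by decide))
  refine .seq ((invertCodes_runs hbud.B_eq).mono le_rfl ?_)
  rintro s₄ ⟨a₄, hinv⟩
  have h₄ := h₃.of_agree (a₄.mono (by decide))
  refine .seq ((birthCodes_runs h₄.n_eq).mono le_rfl ?_)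
  rintro s₅ ⟨a₅, hbirth⟩
  have h₅ := h₄.of_agree (a₅.mono (by decide))
  refine .seq ((candidates_runs h₅).mono le_rfl ?_)
  rintro s₆ ⟨a₆, hM₆, hcand⟩
  have h₆ := h₅.of_agree (a₆.mono (by decide))
  refine .seq ((firstClose_runs cl h₆ hM₆).mono le_rfl ?_)
  rintro s₇ ⟨a₇, hfst⟩
  have h₇ := h₆.of_agree (a₇.mono (by decide))
  have hM₇ : s₇.natVar vM = numCand n := (a₇.natVar _ (by decide)).trans hM₆
  refine .seq ((backbones_runs h₇ hM₇).mono le_rfl ?_)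
  rintro s₈ ⟨a₈, hbb⟩
  have h₈ := h₇.of_agree (a₈.mono (by decide))
  have b₄ : AgreeBelow 24 s₃ s₈ := a₄.trans ((a₅.mono (by decide)).trans ((a₆.mono (by decide)).trans
    ((a₇.mono (by decide)).trans (a₈.mono (by decide)))))
  have hB₈ : s₈.natVar vB = B := (b₄.natVar _ (by decide)).trans hbud.B_eq
  refine (strides_runs (Z := Z) (by rw [h₈.n_eq, hbb.NB_eq, hB₈])).mono le_rfl ?_
  rintro s₉ ⟨a₉, -, hstr⟩
  have h₉ := h₈.of_agree (a₉.mono (by decide))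
  have c₈ : AgreeBelow 40 s₇ s₉ := a₈.trans (a₉.mono (by decide))
  have c₇ : AgreeBelow 37 s₆ s₉ := a₇.trans (c₈.mono (by decide))
  have c₆ : AgreeBelow 29 s₅ s₉ := a₆.trans (c₇.mono (by decide))
  have c₅ : AgreeBelow 26 s₄ s₉ := a₅.trans (c₆.mono (by decide))
  have c₄ : AgreeBelow 24 s₃ s₉ := a₄.trans (c₅.mono (by decide))
  have c₃ : AgreeBelow 14 s₂ s₉ := a₃.trans (c₄.mono (by decide))
  have hsort₉ := hsort.of_agree c₃
  have hbud₉ := hbud.of_agree c₄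
  have hbb₉ := hbb.of_agree a₉
  have hM₉ : s₉.natVar vM = numCand n := (c₇.natVar _ (by decide)).trans hM₆
  have hcand₉ : s₉.realArr fCand = s₆.realArr fCand := c₇.realArr _ (by decide)
  have hcode : ∀ u, (dataOf s₉).code u = codeOf k D u := fun u => by
    simp only [Data.code, dataOf, h₉.D_eq, codeOf]
    exact Finset.sum_congr rfl fun c hc => by rw [hbud₉.W_eq c (Finset.mem_range.1 hc)]
  have hkD : ∀ c, c < (dataOf s₉).D → (dataOf s₉).k c = k c := fun c hc =>
    h₉.k_eq c (by simpa only [dataOf, h₉.D_eq] using hc)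
  have hDD : (dataOf s₉).D = D := h₉.D_eq
  have hdn : (dataOf s₉).n = n := h₉.n_eq
  have hpc : ∀ r : Fin n, (dataOf s₉).pc r = P.color (σ r) := hsort₉.pc_eq
  have hcls : ∀ r : Fin n, (dataOf s₉).cls r = γ (P.color (σ r)) := hsort₉.cls_eq
  have hpy : ∀ r : Fin n, (dataOf s₉).py r = P.y (σ r) := hsort₉.py_eq
  refine ⟨a₁.trans ((a₂.mono (by decide)).trans (c₃.mono (by decide))), σ, hsort₉.pts_eq,
    dataOf s₉, Z, ?_, ?_, ?_, hM₉, hbud₉.B_eq, hDD, fun c hc => hkD c (hDD ▸ hc)⟩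
  · refine ⟨rfl, ?_, ?_, ?_, ?_, hstr, ?_, ?_, ?_⟩
    · simpa only [dataOf, h₉.C_eq, hM₉] using hbb₉.mulM_eq
    · simpa only [Data.virtualTop, dataOf, h₉.C_eq, hM₉] using hbb₉.top_eq
    · simpa only [Data.virtualBottom, dataOf, h₉.C_eq, hM₉] using hbb₉.bottom_eq
    · simpa only [dataOf, h₉.C_eq, hM₉] using hbb₉.NB_eq
    · rw [hdn]; omega
    · simp only [dataOf, h₉.C_eq, hM₉]; omega
    · simp only [dataOf, hbud₉.B_eq]; omega
  · refine ⟨by simpa only [dataOf, h₉.Δ_eq] using hΔ, ?_, ?_, ?_, ?_, ?_, ?_, ?_, ?_, ?_, ?_, ?_, ?_,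
      ?_, ?_⟩
    · intro i hi
      obtain ⟨u, hu, hcd⟩ := hbud₉.enum.1 i (by simpa only [dataOf, hbud₉.B_eq] using hi)
      exact ⟨u, fun c hc => by rw [hkD c hc]; exact hu c (hDD ▸ hc), by rw [hcode]; exact hcd⟩
    · intro u hu
      obtain ⟨t, ht, hcd⟩ := hbud₉.enum.2 u
        fun c hc => by have := hu c (hDD ▸ hc); rwa [hkD c (hDD ▸ hc)] at this
      have e1 : (dataOf s₉).cd = s₃.natArr aCd := c₄.natArr _ (by decide)
      have e2 : (dataOf s₉).ι = s₄.natArr aInv := c₅.natArr _ (by decide)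
      have e3 : (dataOf s₉).B = B := hbud₉.B_eq
      rw [hcode, ← hcd, e1, e2, e3, c₄.natArr aCd (by decide)]
      exact hinv t ht
    · intro u u' hu hu' he c hc
      rw [hcode, hcode] at he
      have hk2 : ∀ c, c < D → 2 * (dataOf s₉).k c = 2 * k c := fun c hc => by
        rw [hkD c (hDD ▸ hc)]
      exact codeOf_inj (fun c hc => hk2 c hc ▸ hu c (hDD ▸ hc))
        (fun c hc => hk2 c hc ▸ hu' c (hDD ▸ hc)) he c (hDD ▸ hc)
    · intro q q' hq hq' hqq'
      rw [hdn] at hq hq'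
      have e1 := hcls ⟨q, hq⟩
      have e2 := hcls ⟨q', hq'⟩
      have e3 := hpc ⟨q, hq⟩
      have e4 := hpc ⟨q', hq'⟩
      simp only at e1 e2 e3 e4
      rw [e1, e2, ← e3, ← e4, hqq']
    · intro q hq
      rw [hdn] at hq
      have e0 : (dataOf s₉).e = s₅.natArr aE := c₆.natArr _ (by decide)
      have e1 : s₄.natArr aCls = (dataOf s₉).cls := (c₅.natArr aCls (by decide)).symm
      have e2 : s₄.natArr aW = (dataOf s₉).W := (c₅.natArr aW (by decide)).symm
      rw [e0, hbirth q hq, e1, e2, Data.code, hDD]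
      have hlt : (dataOf s₉).cls q < D := by
        rw [show (dataOf s₉).cls q = _ from hcls ⟨q, hq⟩]
        exact hγ _ (Fin.is_lt _)
      rw [Finset.sum_eq_single ((dataOf s₉).cls q)]
      · simp only [Data.notFirst, true_and]
        split_ifs <;> simp
      · intro c _ hc
        simp [Data.notFirst, hc.symm]
      · intro h'
        exact absurd (Finset.mem_range.2 hlt) h'
    · intro q hq
      rw [hdn] at hq
      rw [show (dataOf s₉).pc q = _ from hpc ⟨q, hq⟩, show (dataOf s₉).C = C from h₉.C_eq]
      exact Fin.is_lt _
    · intro q hq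
      rw [hdn] at hq
      rw [show (dataOf s₉).py q = _ from hpy ⟨q, hq⟩,
        show (dataOf s₉).bottom = P.bottom from h₉.bottom_eq,
        show (dataOf s₉).top = P.top from h₉.top_eq]
      exact P.y_mem _
    · simpa only [dataOf, h₉.C_eq, hM₉] using hbb₉.hb_eq
    · simpa only [dataOf, h₉.C_eq, hM₉] using hbb₉.cb_eq
    · simpa only [Data.virtualTop, dataOf, h₉.C_eq, hM₉, h₉.top_eq, h₉.Δ_eq] using hbb₉.hb_top
    · simpa only [Data.virtualBottom, dataOf, h₉.C_eq, hM₉, h₉.bottom_eq, h₉.Δ_eq]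
        using hbb₉.hb_bottom
    · simpa only [Data.virtualTop, dataOf, h₉.C_eq, hM₉] using hbb₉.cb_top
    · simpa only [Data.virtualBottom, dataOf, h₉.C_eq, hM₉] using hbb₉.cb_bottom
    · have e1 : s₉.natArr aFst = s₇.natArr aFst := c₈.natArr _ (by decide)
      have e2 : s₉.realArr fPy = s₆.realArr fPy := c₇.realArr _ (by decide)
      simpa only [dataOf, hM₉, h₉.n_eq, h₉.Δ_eq, e1, e2, hcand₉] using hfst
  · refine ⟨hdn, h₉.C_eq, h₉.Δ_eq, h₉.bottom_eq, h₉.top_eq, hmono, hpy, hpc, hsort₉.bc_eq, hcls, ?_⟩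
    simp only [dataOf, hM₉, hcand₉]
    exact exists_candidate_index hcand

end BackboneLabeling

namespace BackboneLabeling

namespace Reg

/-- rank of the current point -/
abbrev vR : ℕ := 61
/-- counters of the loops over the backbones -/
abbrev lTop : ℕ := 62
abbrev lBot : ℕ := 63
/-- best decision without a new label -/
abbrev vStay : ℕ := 64
/-- its costs -/
abbrev xStay : ℕ := 64
/-- address of the current cells -/
abbrev vCell : ℕ := 65
/-- address of the cells of the next point -/
abbrev vNext : ℕ := 66
/-- counter of the loops over budgets or candidates -/
abbrev lJ : ℕ := 67
/-- addresses of the cells for the two parts of the strip -/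
abbrev vUp : ℕ := 68
abbrev vLow : ℕ := 69
/-- costs of a new label -/
abbrev xNew : ℕ := 69
/-- counters of the loops over the budgets of the two parts -/
abbrev lUp : ℕ := 70
abbrev lLow : ℕ := 71
abbrev vCode : ℕ := 72
abbrev vBudget : ℕ := 73
abbrev aKind : ℕ := 74
abbrev aCand : ℕ := 75
abbrev aUpper : ℕ := 76
abbrev aLower : ℕ := 77
abbrev fVal : ℕ := 74

end Reg

open Reg

variable {d : Data} {Z r b₁ b₂ i : ℕ} {s s' s'' : Store} {cl : Clearance}

namespace Ready

theorem n_eq (h : Ready d Z s) : s.natVar vn = d.n := by rw [← h.data_eq]; rfl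
theorem M_eq (h : Ready d Z s) : s.natVar vM = d.M := by rw [← h.data_eq]; rfl
theorem B_eq (h : Ready d Z s) : s.natVar vB = d.B := by rw [← h.data_eq]; rfl
theorem Δ_eq (h : Ready d Z s) : s.realVar xΔ = d.Δ := by rw [← h.data_eq]; rfl
theorem py_eq (h : Ready d Z s) : s.realArr fPy = d.py := by rw [← h.data_eq]; rfl
theorem bc_eq (h : Ready d Z s) : s.realArr fBc = d.bc := by rw [← h.data_eq]; rfl
theorem Y_eq (h : Ready d Z s) : s.realArr fCand = d.Y := by rw [← h.data_eq]; rfl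
theorem hb_eq (h : Ready d Z s) : s.realArr fHb = d.hb := by rw [← h.data_eq]; rfl
theorem pc_eq (h : Ready d Z s) : s.natArr aPc = d.pc := by rw [← h.data_eq]; rfl
theorem e_eq (h : Ready d Z s) : s.natArr aE = d.e := by rw [← h.data_eq]; rfl
theorem cd_eq (h : Ready d Z s) : s.natArr aCd = d.cd := by rw [← h.data_eq]; rfl
theorem ι_eq (h : Ready d Z s) : s.natArr aInv = d.ι := by rw [← h.data_eq]; rfl
theorem fst_eq (h : Ready d Z s) : s.natArr aFst = d.fst := by rw [← h.data_eq]; rfl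
theorem cb_eq (h : Ready d Z s) : s.natArr aCb = d.cb := by rw [← h.data_eq]; rfl

end Ready

/-! ### The table of the dynamic program in the store -/

/-- The address of the first cell for the point `r` and the strip between `b₁` and `b₂`. -/
def cellBase (Z r b₁ b₂ : ℕ) : ℕ := b₂ * Z + b₁ * (Z * Z) + r * (Z * (Z * Z))

theorem cellBase_inj {r' b₁' b₂' i' : ℕ} (h₁ : b₁ < Z) (h₂ : b₂ < Z) (h₁' : b₁' < Z)
    (h₂' : b₂' < Z) (hi : i < Z) (hi' : i' < Z)
    (h : cellBase Z r b₁ b₂ + i = cellBase Z r' b₁' b₂' + i') :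
    r = r' ∧ b₁ = b₁' ∧ b₂ = b₂' ∧ i = i' := by
  have key : ∀ {x y x' y' : ℕ}, x < Z → x' < Z → x + Z * y = x' + Z * y' → x = x' ∧ y = y' := by
    intro x y x' y' hx hx' he
    have e1 := congrArg (· % Z) he
    have e2 := congrArg (· / Z) he
    have hZ : 0 < Z := by omega
    simp only [Nat.add_mul_mod_self_left, Nat.mod_eq_of_lt hx, Nat.mod_eq_of_lt hx',
      Nat.add_mul_div_left _ _ hZ, Nat.div_eq_of_lt hx, Nat.div_eq_of_lt hx', zero_add] at e1 e2
    exact ⟨e1, e2⟩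
  have e : i + Z * (b₂ + Z * (b₁ + Z * r)) = i' + Z * (b₂' + Z * (b₁' + Z * r')) := by
    simp only [cellBase] at h
    linarith [h]
  obtain ⟨e1, e⟩ := key hi hi' e
  obtain ⟨e2, e⟩ := key h₂ h₂' e
  obtain ⟨e3, e⟩ := key h₁ h₁' e
  exact ⟨e, e3, e2, e1⟩

/-- The contents of a cell of the table. -/
def cellAt (s : Store) (x : ℕ) : ℕ × ℕ × ℕ × ℕ × ℝ :=
  (s.natArr aKind x, s.natArr aCand x, s.natArr aUpper x, s.natArr aLower x, s.realArr fVal x)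

/-- The table in the store. -/
def tableOf (Z : ℕ) (s : Store) : Table where
  kind r b₁ b₂ i := (cellAt s (cellBase Z r b₁ b₂ + i)).1
  cand r b₁ b₂ i := (cellAt s (cellBase Z r b₁ b₂ + i)).2.1
  upper r b₁ b₂ i := (cellAt s (cellBase Z r b₁ b₂ + i)).2.2.1
  lower r b₁ b₂ i := (cellAt s (cellBase Z r b₁ b₂ + i)).2.2.2.1
  val r b₁ b₂ i := (cellAt s (cellBase Z r b₁ b₂ + i)).2.2.2.2

/-- The cell is the best of the decisions in `S`. -/
def BestCell (S : ℕ → ℕ → ℕ → ℕ → ℝ → Prop) (x : ℕ × ℕ × ℕ × ℕ × ℝ) : Prop :=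
  Data.IsBest S x.1 x.2.1 x.2.2.1 x.2.2.2.1 x.2.2.2.2

/-- Only the `m` cells from `A` on are different in `s` and `s'`. -/
def SameOff (A m : ℕ) (s s' : Store) : Prop :=
  ∀ x, (∀ i, i < m → x ≠ A + i) → cellAt s' x = cellAt s x

theorem SameOff.trans {A m : ℕ} (h : SameOff A m s s') (h' : SameOff A m s' s'') :
    SameOff A m s s'' := fun x hx => (h' x hx).trans (h x hx)

theorem SameOff.cellAt_eq {r' b₁' b₂' m : ℕ} (h : SameOff (cellBase Z r b₁ b₂) m s s')
    (hm : m ≤ Z) (h₁ : b₁ < Z) (h₂ : b₂ < Z) (h₁' : b₁' < Z) (h₂' : b₂' < Z) (hi : i < Z)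
    (hne : ¬ (r' = r ∧ b₁' = b₁ ∧ b₂' = b₂)) :
    cellAt s' (cellBase Z r' b₁' b₂' + i) = cellAt s (cellBase Z r' b₁' b₂' + i) := by
  refine h _ fun i' hi' he => hne ?_
  obtain ⟨e1, e2, e3, -⟩ := cellBase_inj h₁' h₂' h₁ h₂ hi (by omega) he
  exact ⟨e1, e2, e3⟩

theorem Data.Choice.congr {T T' : Table} {κ j i' i'' : ℕ} {v : ℝ} (ok : d.Ok cl) (hr : r < d.n)
    (h₁ : b₁ < d.C * d.M + 2) (h₂ : b₂ < d.C * d.M + 2) (hi : i < d.B)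
    (hT : ∀ b₁, b₁ < d.C * d.M + 2 → ∀ b₂, b₂ < d.C * d.M + 2 → ∀ i, i < d.B →
      T'.kind (r + 1) b₁ b₂ i = T.kind (r + 1) b₁ b₂ i ∧
      T'.val (r + 1) b₁ b₂ i = T.val (r + 1) b₁ b₂ i)
    (h : d.Choice T r b₁ b₂ i κ j i' i'' v) : d.Choice T' r b₁ b₂ i κ j i' i'' v := by
  obtain ⟨k₀, v₀⟩ := hT b₁ h₁ b₂ h₂ i hi
  cases h with
  | pass g g' => rw [← k₀] at g'; rw [← v₀]; exact .pass g g'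
  | up g g₁ g₂ g' => rw [← k₀] at g'; rw [← v₀]; exact .up g g₁ g₂ g'
  | down g g₁ g₂ g' => rw [← k₀] at g'; rw [← v₀]; exact .down g g₁ g₂ g'
  | split g g₁ g₂ hj g₃ g₄ g₅ hi' hi'' g₆ g₇ g' g'' =>
    have hn : j + d.pc r * d.M < d.C * d.M + 2 := by
      have := add_mul_lt (ok.pc_lt r hr) hj
      omega
    obtain ⟨k₁, v₁⟩ := hT b₁ h₁ _ hn i' hi'
    obtain ⟨k₂, v₂⟩ := hT _ hn b₂ h₂ i'' hi''
    rw [← k₁] at g'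
    rw [← k₂] at g''
    rw [← v₁, ← v₂]
    exact .split g g₁ g₂ hj g₃ g₄ g₅ hi' hi'' g₆ g₇ g' g''

/-! ### Decisions without a new label -/

/-- The decisions without a new label and their costs. -/
inductive Data.Stay (d : Data) (r b₁ b₂ : ℕ) : ℕ → ℝ → Prop
  | pass : ¬ d.InStrip r b₁ b₂ → Stay d r b₁ b₂ 1 0
  | up : d.InStrip r b₁ b₂ → d.pc r = d.cb b₁ → d.Δ ≤ d.py r - d.hb b₂ →
      Stay d r b₁ b₂ 2 (d.hb b₁ - d.py r)
  | down : d.InStrip r b₁ b₂ → d.pc r = d.cb b₂ → d.Δ ≤ d.hb b₁ - d.py r →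
      Stay d r b₁ b₂ 3 (d.py r - d.hb b₂)

theorem Data.Stay.choice {T : Table} {κ j i' i'' : ℕ} {v : ℝ} (h : d.Stay r b₁ b₂ κ v)
    (hk : T.kind (r + 1) b₁ b₂ i ≠ 0) :
    d.Choice T r b₁ b₂ i κ j i' i'' (T.val (r + 1) b₁ b₂ i + v) ∧ κ ≠ 4 := by
  cases h with
  | pass g => exact ⟨by simpa using Data.Choice.pass g hk, by decide⟩
  | up g g₁ g₂ => exact ⟨.up g g₁ g₂ hk, by decide⟩
  | down g g₁ g₂ => exact ⟨.down g g₁ g₂ hk, by decide⟩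

theorem Data.Choice.stay {T : Table} {κ j i' i'' : ℕ} {v : ℝ}
    (h : d.Choice T r b₁ b₂ i κ j i' i'' v) (hκ : κ ≠ 4) : T.kind (r + 1) b₁ b₂ i ≠ 0 ∧
      ∃ c, d.Stay r b₁ b₂ κ c ∧ v = T.val (r + 1) b₁ b₂ i + c := by
  cases h with
  | pass g g' => exact ⟨g', _, .pass g, by simp⟩
  | up g g₁ g₂ g' => exact ⟨g', _, .up g g₁ g₂, rfl⟩
  | down g g₁ g₂ g' => exact ⟨g', _, .down g g₁ g₂, rfl⟩
  | split => exact absurd rfl hκ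

abbrev pyExp : RealExp := .cell fPy (.var vR)
abbrev topExp : RealExp := .cell fHb (.var lTop)
abbrev botExp : RealExp := .cell fHb (.var lBot)

/-- The point lies in the strip. -/
def inStripTest : Test := .conj (.realLT botExp pyExp) (.neg (.realLT topExp pyExp))
def aboveBotTest : Test := .neg (.realLT (.sub pyExp botExp) (.var xΔ))
def belowTopTest : Test := .neg (.realLT (.sub topExp pyExp) (.var xΔ))

/-- The address of the first cell. -/
def baseExp (r b₁ b₂ : NatExp) : NatExp :=
  .add (.add (.cell aZ₁ b₂) (.cell aZ₂ b₁)) (.cell aZ₃ r)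

def bestStay : Program :=
  .setNat vStay (.const 0) ;; .setReal xStay .zero ;;
  .setNat vCell (baseExp (.var vR) (.var lTop) (.var lBot)) ;;
  .setNat vNext (baseExp (.add (.var vR) (.const 1)) (.var lTop) (.var lBot)) ;;
  .ite inStripTest
    (.ite (.conj (.natEq (.cell aPc (.var vR)) (.cell aCb (.var lTop))) aboveBotTest)
      (.setNat vStay (.const 2) ;; .setReal xStay (.sub topExp pyExp)) .skip ;;
    .ite (.conj (.conj (.natEq (.cell aPc (.var vR)) (.cell aCb (.var lBot))) belowTopTest)
        (.neg (.conj (.natEq (.var vStay) (.const 2))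
          (.realLT (.var xStay) (.sub pyExp botExp)))))
      (.setNat vStay (.const 3) ;; .setReal xStay (.sub pyExp botExp)) .skip)
    (.setNat vStay (.const 1))

/-- The store holds the parameters of a group of cells. -/
structure Group (Z r b₁ b₂ : ℕ) (s : Store) : Prop where
  r_eq : s.natVar vR = r
  top_eq : s.natVar lTop = b₁
  bot_eq : s.natVar lBot = b₂

theorem Group.of_agree (h : Group Z r b₁ b₂ s) (ha : AgreeBelow 64 s s') : Group Z r b₁ b₂ s' :=
  ⟨(ha.natVar _ (by decide)).trans h.r_eq, (ha.natVar _ (by decide)).trans h.top_eq,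
    (ha.natVar _ (by decide)).trans h.bot_eq⟩

theorem holds_inStripTest (h : Ready d Z s) (hg : Group Z r b₁ b₂ s) :
    inStripTest.Holds s ↔ d.InStrip r b₁ b₂ := by
  simp [inStripTest, hg.r_eq, hg.top_eq, hg.bot_eq, h.py_eq, h.hb_eq, Data.InStrip]

theorem holds_aboveBotTest (h : Ready d Z s) (hg : Group Z r b₁ b₂ s) :
    aboveBotTest.Holds s ↔ d.Δ ≤ d.py r - d.hb b₂ := by
  simp [aboveBotTest, hg.r_eq, hg.bot_eq, h.py_eq, h.hb_eq, h.Δ_eq]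

theorem holds_belowTopTest (h : Ready d Z s) (hg : Group Z r b₁ b₂ s) :
    belowTopTest.Holds s ↔ d.Δ ≤ d.hb b₁ - d.py r := by
  simp [belowTopTest, hg.r_eq, hg.top_eq, h.py_eq, h.hb_eq, h.Δ_eq]

theorem Strides.eval_baseExp {e₀ e₁ e₂ : NatExp} (h : Strides Z s) (h₀ : e₀.eval s = r)
    (h₁ : e₁.eval s = b₁) (h₂ : e₂.eval s = b₂) (g₀ : r ≤ Z) (g₁ : b₁ ≤ Z) (g₂ : b₂ ≤ Z) :
    (baseExp e₀ e₁ e₂).eval s = cellBase Z r b₁ b₂ := by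
  simp [baseExp, h₀, h₁, h₂, h.Z₁_eq _ g₂, h.Z₂_eq _ g₁, h.Z₃_eq _ g₀, cellBase]

theorem bestStay_runs (h : Ready d Z s) (hg : Group Z r b₁ b₂ s) (hr : r < d.n)
    (h₁ : b₁ < d.C * d.M + 2) (h₂ : b₂ < d.C * d.M + 2) :
    RunsWithin bestStay s 150 fun s' => AgreeBelow 64 s s' ∧ cellAt s' = cellAt s ∧
      s'.natVar vCell = cellBase Z r b₁ b₂ ∧ s'.natVar vNext = cellBase Z (r + 1) b₁ b₂ ∧
      (s'.natVar vStay ≠ 0 → d.Stay r b₁ b₂ (s'.natVar vStay) (s'.realVar xStay)) ∧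
      ∀ κ c, d.Stay r b₁ b₂ κ c → s'.natVar vStay ≠ 0 ∧ s'.realVar xStay ≤ c := by
  have hn := h.n_lt
  have hN := h.NB_le
  refine (RunsWithin.seq (T := 2) (T' := 2 + (9 + (11 + 113))) ?_).mono_time
    (by decide)
  refine .of_loopFree rfl (by decide) (.seq (.of_loopFree rfl (by decide) (.seq
    (.of_loopFree rfl (by decide) (.seq (.of_loopFree rfl (by decide) ?_))))))
  simp only [Program.run]
  rw [Strides.eval_baseExp (Z := Z) (r := r) (b₁ := b₁) (b₂ := b₂)
    (h.strides.of_agree ((AgreeBelow.setNat (by decide)).trans (.setReal (by decide))))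
    (by simpa using hg.r_eq) (by simpa using hg.top_eq) (by simpa using hg.bot_eq)
    (by omega) (by omega) (by omega),
    Strides.eval_baseExp (Z := Z) (r := r + 1) (b₁ := b₁) (b₂ := b₂)
    (h.strides.of_agree (((AgreeBelow.setNat (by decide)).trans (.setReal (by decide))).trans
      (.setNat (by decide))))
    (by simp [hg.r_eq]) (by simpa using hg.top_eq) (by simpa using hg.bot_eq)
    (by omega) (by omega) (by omega)]
  set s₁ := (((s.setNat vStay (NatExp.eval s (.const 0))).setReal xStay
    (RealExp.eval (s.setNat vStay (NatExp.eval s (.const 0))) .zero)).setNat vCell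
      (cellBase Z r b₁ b₂)).setNat vNext (cellBase Z (r + 1) b₁ b₂) with hs₁
  have a₁ : AgreeBelow 64 s s₁ := (((AgreeBelow.setNat (by decide)).trans
    (.setReal (by decide))).trans (.setNat (by decide))).trans (.setNat (by decide))
  have c₁ : cellAt s₁ = cellAt s := rfl
  have v₁ : s₁.natVar vCell = cellBase Z r b₁ b₂ := by simp [hs₁]
  have w₁ : s₁.natVar vNext = cellBase Z (r + 1) b₁ b₂ := by simp [hs₁]
  have k₁ : s₁.natVar vStay = 0 := by simp [hs₁]
  have x₁ : s₁.realVar xStay = 0 := by simp [hs₁]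
  have R₁ := h.of_agree (a₁.mono (by decide))
  have G₁ := hg.of_agree a₁
  clear_value s₁
  refine (RunsWithin.ite (T := 100) ?_ ?_).mono_time (by decide)
  · intro hin
    rw [holds_inStripTest R₁ G₁] at hin
    refine RunsWithin.seq (T := 40) (T' := 60) (.of_loopFree rfl (by decide) ?_)
    have key : ∀ s₂ : Store, AgreeBelow 64 s₁ s₂ → cellAt s₂ = cellAt s₁ →
        s₂.natVar vCell = cellBase Z r b₁ b₂ → s₂.natVar vNext = cellBase Z (r + 1) b₁ b₂ →
        (s₂.natVar vStay = 0 ∧ ¬ (d.pc r = d.cb b₁ ∧ d.Δ ≤ d.py r - d.hb b₂) ∨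
          s₂.natVar vStay = 2 ∧ s₂.realVar xStay = d.hb b₁ - d.py r ∧
          d.pc r = d.cb b₁ ∧ d.Δ ≤ d.py r - d.hb b₂) →
        RunsWithin (.ite (.conj (.conj (.natEq (.cell aPc (.var vR)) (.cell aCb (.var lBot)))
            belowTopTest) (.neg (.conj (.natEq (.var vStay) (.const 2))
            (.realLT (.var xStay) (.sub pyExp botExp)))))
          (.setNat vStay (.const 3) ;; .setReal xStay (.sub pyExp botExp)) .skip) s₂ 60 fun s' =>
          AgreeBelow 64 s s' ∧ cellAt s' = cellAt s ∧
      s'.natVar vCell = cellBase Z r b₁ b₂ ∧ s'.natVar vNext = cellBase Z (r + 1) b₁ b₂ ∧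
      (s'.natVar vStay ≠ 0 → d.Stay r b₁ b₂ (s'.natVar vStay) (s'.realVar xStay)) ∧
      ∀ κ c, d.Stay r b₁ b₂ κ c → s'.natVar vStay ≠ 0 ∧ s'.realVar xStay ≤ c := by
      intro s₂ a₂ c₂ v₂ w₂ hs₂
      have R₂ := R₁.of_agree (a₂.mono (by decide))
      have G₂ := G₁.of_agree a₂
      refine .of_loopFree rfl (by decide) ?_
      have e0 : Test.Holds s₂ (.conj (.conj (.natEq (.cell aPc (.var vR)) (.cell aCb (.var lBot)))
            belowTopTest) (.neg (.conj (.natEq (.var vStay) (.const 2))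
            (.realLT (.var xStay) (.sub pyExp botExp))))) ↔ (d.pc r = d.cb b₂ ∧
            d.Δ ≤ d.hb b₁ - d.py r) ∧ ¬ (s₂.natVar vStay = 2 ∧
            s₂.realVar xStay < d.py r - d.hb b₂) := by
        rw [Test.Holds, Test.Holds, Test.Holds, Test.Holds, holds_belowTopTest R₂ G₂]
        simp [G₂.r_eq, G₂.bot_eq, R₂.py_eq, R₂.hb_eq, R₂.pc_eq, R₂.cb_eq]
      rw [Program.run]
      split_ifs with hc
      · rw [e0] at hc
        refine ⟨(a₁.trans a₂).trans ((AgreeBelow.setNat (by decide)).trans (.setReal (by decide))),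
          c₂.trans c₁, by simpa using v₂, by simpa using w₂, ?_, ?_⟩
        · intro _
          have := Data.Stay.down hin hc.1.1 hc.1.2
          simpa [G₂.r_eq, G₂.bot_eq, R₂.py_eq, R₂.hb_eq] using this
        · intro κ c hκ
          refine ⟨by simp, ?_⟩
          suffices d.py r - d.hb b₂ ≤ c by simpa [G₂.r_eq, G₂.bot_eq, R₂.py_eq, R₂.hb_eq] using this
          cases hκ with
          | pass g => exact absurd hin g
          | down => exact le_rfl
          | up g g₁ g₂ =>
            rcases hs₂ with ⟨_, g'⟩ | ⟨g', g'', _⟩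
            · exact absurd ⟨g₁, g₂⟩ g'
            · rw [← g'']
              exact not_lt.1 fun hlt => hc.2 ⟨g', hlt⟩
      · rw [e0] at hc
        refine ⟨a₁.trans a₂, c₂.trans c₁, v₂, w₂, ?_, ?_⟩
        · intro hne
          rcases hs₂ with ⟨g', _⟩ | ⟨g', g'', g₁, g₂⟩
          · exact absurd g' hne
          · simp only [Program.run]
            rw [g', g'']
            exact .up hin g₁ g₂
        · intro κ c hκ
          simp only [Program.run]
          cases hκ with
          | pass g => exact absurd hin g
          | up g g₁ g₂ =>
            rcases hs₂ with ⟨_, g'⟩ | ⟨g', g'', _⟩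
            · exact absurd ⟨g₁, g₂⟩ g'
            · exact ⟨by omega, g''.le⟩
          | down g g₁ g₂ =>
            have := not_not.1 (fun h' => hc ⟨⟨g₁, g₂⟩, h'⟩)
            exact ⟨by omega, this.2.le⟩
    rw [Program.run]
    have e0 : Test.Holds s₁ (.conj (.natEq (.cell aPc (.var vR)) (.cell aCb (.var lTop)))
        aboveBotTest) ↔ d.pc r = d.cb b₁ ∧ d.Δ ≤ d.py r - d.hb b₂ := by
      rw [Test.Holds, holds_aboveBotTest R₁ G₁]
      simp [G₁.r_eq, G₁.top_eq, R₁.pc_eq, R₁.cb_eq]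
    split_ifs with hc
    · rw [e0] at hc
      refine key _ ((AgreeBelow.setNat (by decide)).trans (.setReal (by decide))) rfl
        (by simpa using v₁) (by simpa using w₁) (.inr ⟨by simp, ?_, hc⟩)
      simp [G₁.r_eq, G₁.top_eq, R₁.py_eq, R₁.hb_eq]
    · rw [e0] at hc
      exact key _ (.refl _ _) rfl v₁ w₁ (.inl ⟨k₁, hc⟩)
  · intro hin
    rw [holds_inStripTest R₁ G₁] at hin
    refine .of_loopFree rfl (by decide) ⟨a₁.trans (.setNat (by decide)), c₁, by simpa using v₁,
      by simpa using w₁, ?_, ?_⟩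
    · intro _
      simpa [x₁] using Data.Stay.pass hin
    · intro κ c hκ
      cases hκ with
      | pass => simp [x₁]
      | up g => exact absurd g hin
      | down g => exact absurd g hin

end BackboneLabeling

namespace BackboneLabeling

namespace Reg
/-- value of a decision -/
abbrev xVal : ℕ := 72
end Reg

open Reg

variable {d : Data} {Z r b₁ b₂ i : ℕ} {s s' s'' : Store} {cl : Clearance} {T : Table}

/-! ### The cells for one strip -/

theorem Program.run_seq (p q : Program) : (p ;; q).run s = q.run (p.run s) := rfl

/-- The store after a cell has been written. -/
noncomputable def Store.putCell (s : Store) (x κ j l l' : ℕ) (v : ℝ) : Store :=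
  ((((s.storeNat aKind x κ).storeNat aCand x j).storeNat aUpper x l).storeNat aLower x l').storeReal
    fVal x v

theorem cellAt_putCell {x κ j l l' y : ℕ} {v : ℝ} :
    cellAt (s.putCell x κ j l l' v) y = if y = x then (κ, j, l, l', v) else cellAt s y := by
  simp only [cellAt, Store.putCell, Store.storeNat, Store.storeReal, Function.update_apply]
  by_cases h : y = x <;> simp [h]

def writeCell (x κ j l l' : NatExp) (v : RealExp) : Program :=
  .storeNat aKind x κ ;; .storeNat aCand x j ;; .storeNat aUpper x l ;; .storeNat aLower x l' ;;
  .storeReal fVal x v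

theorem Data.IsBest.congr {S S' : ℕ → ℕ → ℕ → ℕ → ℝ → Prop} {κ j l l' : ℕ} {v : ℝ}
    (h : Data.IsBest S κ j l l' v) (hS : ∀ κ j l l' v, S' κ j l l' v ↔ S κ j l l' v) :
    Data.IsBest S' κ j l l' v :=
  ⟨fun hκ => (hS ..).2 (h.1 hκ), fun κ' j' l l' v' h' => h.2 κ' j' l l' v' ((hS ..).1 h')⟩

/-- The cells from `A` on hold the best decisions for the budgets, where a new label is allowed
for `X` only. -/
def Optimized (d : Data) (T : Table) (A r b₁ b₂ : ℕ) (X : ℕ → ℕ → ℕ → Prop) (s : Store) : Prop :=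
  ∀ i, i < d.B → BestCell (fun κ j i' i'' v => d.Choice T r b₁ b₂ i κ j i' i'' v ∧
    (κ = 4 → X j i' i'')) (cellAt s (A + i))

theorem Optimized.congr {A : ℕ} {X X' : ℕ → ℕ → ℕ → Prop} (h : Optimized d T A r b₁ b₂ X s)
    (hX : ∀ i j i' i'' v, d.Choice T r b₁ b₂ i 4 j i' i'' v → (X' j i' i'' ↔ X j i' i'')) :
    Optimized d T A r b₁ b₂ X' s := fun i hi =>
  (h i hi).congr fun κ j l l' v => and_congr_right fun hc => by
    by_cases hκ : κ = 4
    · subst hκ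
      simp [hX i j l l' v hc]
    · simp [hκ]

def stayCells : Program :=
  .forUp lJ vB
    (.ite (.conj (.neg (.natEq (.var vStay) (.const 0)))
        (.neg (.natEq (.cell aKind (.add (.var vNext) (.var lJ))) (.const 0))))
      (writeCell (.add (.var vCell) (.var lJ)) (.var vStay) (.const 0) (.const 0) (.const 0)
        (.add (.cell fVal (.add (.var vNext) (.var lJ))) (.var xStay)))
      (.storeNat aKind (.add (.var vCell) (.var lJ)) (.const 0)))

theorem stayCells_runs (h : Ready d Z s)
    (h₁ : b₁ < d.C * d.M + 2) (h₂ : b₂ < d.C * d.M + 2) (hcell : s.natVar vCell = cellBase Z r b₁ b₂)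
    (hnext : s.natVar vNext = cellBase Z (r + 1) b₁ b₂)
    (hstay : s.natVar vStay ≠ 0 → d.Stay r b₁ b₂ (s.natVar vStay) (s.realVar xStay))
    (hbest : ∀ κ c, d.Stay r b₁ b₂ κ c → s.natVar vStay ≠ 0 ∧ s.realVar xStay ≤ c) :
    RunsWithin stayCells s (d.B * 78 + 6) fun s' => AgreeBelow 67 s s' ∧
      Optimized d (tableOf Z s) (cellBase Z r b₁ b₂) r b₁ b₂ (fun _ _ _ => False) s' ∧
      SameOff (cellBase Z r b₁ b₂) d.B s s' := by
  have hN := h.NB_le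
  have hB := h.B_le
  refine (RunsWithin.forUp (T := 70) (fun i s' => (∀ i', i' < i → BestCell (fun κ j l l' v =>
    d.Choice (tableOf Z s) r b₁ b₂ i' κ j l l' v ∧ (κ = 4 → False))
      (cellAt s' (cellBase Z r b₁ b₂ + i'))) ∧ SameOff (cellBase Z r b₁ b₂) i s s')
    (by decide) h.B_eq rfl ?_ ?_).mono le_rfl fun s' h' => h'
  · exact ⟨fun i' hi' => absurd hi' (by simp), fun x _ => rfl⟩
  intro i hi s₁ a₁ hv hI
  have hc₁ : s₁.natVar vCell = cellBase Z r b₁ b₂ := (a₁.natVar _ (by decide)).trans hcell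
  have hn₁ : s₁.natVar vNext = cellBase Z (r + 1) b₁ b₂ := (a₁.natVar _ (by decide)).trans hnext
  have hk₁ : s₁.natVar vStay = s.natVar vStay := a₁.natVar _ (by decide)
  have hx₁ : s₁.realVar xStay = s.realVar xStay := a₁.realVar _ (by decide)
  have hsame : cellAt s₁ (cellBase Z (r + 1) b₁ b₂ + i) =
      cellAt s (cellBase Z (r + 1) b₁ b₂ + i) :=
    hI.2.cellAt_eq (by omega) (by omega) (by omega) (by omega) (by omega) (by omega) (by simp)
  have hkind : s₁.natArr aKind (cellBase Z (r + 1) b₁ b₂ + i) =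
    (tableOf Z s).kind (r + 1) b₁ b₂ i := congrArg Prod.fst hsame
  have hval : s₁.realArr fVal (cellBase Z (r + 1) b₁ b₂ + i) =
    (tableOf Z s).val (r + 1) b₁ b₂ i := congrArg (fun x => x.2.2.2.2) hsame
  refine .of_loopFree rfl (by decide) ?_
  suffices hw : ∃ c, BestCell (fun κ j l l' v => d.Choice (tableOf Z s) r b₁ b₂ i κ j l l' v ∧
      (κ = 4 → False)) c ∧ ∀ x, cellAt (Program.run (.ite (.conj (.neg (.natEq (.var vStay)
        (.const 0))) (.neg (.natEq (.cell aKind (.add (.var vNext) (.var lJ))) (.const 0))))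
      (writeCell (.add (.var vCell) (.var lJ)) (.var vStay) (.const 0) (.const 0) (.const 0)
        (.add (.cell fVal (.add (.var vNext) (.var lJ))) (.var xStay)))
      (.storeNat aKind (.add (.var vCell) (.var lJ)) (.const 0))) s₁) x =
      if x = cellBase Z r b₁ b₂ + i then c else cellAt s₁ x by
    obtain ⟨c, hc, hw⟩ := hw
    refine ⟨fun i' hi' => ?_, fun x hx => ?_⟩
    · change BestCell _ (cellAt (Program.run _ s₁) _)
      rw [hw]
      by_cases he : i' = i
      · subst he
        rwa [if_pos rfl]
      · rw [if_neg (by omega)]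
        exact hI.1 i' (by omega)
    · change cellAt (Program.run _ s₁) _ = _
      rw [hw, if_neg (hx i (by omega))]
      exact hI.2 x fun i' hi' => hx i' (by omega)
  rw [Program.run]
  have e0 : Test.Holds s₁ (.conj (.neg (.natEq (.var vStay) (.const 0)))
      (.neg (.natEq (.cell aKind (.add (.var vNext) (.var lJ))) (.const 0)))) ↔
      s.natVar vStay ≠ 0 ∧ (tableOf Z s).kind (r + 1) b₁ b₂ i ≠ 0 := by
    simp [hv, hk₁, hn₁, hkind]
  split_ifs with hc
  · rw [e0] at hc
    refine ⟨(s.natVar vStay, 0, 0, 0, (tableOf Z s).val (r + 1) b₁ b₂ i + s.realVar xStay),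
      ⟨fun _ => ?_, ?_⟩, ?_⟩
    · obtain ⟨g, g'⟩ := (hstay hc.1).choice (T := tableOf Z s) (j := 0) (i' := 0) (i'' := 0) hc.2
      exact ⟨g, g'⟩
    · rintro κ j l l' v ⟨g, g'⟩
      obtain ⟨-, c, g₁, rfl⟩ := g.stay g'
      exact ⟨hc.1, by simpa using (hbest _ _ g₁).2⟩
    · intro x
      rw [← cellAt_putCell]
      congr 1
      simp [writeCell, Store.putCell, hc₁, hv, hk₁, hx₁, hn₁, hval]
  · rw [e0] at hc
    refine ⟨(0, (cellAt s₁ (cellBase Z r b₁ b₂ + i)).2), ⟨fun h' => absurd rfl h', ?_⟩,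
      fun x => ?_⟩
    · rintro κ j l l' v ⟨g, g'⟩
      obtain ⟨g₀, c, g₁, rfl⟩ := g.stay g'
      exact absurd ⟨(hbest _ _ g₁).1, g₀⟩ hc
    · by_cases hx : x = cellBase Z r b₁ b₂ + i
      · simp [cellAt, hc₁, hv, hx]
      · simp [cellAt, hc₁, hv, hx]

/-- A new label at the height `j` is far enough from the other backbones and the point `r`
from the other backbones. -/
def Data.CanPlace (d : Data) (r b₁ b₂ j : ℕ) : Prop :=
  d.InStrip r b₁ b₂ ∧ d.Δ ≤ d.py r - d.hb b₂ ∧ d.Δ ≤ d.hb b₁ - d.py r ∧ r ≤ d.fst j ∧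
    d.Δ ≤ d.hb b₁ - d.Y j ∧ d.Δ ≤ d.Y j - d.hb b₂

def splitCell : Program :=
  .setNat vCode (.add (.add (.cell aCd (.var lUp)) (.cell aCd (.var lLow))) (.cell aE (.var vR))) ;;
  .setNat vBudget (.cell aInv (.var vCode)) ;;
  .setReal xVal (.add (.add (.cell fVal (.add (.var vUp) (.var lUp)))
    (.cell fVal (.add (.var vLow) (.var lLow)))) (.var xNew)) ;;
  .ite (.conj (.conj (.conj (.natLT (.var vBudget) (.var vB))
        (.natEq (.cell aCd (.var vBudget)) (.var vCode)))
      (.conj (.neg (.natEq (.cell aKind (.add (.var vUp) (.var lUp))) (.const 0)))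
        (.neg (.natEq (.cell aKind (.add (.var vLow) (.var lLow))) (.const 0)))))
      (.neg (.conj (.neg (.natEq (.cell aKind (.add (.var vCell) (.var vBudget))) (.const 0)))
        (.neg (.realLT (.var xVal) (.cell fVal (.add (.var vCell) (.var vBudget))))))))
    (writeCell (.add (.var vCell) (.var vBudget)) (.const 4) (.var lJ) (.var lUp) (.var lLow)
      (.var xVal))
    .skip

theorem splitCell_runs {A U L j i' i'' : ℕ} {X : ℕ → ℕ → ℕ → Prop} (h : Ready d Z s)
    (hr : s.natVar vR = r) (hA : s.natVar vCell = A) (hU : s.natVar vUp = U)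
    (hL : s.natVar vLow = L) (hj : s.natVar lJ = j) (hi' : s.natVar lUp = i')
    (hi'' : s.natVar lLow = i'') (hx : s.realVar xNew = |d.py r - d.Y j| + d.bc r)
    (hjM : j < d.M) (hi'B : i' < d.B) (hi''B : i'' < d.B) (hcan : d.CanPlace r b₁ b₂ j)
    (hUk : s.natArr aKind (U + i') = T.kind (r + 1) b₁ (j + d.pc r * d.M) i')
    (hUv : s.realArr fVal (U + i') = T.val (r + 1) b₁ (j + d.pc r * d.M) i')
    (hLk : s.natArr aKind (L + i'') = T.kind (r + 1) (j + d.pc r * d.M) b₂ i'')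
    (hLv : s.realArr fVal (L + i'') = T.val (r + 1) (j + d.pc r * d.M) b₂ i'')
    (hopt : Optimized d T A r b₁ b₂ X s) :
    RunsWithin splitCell s 150 fun s' =>
      Optimized d T A r b₁ b₂ (fun k l l' => X k l l' ∨ k = j ∧ l = i' ∧ l' = i'') s' ∧
      SameOff A d.B s s' := by
  refine .of_loopFree rfl (by decide) ?_
  set x := d.cd i' + d.cd i'' + d.e r with hxdef
  set V := T.val (r + 1) b₁ (j + d.pc r * d.M) i' + T.val (r + 1) (j + d.pc r * d.M) b₂ i'' +
    (|d.py r - d.Y j| + d.bc r) with hV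
  rw [splitCell, Program.run_seq, Program.run_seq, Program.run_seq]
  set s₁ := Program.run (.setReal xVal (.add (.add (.cell fVal (.add (.var vUp) (.var lUp)))
    (.cell fVal (.add (.var vLow) (.var lLow)))) (.var xNew))) (Program.run (.setNat vBudget
    (.cell aInv (.var vCode))) (Program.run (.setNat vCode (.add (.add (.cell aCd (.var lUp))
    (.cell aCd (.var lLow))) (.cell aE (.var vR)))) s)) with hs₁
  have a₁ : AgreeBelow 72 s s₁ := ((AgreeBelow.setNat (by decide)).trans
    (.setNat (by decide))).trans (.setReal (by decide))
  have c₁ : cellAt s₁ = cellAt s := rfl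
  have k₁ : s₁.natArr = s.natArr := rfl
  have f₁ : s₁.realArr = s.realArr := rfl
  have vx : s₁.natVar vCode = x := by simp [hs₁, hi', hi'', hr, h.cd_eq, h.e_eq, hxdef]
  have vb : s₁.natVar vBudget = d.ι x := by simp [hs₁, hi', hi'', hr, h.cd_eq, h.e_eq, h.ι_eq, hxdef]
  have vv : s₁.realVar xVal = V := by simp [hs₁, hU, hL, hi', hi'', hUv, hLv, hx, hV]
  have R := h.of_agree (a₁.mono (by decide))
  have hA₁ : s₁.natVar vCell = A := (a₁.natVar _ (by decide)).trans hA
  have hU₁ : s₁.natVar vUp = U := (a₁.natVar _ (by decide)).trans hU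
  have hL₁ : s₁.natVar vLow = L := (a₁.natVar _ (by decide)).trans hL
  have hj₁ : s₁.natVar lJ = j := (a₁.natVar _ (by decide)).trans hj
  have hi'₁ : s₁.natVar lUp = i' := (a₁.natVar _ (by decide)).trans hi'
  have hi''₁ : s₁.natVar lLow = i'' := (a₁.natVar _ (by decide)).trans hi''
  clear_value s₁
  have hnew : ∀ i v, d.Choice T r b₁ b₂ i 4 j i' i'' v → i = d.ι x ∧ v = V ∧
      d.cd (d.ι x) = x ∧ T.kind (r + 1) b₁ (j + d.pc r * d.M) i' ≠ 0 ∧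
      T.kind (r + 1) (j + d.pc r * d.M) b₂ i'' ≠ 0 := by
    intro i v hc
    cases hc with
    | split _ _ _ _ _ _ _ _ _ g₁ g₂ g₃ g₄ => exact ⟨g₂, rfl, g₁, g₃, g₄⟩
  have hold : ∀ i, i < d.B → ((i = d.ι x ∧ d.cd (d.ι x) = x ∧
      T.kind (r + 1) b₁ (j + d.pc r * d.M) i' ≠ 0 ∧
      T.kind (r + 1) (j + d.pc r * d.M) b₂ i'' ≠ 0) → (cellAt s (A + i)).1 ≠ 0 ∧
      (cellAt s (A + i)).2.2.2.2 ≤ V) →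
      BestCell (fun κ k l l' v => d.Choice T r b₁ b₂ i κ k l l' v ∧
      (κ = 4 → (X k l l' ∨ k = j ∧ l = i' ∧ l' = i''))) (cellAt s (A + i)) := by
    intro i hi hno
    refine ⟨fun hne => ?_, ?_⟩
    · obtain ⟨g, g'⟩ := (hopt i hi).1 hne
      exact ⟨g, fun h4 => .inl (g' h4)⟩
    · rintro κ k l l' v ⟨g, g'⟩
      by_cases h4 : κ = 4
      · rcases g' h4 with hX | ⟨rfl, rfl, rfl⟩
        · exact (hopt i hi).2 κ k l l' v ⟨g, fun _ => hX⟩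
        · subst h4
          obtain ⟨g₁, rfl, g₂, g₃, g₄⟩ := hnew i v g
          exact hno ⟨g₁, g₂, g₃, g₄⟩
      · exact (hopt i hi).2 κ k l l' v ⟨g, fun h' => absurd h' h4⟩
  rw [Program.run]
  split_ifs with hc
  · have hc' : ((d.ι x < d.B ∧ d.cd (d.ι x) = x) ∧
        T.kind (r + 1) b₁ (j + d.pc r * d.M) i' ≠ 0 ∧
        T.kind (r + 1) (j + d.pc r * d.M) b₂ i'' ≠ 0) ∧
        (s.natArr aKind (A + d.ι x) ≠ 0 → V < s.realArr fVal (A + d.ι x)) := by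
      simpa [vb, R.B_eq, R.cd_eq, vx, hU₁, hL₁, hi'₁, hi''₁, k₁, f₁, hUk, hLk, hA₁, vv] using hc
    obtain ⟨⟨⟨g₁, g₂⟩, g₃, g₄⟩, g₅⟩ := hc'
    have hput : Program.run (writeCell (.add (.var vCell) (.var vBudget)) (.const 4) (.var lJ)
        (.var lUp) (.var lLow) (.var xVal)) s₁ = s₁.putCell (A + d.ι x) 4 j i' i'' V := by
      simp [writeCell, Store.putCell, hA₁, vb, hj₁, hi'₁, hi''₁, vv]
    rw [hput]
    refine ⟨fun i hi => ?_, fun y hy => ?_⟩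
    · rw [cellAt_putCell, c₁]
      by_cases he : i = d.ι x
      · subst he
        rw [if_pos rfl]
        refine ⟨fun _ => ⟨.split hcan.1 hcan.2.1 hcan.2.2.1 hjM hcan.2.2.2.1 hcan.2.2.2.2.1
          hcan.2.2.2.2.2 hi'B hi''B g₂ rfl g₃ g₄, fun _ => .inr ⟨rfl, rfl, rfl⟩⟩, ?_⟩
        rintro κ k l l' v ⟨g, g'⟩
        refine ⟨by simp, ?_⟩
        have hle : d.Choice T r b₁ b₂ (d.ι x) κ k l l' v ∧ (κ = 4 → X k l l') → V ≤ v := fun g' => by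
          obtain ⟨q₁, q₂⟩ := (hopt _ hi).2 κ k l l' v g'
          exact (g₅ q₁).le.trans q₂
        by_cases h4 : κ = 4
        · rcases g' h4 with hX | ⟨rfl, rfl, rfl⟩
          · exact hle ⟨g, fun _ => hX⟩
          · subst h4
            exact (hnew _ v g).2.1.ge
        · exact hle ⟨g, fun h' => absurd h' h4⟩
      · rw [if_neg (by omega)]
        exact hold i hi fun h' => absurd h'.1 he
    · rw [cellAt_putCell, c₁, if_neg (hy _ g₁)]
  · refine ⟨fun i hi => ?_, fun y _ => by rw [Program.run, c₁]⟩
    rw [Program.run, c₁]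
    refine hold i hi ?_
    rintro ⟨rfl, g₂, g₃, g₄⟩
    have hc' : (((d.ι x < d.B ∧ d.cd (d.ι x) = x) ∧
        T.kind (r + 1) b₁ (j + d.pc r * d.M) i' ≠ 0 ∧
        T.kind (r + 1) (j + d.pc r * d.M) b₂ i'' ≠ 0) ∧
        (s.natArr aKind (A + d.ι x) ≠ 0 → V < s.realArr fVal (A + d.ι x))) → False := by
      simpa [vb, R.B_eq, R.cd_eq, vx, hU₁, hL₁, hi'₁, hi''₁, k₁, f₁, hUk, hLk, hA₁, vv] using hc
    have hc'' : ¬ (s.natArr aKind (A + d.ι x) ≠ 0 → V < s.realArr fVal (A + d.ι x)) :=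
      fun h' => hc' ⟨⟨⟨hi, g₂⟩, g₃, g₄⟩, h'⟩
    push Not at hc''
    exact hc''

end BackboneLabeling

namespace BackboneLabeling

open Reg

variable {d : Data} {Z r b₁ b₂ i : ℕ} {s s' s'' : Store} {cl : Clearance} {T : Table}

open Classical in
theorem Program.run_ite (b : Test) (p q : Program) :
    (Program.ite b p q).run s = if b.Holds s then p.run s else q.run s := rfl

def canPlaceTest : Test :=
  .conj inStripTest (.conj aboveBotTest (.conj belowTopTest (.conj
    (.neg (.natLT (.cell aFst (.var lJ)) (.var vR))) (.conj
    (.neg (.realLT (.sub topExp (.cell fCand (.var lJ))) (.var xΔ)))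
    (.neg (.realLT (.sub (.cell fCand (.var lJ)) botExp) (.var xΔ)))))))

theorem holds_canPlaceTest {j : ℕ} (h : Ready d Z s) (hg : Group Z r b₁ b₂ s)
    (hj : s.natVar lJ = j) : canPlaceTest.Holds s ↔ d.CanPlace r b₁ b₂ j := by
  rw [canPlaceTest, Test.Holds, Test.Holds, Test.Holds, holds_inStripTest h hg,
    holds_aboveBotTest h hg, holds_belowTopTest h hg]
  simp [hg.r_eq, hg.top_eq, hg.bot_eq, h.Y_eq, h.hb_eq, h.fst_eq, hj, h.Δ_eq, Data.CanPlace]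

/-- The new backbone. -/
abbrev newExp : NatExp := .add (.var lJ) (.cell aMulM (.cell aPc (.var vR)))
abbrev nextExp : NatExp := .add (.var vR) (.const 1)

def splitCells : Program :=
  .forUp lJ vM
    (.ite canPlaceTest
      ((.setNat vUp (baseExp nextExp (.var lTop) newExp) ;;
        .setNat vLow (baseExp nextExp newExp (.var lBot)) ;;
        .ite (.realLT pyExp (.cell fCand (.var lJ)))
          (.setReal xNew (.sub (.cell fCand (.var lJ)) pyExp))
          (.setReal xNew (.sub pyExp (.cell fCand (.var lJ)))) ;;
        .setReal xNew (.add (.var xNew) (.cell fBc (.var vR)))) ;;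
        .forUp lUp vB (.forUp lLow vB splitCell))
      .skip)

theorem splitCells_runs {s₀ : Store} (ok : d.Ok cl) (h : Ready d Z s) (hg : Group Z r b₁ b₂ s)
    (hr : r < d.n) (h₁ : b₁ < d.C * d.M + 2) (h₂ : b₂ < d.C * d.M + 2)
    (hcell : s.natVar vCell = cellBase Z r b₁ b₂)
    (hopt : Optimized d (tableOf Z s₀) (cellBase Z r b₁ b₂) r b₁ b₂ (fun _ _ _ => False) s)
    (hoff : SameOff (cellBase Z r b₁ b₂) d.B s₀ s) :
    RunsWithin splitCells s (d.M * (d.B * (d.B * 158 + 14) + 200) + 6) fun s' => AgreeBelow 67 s s' ∧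
      Optimized d (tableOf Z s₀) (cellBase Z r b₁ b₂) r b₁ b₂ (fun _ _ _ => True) s' ∧
      SameOff (cellBase Z r b₁ b₂) d.B s₀ s' := by
  have hN := h.NB_le
  have hB := h.B_le
  have hnZ := h.n_lt
  set A := cellBase Z r b₁ b₂ with hA
  refine (RunsWithin.forUp (T := d.B * (d.B * 158 + 14) + 192) (fun J s' =>
    Optimized d (tableOf Z s₀) A r b₁ b₂ (fun j _ _ => j < J) s' ∧ SameOff A d.B s₀ s')
    (by decide) h.M_eq rfl ?_ ?_).mono le_rfl ?_
  · exact ⟨hopt.congr fun i j i' i'' v _ => by simp, hoff⟩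
  · rintro J hJ s₁ a₁ hv ⟨hopt₁, hoff₁⟩
    have R₁ := h.of_agree (a₁.mono (by decide))
    have G₁ := hg.of_agree (a₁.mono (by decide))
    have hc₁ : s₁.natVar vCell = A := (a₁.natVar _ (by decide)).trans hcell
    refine (RunsWithin.ite (T := 100 + (d.B * (d.B * 158 + 14) + 6)) ?_ ?_).mono_time ?_
    · intro hcan
      rw [holds_canPlaceTest R₁ G₁ hv] at hcan
      refine .seq (.of_loopFree rfl (by decide) ?_)
      set N := J + d.pc r * d.M with hNew
      have hNlt : N < d.C * d.M := add_mul_lt (ok.pc_lt r hr) hJ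
      have hmul := R₁.mulM_eq (d.pc r) (ok.pc_lt r hr).le
      have eU : Program.run (.setNat vUp (baseExp nextExp (.var lTop) newExp)) s₁ =
          s₁.setNat vUp (cellBase Z (r + 1) b₁ N) := by
        rw [Program.run, Strides.eval_baseExp (r := r + 1) (b₁ := b₁) (b₂ := N) R₁.strides (by simp [G₁.r_eq])
          (by simpa using G₁.top_eq) (by simp [hv, G₁.r_eq, R₁.pc_eq, hmul, hNew]) (by omega)
          (by omega) (by omega)]
      have eL : Program.run (.setNat vLow (baseExp nextExp newExp (.var lBot)))
          (s₁.setNat vUp (cellBase Z (r + 1) b₁ N)) = (s₁.setNat vUp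
            (cellBase Z (r + 1) b₁ N)).setNat vLow (cellBase Z (r + 1) N b₂) := by
        rw [Program.run, Strides.eval_baseExp (r := r + 1) (b₁ := N) (b₂ := b₂) (R₁.strides.of_agree (.setNat (by decide)))
          (by simp [G₁.r_eq]) (by simp [hv, G₁.r_eq, R₁.pc_eq, hmul, hNew])
          (by simpa using G₁.bot_eq) (by omega) (by omega) (by omega)]
      rw [Program.run_seq, eU, Program.run_seq, eL]
      set s₂ := (s₁.setNat vUp (cellBase Z (r + 1) b₁ N)).setNat vLow (cellBase Z (r + 1) N b₂)
        with hs₂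
      obtain ⟨s₃, hs₃, hx₃, hU₃, hL₃, a₃, c₃⟩ : ∃ s₃, (Program.run (.ite (.realLT pyExp
          (.cell fCand (.var lJ)))
          (.setReal xNew (.sub (.cell fCand (.var lJ)) pyExp))
          (.setReal xNew (.sub pyExp (.cell fCand (.var lJ)))) ;;
        .setReal xNew (.add (.var xNew) (.cell fBc (.var vR)))) s₂) = s₃ ∧
          s₃.realVar xNew = |d.py r - d.Y J| + d.bc r ∧
          s₃.natVar vUp = cellBase Z (r + 1) b₁ N ∧ s₃.natVar vLow = cellBase Z (r + 1) N b₂ ∧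
          AgreeBelow 68 s₁ s₃ ∧ cellAt s₃ = cellAt s₁ := by
        have a₂ : AgreeBelow 68 s₁ s₂ := (AgreeBelow.setNat (by decide)).trans (.setNat (by decide))
        have R₂ := R₁.of_agree (a₂.mono (by decide))
        have G₂ := G₁.of_agree (a₂.mono (by decide))
        have hv₂ : s₂.natVar lJ = J := (a₂.natVar _ (by decide)).trans hv
        refine ⟨_, rfl, ?_⟩
        rw [Program.run_seq, Program.run_ite]
        have e0 : Test.Holds s₂ (.realLT pyExp (.cell fCand (.var lJ))) ↔ d.py r < d.Y J := by
          simp [G₂.r_eq, R₂.py_eq, R₂.Y_eq, hv₂]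
        split_ifs with hlt
        · rw [e0] at hlt
          refine ⟨?_, by simp [hs₂], by simp [hs₂], a₂.trans ((AgreeBelow.setReal (by decide)).trans
            (.setReal (by decide))), rfl⟩
          rw [abs_of_neg (by linarith)]
          simp [G₂.r_eq, R₂.py_eq, R₂.Y_eq, R₂.bc_eq, hv₂]
        · rw [e0, not_lt] at hlt
          refine ⟨?_, by simp [hs₂], by simp [hs₂], a₂.trans ((AgreeBelow.setReal (by decide)).trans
            (.setReal (by decide))), rfl⟩
          rw [abs_of_nonneg (by linarith)]
          simp [G₂.r_eq, R₂.py_eq, R₂.Y_eq, R₂.bc_eq, hv₂]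
      rw [hs₃]
      have R₃ := R₁.of_agree (a₃.mono (by decide))
      have G₃ := G₁.of_agree (a₃.mono (by decide))
      have hv₃ : s₃.natVar lJ = J := (a₃.natVar _ (by decide)).trans hv
      have hc₃ : s₃.natVar vCell = A := (a₃.natVar _ (by decide)).trans hc₁
      have hopt₃ : Optimized d (tableOf Z s₀) A r b₁ b₂ (fun j _ _ => j < J) s₃ := by
        simpa only [Optimized, c₃] using hopt₁
      have hoff₃ : SameOff A d.B s₀ s₃ := by simpa only [SameOff, c₃] using hoff₁
      clear hs₃
      refine (RunsWithin.forUp (T := d.B * 158 + 6) (fun I s' =>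
        Optimized d (tableOf Z s₀) A r b₁ b₂ (fun j i' _ => j < J ∨ j = J ∧ i' < I) s' ∧
          SameOff A d.B s₀ s') (by decide) R₃.B_eq rfl ?_ ?_).mono (le_of_eq (by ring)) ?_
      · exact ⟨hopt₃.congr fun i j i' i'' v _ => by simp, hoff₃⟩
      · rintro I hI s₄ a₄ hv₄ ⟨hopt₄, hoff₄⟩
        have R₄ := R₃.of_agree (a₄.mono (by decide))
        refine (RunsWithin.forUp (T := 150) (fun I' s' =>
          Optimized d (tableOf Z s₀) A r b₁ b₂ (fun j i' i'' => (j < J ∨ j = J ∧ i' < I) ∨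
            j = J ∧ i' = I ∧ i'' < I') s' ∧
          SameOff A d.B s₀ s') (by decide) R₄.B_eq rfl ?_ ?_).mono le_rfl ?_
        · exact ⟨hopt₄.congr fun i j i' i'' v _ => by simp, hoff₄⟩
        · rintro I' hI' s₅ a₅ hv₅ ⟨hopt₅, hoff₅⟩
          have b₅ : AgreeBelow 70 s₃ s₅ := a₄.trans (a₅.mono (by decide))
          have R₅ := R₄.of_agree (a₅.mono (by decide))
          have G₅ := G₃.of_agree (b₅.mono (by decide))
          have cU : cellAt s₅ (cellBase Z (r + 1) b₁ N + I) =
              cellAt s₀ (cellBase Z (r + 1) b₁ N + I) :=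
            hoff₅.cellAt_eq hB (by omega) (by omega) (by omega) (by omega) (by omega) (by simp)
          have cL : cellAt s₅ (cellBase Z (r + 1) N b₂ + I') =
              cellAt s₀ (cellBase Z (r + 1) N b₂ + I') :=
            hoff₅.cellAt_eq hB (by omega) (by omega) (by omega) (by omega) (by omega) (by simp)
          refine (splitCell_runs (T := tableOf Z s₀) R₅ G₅.r_eq
            ((b₅.natVar _ (by decide)).trans hc₃)
            ((b₅.natVar _ (by decide)).trans hU₃) ((b₅.natVar _ (by decide)).trans hL₃)
            ((b₅.natVar _ (by decide)).trans hv₃) ((a₅.natVar _ (by decide)).trans hv₄) hv₅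
            ((b₅.realVar _ (by decide)).trans hx₃) hJ hI hI' hcan
            (congrArg Prod.fst cU) (congrArg (fun x => x.2.2.2.2) cU)
            (congrArg Prod.fst cL) (congrArg (fun x => x.2.2.2.2) cL) hopt₅).mono le_rfl ?_
          rintro s₆ ⟨hopt₆, hoff₆⟩
          refine ⟨Optimized.congr (s := s₆.setNat lLow (I' + 1)) hopt₆
            fun i j i' i'' v _ => by omega, hoff₅.trans hoff₆⟩
        · rintro s₆ ⟨-, hopt₆, hoff₆⟩
          refine ⟨Optimized.congr (s := s₆.setNat lUp (I + 1)) hopt₆ fun i j i' i'' v hc => ?_, hoff₆⟩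
          cases hc with
          | split _ _ _ _ _ _ _ g₁ g₂ => omega
      · rintro s₆ ⟨-, hopt₆, hoff₆⟩
        refine ⟨Optimized.congr (s := s₆.setNat lJ (J + 1)) hopt₆ fun i j i' i'' v hc => ?_, hoff₆⟩
        cases hc with
        | split _ _ _ _ _ _ _ g₁ g₂ => omega
    · intro hcan
      rw [holds_canPlaceTest R₁ G₁ hv] at hcan
      refine (RunsWithin.of_loopFree (T := 1) rfl (by decide) ?_).mono_time (by omega)
      refine ⟨Optimized.congr (s := s₁.setNat lJ (J + 1)) hopt₁ fun i j i' i'' v hc => ?_, hoff₁⟩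
      cases hc with
      | split g₁ g₂ g₃ g₄ g₅ g₆ g₇ =>
        have : j ≠ J := by
          rintro rfl
          exact hcan ⟨g₁, g₂, g₃, g₅, g₆, g₇⟩
        omega
    · have : canPlaceTest.cost ≤ 80 := by decide
      omega
  · rintro s₁ ⟨a₁, hopt₁, hoff₁⟩
    refine ⟨a₁, hopt₁.congr fun i j i' i'' v hc => ?_, hoff₁⟩
    cases hc with
    | split _ _ _ g => simp [g]

def groupCells : Program := bestStay ;; stayCells ;; splitCells

theorem groupCells_runs (ok : d.Ok cl) (h : Ready d Z s) (hg : Group Z r b₁ b₂ s)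
    (hr : r < d.n) (h₁ : b₁ < d.C * d.M + 2) (h₂ : b₂ < d.C * d.M + 2) :
    RunsWithin groupCells s (d.M * (d.B * (d.B * 158 + 14) + 200) + (d.B * 78) + 162) fun s' =>
      (∀ i, i < d.B → BestCell (d.Choice (tableOf Z s) r b₁ b₂ i)
        (cellAt s' (cellBase Z r b₁ b₂ + i))) ∧
      SameOff (cellBase Z r b₁ b₂) d.B s s' := by
  refine (RunsWithin.seq (T := 150) (T' := (d.B * 78 + 6) +
    (d.M * (d.B * (d.B * 158 + 14) + 200) + 6)) ?_).mono_time (by omega)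
  refine (bestStay_runs h hg hr h₁ h₂).mono le_rfl ?_
  rintro s₁ ⟨a₁, c₁, hcell, hnext, hstay, hbest⟩
  have R₁ := h.of_agree (a₁.mono (by decide))
  have G₁ := hg.of_agree a₁
  refine .seq ((stayCells_runs R₁ h₁ h₂ hcell hnext hstay hbest).mono le_rfl ?_)
  rintro s₂ ⟨a₂, hopt, hoff⟩
  have R₂ := R₁.of_agree (a₂.mono (by decide))
  have G₂ := G₁.of_agree (a₂.mono (by decide))
  refine (splitCells_runs ok R₂ G₂ hr h₁ h₂ ((a₂.natVar _ (by decide)).trans hcell) hopt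
    hoff).mono le_rfl ?_
  rintro s₃ ⟨-, hopt₃, hoff₃⟩
  have e : tableOf Z s₁ = tableOf Z s := by simp only [tableOf, c₁]
  rw [e] at hopt₃
  refine ⟨fun i hi => (hopt₃ i hi).congr fun κ j l l' v => by simp, ?_⟩
  simpa only [SameOff, c₁] using hoff₃

end BackboneLabeling

namespace BackboneLabeling

open Reg

variable {d : Data} {Z r b₁ b₂ i : ℕ} {s s' s'' : Store} {cl : Clearance} {T : Table}

/-! ### The whole table -/

/-- The cells of the last layer for `X` are correct. -/
def BaseOn (d : Data) (Z : ℕ) (X : ℕ → ℕ → ℕ → Prop) (s : Store) : Prop :=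
  ∀ b₁, b₁ < d.C * d.M + 2 → ∀ b₂, b₂ < d.C * d.M + 2 → ∀ i, i < d.B → X b₁ b₂ i →
    ((tableOf Z s).kind d.n b₁ b₂ i ≠ 0 ↔ d.cd i = 0) ∧ (tableOf Z s).val d.n b₁ b₂ i = 0

def baseCells : Program :=
  .forUp 57 vNB (.forUp 58 vNB (.forUp 59 vB
    (.setNat 60 (.add (baseExp (.var vn) (.var 57) (.var 58)) (.var 59)) ;;
    .storeReal fVal (.var 60) .zero ;;
    .ite (.natEq (.cell aCd (.var 59)) (.const 0)) (.storeNat aKind (.var 60) (.const 1))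
      (.storeNat aKind (.var 60) (.const 0)))))

theorem BaseOn.mono {X X' : ℕ → ℕ → ℕ → Prop} (h : BaseOn d Z X s)
    (hX : ∀ b₁ b₂ i, b₂ < d.C * d.M + 2 → i < d.B → X' b₁ b₂ i → X b₁ b₂ i) : BaseOn d Z X' s :=
  fun b₁ h₁ b₂ h₂ i hi hx => h b₁ h₁ b₂ h₂ i hi (hX b₁ b₂ i h₂ hi hx)

theorem baseCells_runs (h : Ready d Z s) :
    RunsWithin baseCells s ((d.C * d.M + 2) * ((d.C * d.M + 2) * (d.B * 58 + 14) + 14) + 6)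
      fun s' => AgreeBelow 57 s s' ∧ BaseOn d Z (fun _ _ _ => True) s' := by
  have hN := h.NB_le
  have hB := h.B_le
  have hnZ := h.n_lt
  refine (RunsWithin.forUp (T := (d.C * d.M + 2) * (d.B * 58 + 14) + 6) (fun b₁ s' =>
    BaseOn d Z (fun b₁' _ _ => b₁' < b₁) s') (by decide) h.NB_eq rfl ?_ ?_).mono
    (le_of_eq (by ring)) ?_
  · exact fun _ _ _ _ _ _ hx => absurd hx (by simp)
  · intro b₁ h₁ s₁ a₁ hv₁ hI₁
    have R₁ := h.of_agree (a₁.mono (by decide))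
    refine (RunsWithin.forUp (T := d.B * 58 + 6) (fun b₂ s' =>
      BaseOn d Z (fun b₁' b₂' _ => b₁' < b₁ ∨ b₁' = b₁ ∧ b₂' < b₂) s') (by decide) R₁.NB_eq rfl
      ?_ ?_).mono (le_of_eq (by ring)) ?_
    · exact hI₁.mono fun _ _ _ _ _ hx => by omega
    · intro b₂ h₂ s₂ a₂ hv₂ hI₂
      have R₂ := R₁.of_agree (a₂.mono (by decide))
      have hv₁₂ : s₂.natVar 57 = b₁ := (a₂.natVar _ (by decide)).trans hv₁
      refine (RunsWithin.forUp (T := 50) (fun i s' =>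
        BaseOn d Z (fun b₁' b₂' i' => b₁' < b₁ ∨ b₁' = b₁ ∧ b₂' < b₂ ∨
          b₁' = b₁ ∧ b₂' = b₂ ∧ i' < i) s') (by decide) R₂.B_eq rfl ?_ ?_).mono le_rfl ?_
      · exact hI₂.mono fun _ _ _ _ _ hx => by omega
      · intro i hi s₃ a₃ hv₃ hI₃
        have R₃ := R₂.of_agree (a₃.mono (by decide))
        have hv₁₃ : s₃.natVar 57 = b₁ := (a₃.natVar _ (by decide)).trans hv₁₂
        have hv₂₃ : s₃.natVar 58 = b₂ := (a₃.natVar _ (by decide)).trans hv₂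
        refine .of_loopFree rfl (by decide) ?_
        rw [Program.run_seq, Program.run]
        have ev : NatExp.eval s₃ (.add (baseExp (.var vn) (.var 57) (.var 58)) (.var 59)) =
            cellBase Z d.n b₁ b₂ + i := by
          rw [NatExp.eval, Strides.eval_baseExp (e₀ := .var vn) (e₁ := .var 57) (e₂ := .var 58) R₃.strides
            R₃.n_eq hv₁₃ hv₂₃ (by omega) (by omega)
            (by omega), NatExp.eval, hv₃]
        rw [ev]
        set x := cellBase Z d.n b₁ b₂ + i with hx
        have hcd : s₃.natArr aCd = d.cd := R₃.cd_eq
        have hrun : ∃ w, (w ≠ 0 ↔ d.cd i = 0) ∧ (Program.run (.storeReal fVal (.var 60) .zero ;;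
            .ite (.natEq (.cell aCd (.var 59)) (.const 0)) (.storeNat aKind (.var 60) (.const 1))
            (.storeNat aKind (.var 60) (.const 0))) (s₃.setNat 60 x)) =
            (((s₃.setNat 60 x).storeReal fVal x 0).storeNat aKind x w) := by
          by_cases hz : d.cd i = 0
          · exact ⟨1, by simp [hz], by simp [hv₃, hcd, hz]⟩
          · exact ⟨0, by simp [hz], by simp [hv₃, hcd, hz]⟩
        obtain ⟨w, hw, hrun⟩ := hrun
        rw [hrun]
        intro b₁' h₁' b₂' h₂' i' hi' hX
        simp only [tableOf, cellAt, Store.natArr_setNat, Store.realArr_setNat,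
          Store.natArr_storeNat_self, Store.realArr_storeNat, Store.realArr_storeReal_self,
          Store.natArr_storeReal, Function.update_apply]
        by_cases he : cellBase Z d.n b₁' b₂' + i' = x
        · obtain ⟨-, rfl, rfl, rfl⟩ := cellBase_inj (by omega) (by omega) (by omega) (by omega)
            (by omega) (by omega) he
          simp [hx, hw]
        · rw [if_neg he, if_neg he]
          refine hI₃ b₁' h₁' b₂' h₂' i' hi' ?_
          have : ¬ (b₁' = b₁ ∧ b₂' = b₂ ∧ i' = i) := by
            rintro ⟨rfl, rfl, rfl⟩
            exact he rfl
          omega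
      · rintro s₃ ⟨-, hI₃⟩
        exact BaseOn.mono (s := s₃.setNat 58 (b₂ + 1)) hI₃ fun _ _ _ _ _ hx => by omega
    · rintro s₃ ⟨-, hI₃⟩
      exact BaseOn.mono (s := s₃.setNat 57 (b₁ + 1)) hI₃ fun _ _ _ _ _ hx => by omega
  · rintro s₃ ⟨a₃, hI₃⟩
    exact ⟨a₃, fun b₁ h₁ b₂ h₂ i hi _ => hI₃ b₁ h₁ b₂ h₂ i hi h₁⟩

/-- The last layer and the cells for `X` are correct. -/
structure SolvedOn (d : Data) (Z : ℕ) (X : ℕ → ℕ → ℕ → Prop) (s : Store) : Prop where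
  base : BaseOn d Z (fun _ _ _ => True) s
  step : ∀ r, r < d.n → ∀ b₁, b₁ < d.C * d.M + 2 → ∀ b₂, b₂ < d.C * d.M + 2 → X r b₁ b₂ →
    ∀ i, i < d.B → BestCell (d.Choice (tableOf Z s) r b₁ b₂ i) (cellAt s (cellBase Z r b₁ b₂ + i))

theorem SolvedOn.mono {X X' : ℕ → ℕ → ℕ → Prop} (h : SolvedOn d Z X s)
    (hs : cellAt s' = cellAt s)
    (hX : ∀ r b₁ b₂, b₁ < d.C * d.M + 2 → b₂ < d.C * d.M + 2 → X' r b₁ b₂ → X r b₁ b₂) :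
    SolvedOn d Z X' s' := by
  have e : tableOf Z s' = tableOf Z s := by simp only [tableOf, hs]
  refine ⟨fun b₁ h₁ b₂ h₂ i hi _ => ?_, fun r hr b₁ h₁ b₂ h₂ hx => ?_⟩
  · rw [e]
    exact h.base b₁ h₁ b₂ h₂ i hi trivial
  · rw [e, hs]
    exact h.step r hr b₁ h₁ b₂ h₂ (hX r b₁ b₂ h₁ h₂ hx)

theorem SolvedOn.insert {X : ℕ → ℕ → ℕ → Prop} (ok : d.Ok cl) (hR : Ready d Z s)
    (h : SolvedOn d Z X s) (hr : r < d.n) (h₁ : b₁ < d.C * d.M + 2) (h₂ : b₂ < d.C * d.M + 2)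
    (hX : ∀ r' b₁' b₂', X r' b₁' b₂' → r ≤ r')
    (hbest : ∀ i, i < d.B → BestCell (d.Choice (tableOf Z s) r b₁ b₂ i)
        (cellAt s' (cellBase Z r b₁ b₂ + i)))
    (hoff : SameOff (cellBase Z r b₁ b₂) d.B s s') :
    SolvedOn d Z (fun r' b₁' b₂' => X r' b₁' b₂' ∨ r' = r ∧ b₁' = b₁ ∧ b₂' = b₂) s' := by
  have hN := hR.NB_le
  have hB := hR.B_le
  have hcell : ∀ r', ∀ b₁', b₁' < d.C * d.M + 2 → ∀ b₂', b₂' < d.C * d.M + 2 → ∀ i, i < d.B →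
      ¬ (r' = r ∧ b₁' = b₁ ∧ b₂' = b₂) →
      cellAt s' (cellBase Z r' b₁' b₂' + i) = cellAt s (cellBase Z r' b₁' b₂' + i) :=
    fun r' b₁' h₁' b₂' h₂' i hi hne => hoff.cellAt_eq hB (by omega) (by omega) (by omega)
      (by omega) (by omega) hne
  have htab : ∀ r', r' ≠ r → ∀ b₁', b₁' < d.C * d.M + 2 → ∀ b₂', b₂' < d.C * d.M + 2 → ∀ i,
      i < d.B → (tableOf Z s').kind r' b₁' b₂' i = (tableOf Z s).kind r' b₁' b₂' i ∧
        (tableOf Z s').val r' b₁' b₂' i = (tableOf Z s).val r' b₁' b₂' i := by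
    intro r' hr' b₁' h₁' b₂' h₂' i hi
    have := hcell r' b₁' h₁' b₂' h₂' i hi fun h' => hr' h'.1
    exact ⟨congrArg Prod.fst this, congrArg (fun x => x.2.2.2.2) this⟩
  have hchoice : ∀ r', r' < d.n → r ≤ r' → ∀ b₁', b₁' < d.C * d.M + 2 → ∀ b₂',
      b₂' < d.C * d.M + 2 → ∀ i, i < d.B → ∀ κ j l l' v,
      d.Choice (tableOf Z s') r' b₁' b₂' i κ j l l' v ↔
      d.Choice (tableOf Z s) r' b₁' b₂' i κ j l l' v := by
    intro r' hr' hle b₁' h₁' b₂' h₂' i hi κ j l l' v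
    constructor
    · refine Data.Choice.congr ok hr' h₁' h₂' hi fun c₁ g₁ c₂ g₂ i' hi' => ?_
      obtain ⟨e, e'⟩ := htab (r' + 1) (by omega) c₁ g₁ c₂ g₂ i' hi'
      exact ⟨e.symm, e'.symm⟩
    · exact Data.Choice.congr ok hr' h₁' h₂' hi (htab (r' + 1) (by omega))
  refine ⟨fun b₁' h₁' b₂' h₂' i hi _ => ?_, fun r' hr' b₁' h₁' b₂' h₂' hx i hi => ?_⟩
  · obtain ⟨e, e'⟩ := htab d.n (by omega) b₁' h₁' b₂' h₂' i hi
    rw [e, e']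
    exact h.base b₁' h₁' b₂' h₂' i hi trivial
  · by_cases he : r' = r ∧ b₁' = b₁ ∧ b₂' = b₂
    · obtain ⟨rfl, rfl, rfl⟩ := he
      exact (hbest i hi).congr (hchoice _ hr' le_rfl _ h₁' _ h₂' i hi)
    · have hx' := hx.resolve_right he
      rw [hcell r' b₁' h₁' b₂' h₂' i hi he]
      exact (h.step r' hr' b₁' h₁' b₂' h₂' hx' i hi).congr
        (hchoice _ hr' (hX _ _ _ hx') _ h₁' _ h₂' i hi)

def fillTable : Program :=
  baseCells ;;
  .forUp 60 vn (.setNat vR (.sub (.sub (.var vn) (.const 1)) (.var 60)) ;;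
    .forUp lTop vNB (.forUp lBot vNB groupCells))

theorem fillTable_time {N M B n : ℕ} (hN : 0 < N) (hM : 0 < M) (hB : 0 < B) (hn : 0 < n) :
    (N * (N * (B * 58 + 14) + 14) + 6) +
      (n * (6 + (N * (N * (M * (B * (B * 158 + 14) + 200) + (B * 78) + 170) + 14) + 6) + 8) + 6)
      ≤ 1000 * (n * (N * N * M * (B * B))) := by
  have aux : ∀ (x : ℕ) {X Y k : ℕ}, X ≤ k * Y → x * X ≤ k * (x * Y) := fun x X Y k h =>
    (Nat.mul_le_mul_left x h).trans (le_of_eq (by ring))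
  obtain ⟨Q, hQ⟩ : ∃ Q, Q = B * B := ⟨_, rfl⟩
  obtain ⟨P, hP⟩ : ∃ P, P = M * Q := ⟨_, rfl⟩
  obtain ⟨R, hR⟩ : ∃ R, R = N * P := ⟨_, rfl⟩
  obtain ⟨S, hS⟩ : ∃ S, S = N * R := ⟨_, rfl⟩
  obtain ⟨V, hV⟩ : ∃ V, V = n * S := ⟨_, rfl⟩
  have q : B ≤ Q := hQ ▸ Nat.le_mul_of_pos_left _ hB
  have p : Q ≤ P := hP ▸ Nat.le_mul_of_pos_left _ hM
  have r : P ≤ R := hR ▸ Nat.le_mul_of_pos_left _ hN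
  have s : R ≤ S := hS ▸ Nat.le_mul_of_pos_left _ hN
  have v : S ≤ V := hV ▸ Nat.le_mul_of_pos_left _ hn
  have e : n * (N * N * M * (B * B)) = V := by rw [hV, hS, hR, hP, hQ]; ring
  have hG : M * (B * (B * 158 + 14) + 200) + B * 78 + 170 ≤ 620 * P := by
    have : M * (B * (B * 158 + 14) + 200) ≤ M * (372 * Q) := by
      refine Nat.mul_le_mul_left _ ?_
      have : B * (B * 158 + 14) = 158 * Q + 14 * B := by rw [hQ]; ring
      linarith
    have e' : M * (372 * Q) = 372 * P := by rw [hP]; ring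
    linarith
  have h1 : N * (M * (B * (B * 158 + 14) + 200) + B * 78 + 170) ≤ 620 * R :=
    by rw [hR]; exact aux N hG
  have h2 : N * (N * (M * (B * (B * 158 + 14) + 200) + B * 78 + 170) + 14) ≤ 634 * S :=
    by rw [hS]; exact aux N (by linarith)
  have h3 : n * (6 + (N * (N * (M * (B * (B * 158 + 14) + 200) + B * 78 + 170) + 14) + 6) + 8) ≤
      660 * V := by rw [hV]; exact aux n (by linarith)
  have h4 : N * (B * 58 + 14) ≤ 72 * R :=
    by rw [hR]; exact aux N (by linarith)
  have h5 : N * (N * (B * 58 + 14) + 14) ≤ 86 * S :=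
    by rw [hS]; exact aux N (by linarith)
  rw [e]
  linarith

theorem fillTable_runs (ok : d.Ok cl) (h : Ready d Z s) (hn : 0 < d.n) (hM : 0 < d.M)
    (hB : 0 < d.B) :
    RunsWithin fillTable s
      (1000 * (d.n * ((d.C * d.M + 2) * (d.C * d.M + 2) * d.M * (d.B * d.B)))) fun s' =>
      AgreeBelow 56 s s' ∧ d.Solves (tableOf Z s') := by
  refine (RunsWithin.seq ?_).mono_time (fillTable_time (by omega) hM hB hn)
  refine (baseCells_runs h).mono le_rfl ?_
  rintro s₁ ⟨a₁, hbase⟩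
  have R₁ := h.of_agree (a₁.mono (by decide))
  refine (RunsWithin.forUp (fun t s' => SolvedOn d Z (fun r _ _ => d.n ≤ r + t) s')
    (by decide) R₁.n_eq rfl ?_ ?_).mono le_rfl ?_
  · exact ⟨hbase, fun r hr _ _ _ _ h' => absurd h' (by simpa using hr)⟩
  · intro t ht s₂ a₂ hv₂ hI₂
    have R₂ := R₁.of_agree (a₂.mono (by decide))
    refine .seq (.of_loopFree rfl (by decide) ?_)
    set r := d.n - 1 - t with hr
    have hs₃ : Program.run (.setNat vR (.sub (.sub (.var vn) (.const 1)) (.var 60))) s₂ =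
        s₂.setNat vR r := by simp [R₂.n_eq, hv₂, hr]
    rw [hs₃]
    have R₃ := R₂.of_agree (s' := s₂.setNat vR r) (.setNat (by decide))
    refine (RunsWithin.forUp (T := (d.C * d.M + 2) * (d.M * (d.B * (d.B * 158 + 14) + 200) +
      d.B * 78 + 170) + 6) (fun b₁ s' => SolvedOn d Z (fun r' b₁' _ => d.n ≤ r' + t ∨
      r' = r ∧ b₁' < b₁) s') (by decide) R₃.NB_eq rfl ?_ ?_).mono ?_ ?_
    · exact hI₂.mono rfl fun _ _ _ _ _ h' => by omega
    · intro b₁ h₁ s₄ a₄ hv₄ hI₄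
      have R₄ := R₃.of_agree (a₄.mono (by decide))
      refine (RunsWithin.forUp (T := d.M * (d.B * (d.B * 158 + 14) + 200) + d.B * 78 + 162)
        (fun b₂ s' => SolvedOn d Z (fun r' b₁' b₂' => (d.n ≤ r' + t ∨
        r' = r ∧ b₁' < b₁) ∨ r' = r ∧ b₁' = b₁ ∧ b₂' < b₂) s') (by decide) R₄.NB_eq rfl
        ?_ ?_).mono ?_ ?_
      · exact hI₄.mono rfl fun _ _ _ _ _ h' => by omega
      · intro b₂ h₂ s₅ a₅ hv₅ hI₅
        have R₅ := R₄.of_agree (a₅.mono (by decide))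
        have G₅ : Group Z r b₁ b₂ s₅ := ⟨(a₅.natVar _ (by decide)).trans
          ((a₄.natVar _ (by decide)).trans (by simp)), (a₅.natVar _ (by decide)).trans hv₄, hv₅⟩
        refine (groupCells_runs ok R₅ G₅ (by omega) h₁ h₂).mono le_rfl ?_
        rintro s₆ ⟨hbest, hoff⟩
        exact (hI₅.insert ok R₅ (by omega) h₁ h₂
          (fun r' _ _ h' => by omega) hbest hoff).mono rfl fun _ _ _ _ _ h' => by omega
      · exact le_rfl
      · rintro s₆ ⟨-, hI₆⟩
        exact hI₆.mono rfl fun _ _ _ _ _ h' => by omega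
    · exact le_of_eq (by ring)
    · rintro s₆ ⟨-, hI₆⟩
      exact hI₆.mono rfl fun _ _ _ _ _ h' => by omega
  · rintro s₂ ⟨a₂, hI₂⟩
    refine ⟨(a₁.mono (by decide)).trans (a₂.mono (by decide)), ?_, ?_, ?_⟩
    · exact fun b₁ h₁ b₂ h₂ i hi => (hI₂.base b₁ h₁ b₂ h₂ i hi trivial).1
    · exact fun b₁ h₁ b₂ h₂ i hi => (hI₂.base b₁ h₁ b₂ h₂ i hi trivial).2
    · exact fun r hr b₁ h₁ b₂ h₂ i hi => hI₂.step r hr b₁ h₁ b₂ h₂ (by omega) i hi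

end BackboneLabeling

namespace BackboneLabeling

namespace Reg

/-- address of the cells of the whole problem -/
abbrev vRoot : ℕ := 78
/-- counter of the loop over the budgets -/
abbrev lI : ℕ := 79
/-- `0` if no feasible budget has been found -/
abbrev vFound : ℕ := 80
/-- best budget -/
abbrev vBest : ℕ := 81
/-- its value -/
abbrev xBest : ℕ := 82
/-- counter of the loop over the points -/
abbrev lR : ℕ := 84
/-- bound and counter of the loop over the strips -/
abbrev vBound : ℕ := 85
abbrev lStrip : ℕ := 86
/-- the strip that contains the point -/
abbrev vStrip : ℕ := 87
/-- numbers of labels and strips -/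
abbrev vLabels : ℕ := 88
abbrev vStrips : ℕ := 89
/-- backbones, labels and budgets of the strips -/
abbrev aStripUp : ℕ := 90
abbrev aStripLow : ℕ := 91
abbrev aStripUpLabel : ℕ := 92
abbrev aStripLowLabel : ℕ := 93
abbrev aStripBudget : ℕ := 94
/-- heights and colors of the labels -/
abbrev fHeight : ℕ := 95
abbrev aLabelColor : ℕ := 95
/-- labels of the points by rank -/
abbrev aAssign : ℕ := 96
/-- address of the cell of the strip -/
abbrev vAddr : ℕ := 97
/-- the new backbone -/
abbrev vNew : ℕ := 98

end Reg

open Reg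

variable {d : Data} {Z r k i : ℕ} {s s' s'' : Store} {cl : Clearance} {T : Table}

theorem AgreeBelow.cellAt_eq (h : AgreeBelow 78 s s') : cellAt s' = cellAt s := by
  funext x
  simp only [cellAt, h.natArr _ (show aKind < 78 by decide), h.natArr _ (show aCand < 78 by decide),
    h.natArr _ (show aUpper < 78 by decide), h.natArr _ (show aLower < 78 by decide),
    h.realArr _ (show fVal < 78 by decide)]

theorem AgreeBelow.tableOf_eq (h : AgreeBelow 78 s s') : tableOf Z s' = tableOf Z s := by
  simp only [tableOf, h.cellAt_eq]

/-! ### The best budget -/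

def updateBest : Program :=
  .setNat vFound (.const 1) ;; .setNat vBest (.var lI) ;;
  .setReal xBest (.cell fVal (.add (.var vRoot) (.var lI)))

def bestBudget : Program :=
  (.setNat vRoot (baseExp (.const 0) (.var vTop) (.var vBottom)) ;; .setNat vFound (.const 0)) ;;
  .forUp lI vB
    (.ite (.conj (.neg (.natEq (.cell aKind (.add (.var vRoot) (.var lI))) (.const 0)))
        (.neg (.conj (.neg (.natEq (.var vFound) (.const 0)))
          (.neg (.realLT (.cell fVal (.add (.var vRoot) (.var lI))) (.var xBest))))))
      updateBest .skip)

theorem bestBudget_runs (h : Ready d Z s) (hT : tableOf Z s = T) :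
    RunsWithin bestBudget s (d.B * 68 + 26) fun s' => AgreeBelow 78 s s' ∧
      (s'.natVar vFound = 0 → ∀ i, i < d.B → T.kind 0 d.virtualTop d.virtualBottom i = 0) ∧
      (s'.natVar vFound ≠ 0 → s'.natVar vBest < d.B ∧
        T.kind 0 d.virtualTop d.virtualBottom (s'.natVar vBest) ≠ 0 ∧
        ∀ i, i < d.B → T.kind 0 d.virtualTop d.virtualBottom i ≠ 0 →
          T.val 0 d.virtualTop d.virtualBottom (s'.natVar vBest) ≤
            T.val 0 d.virtualTop d.virtualBottom i) := by
  have hN := h.NB_le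
  refine (RunsWithin.seq (T := 20) (T' := d.B * 68 + 6) (.of_loopFree rfl (by decide) ?_)).mono_time
    (by omega)
  set s₁ := Program.run (.setNat vRoot (baseExp (.const 0) (.var vTop) (.var vBottom)) ;;
    .setNat vFound (.const 0)) s with hs₁
  have a₁ : AgreeBelow 78 s s₁ := (AgreeBelow.setNat (by decide)).trans (.setNat (by decide))
  have R₁ := h.of_agree (a₁.mono (by decide))
  have hroot₁ : s₁.natVar vRoot = cellBase Z 0 d.virtualTop d.virtualBottom := by
    have : NatExp.eval s (baseExp (.const 0) (.var vTop) (.var vBottom)) =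
        cellBase Z 0 d.virtualTop d.virtualBottom :=
      Strides.eval_baseExp h.strides rfl h.top_eq h.bottom_eq (by omega)
        (by simp only [Data.virtualTop]; omega) (by simp only [Data.virtualBottom]; omega)
    simp [hs₁, this]
  have hf₁ : s₁.natVar vFound = 0 := by simp [hs₁]
  have hT₁ : tableOf Z s₁ = T := a₁.tableOf_eq.trans hT
  clear_value s₁
  refine (RunsWithin.forUp (T := 60) (fun i s' =>
    (s'.natVar vFound = 0 → ∀ i', i' < i → T.kind 0 d.virtualTop d.virtualBottom i' = 0) ∧
    (s'.natVar vFound ≠ 0 → s'.natVar vBest < i ∧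
        T.kind 0 d.virtualTop d.virtualBottom (s'.natVar vBest) ≠ 0 ∧
        s'.realVar xBest = T.val 0 d.virtualTop d.virtualBottom (s'.natVar vBest) ∧
        ∀ i', i' < i → T.kind 0 d.virtualTop d.virtualBottom i' ≠ 0 →
          s'.realVar xBest ≤ T.val 0 d.virtualTop d.virtualBottom i')) (by decide) R₁.B_eq rfl ?_
    ?_).mono le_rfl ?_
  · exact ⟨fun _ i' hi' => absurd hi' (by omega), fun h' => absurd hf₁ (by simpa using h')⟩
  · rintro i hi s₂ a₂ hv ⟨hI, hI'⟩
    have hroot₂ := (a₂.natVar vRoot (by decide)).trans hroot₁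
    have hT₂ : tableOf Z s₂ = T := (a₂.mono (by decide)).tableOf_eq.trans hT₁
    have hk : s₂.natArr aKind (cellBase Z 0 d.virtualTop d.virtualBottom + i) =
        T.kind 0 d.virtualTop d.virtualBottom i := by rw [← hT₂]; rfl
    have hw : s₂.realArr fVal (cellBase Z 0 d.virtualTop d.virtualBottom + i) =
        T.val 0 d.virtualTop d.virtualBottom i := by rw [← hT₂]; rfl
    refine .of_loopFree rfl (by decide) ?_
    rw [Program.run_ite]
    have e0 : Test.Holds s₂ (.conj (.neg (.natEq (.cell aKind (.add (.var vRoot) (.var lI)))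
        (.const 0))) (.neg (.conj (.neg (.natEq (.var vFound) (.const 0)))
          (.neg (.realLT (.cell fVal (.add (.var vRoot) (.var lI))) (.var xBest)))))) ↔
        T.kind 0 d.virtualTop d.virtualBottom i ≠ 0 ∧ (s₂.natVar vFound ≠ 0 →
          T.val 0 d.virtualTop d.virtualBottom i < s₂.realVar xBest) := by
      simp [hroot₂, hv, hk, hw]
    split_ifs with hc
    · rw [e0] at hc
      have u₁ : ((updateBest.run s₂).setNat lI (i + 1)).natVar vFound = 1 := by simp [updateBest]
      have u₂ : ((updateBest.run s₂).setNat lI (i + 1)).natVar vBest = i := by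
        simp [updateBest, hv]
      have u₃ : ((updateBest.run s₂).setNat lI (i + 1)).realVar xBest =
          T.val 0 d.virtualTop d.virtualBottom i := by simp [updateBest, hv, hroot₂, hw]
      rw [u₁, u₂, u₃]
      refine ⟨fun h' => absurd h' one_ne_zero, fun _ => ⟨by omega, hc.1, rfl, ?_⟩⟩
      intro i' hi' hk'
      by_cases he : i' = i
      · rw [he]
      · by_cases hz : s₂.natVar vFound = 0
        · exact absurd (hI hz i' (by omega)) hk'
        · exact (hc.2 hz).le.trans ((hI' hz).2.2.2 i' (by omega) hk')
    · rw [e0] at hc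
      have u₁ : (s₂.setNat lI (i + 1)).natVar vFound = s₂.natVar vFound := by simp
      have u₂ : (s₂.setNat lI (i + 1)).natVar vBest = s₂.natVar vBest := by simp
      rw [Program.run, u₁, u₂, Store.realVar_setNat]
      refine ⟨fun hz i' hi' => ?_, fun hz => ?_⟩
      · by_cases he : i' = i
        · rw [he]
          by_contra hne
          exact hc ⟨hne, fun h' => absurd hz h'⟩
        · exact hI hz i' (by omega)
      · obtain ⟨g₁, g₂, g₃, g₄⟩ := hI' hz
        refine ⟨by omega, g₂, g₃, fun i' hi' hk' => ?_⟩
        by_cases he : i' = i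
        · subst he
          exact not_lt.1 fun hlt => hc ⟨hk', fun _ => hlt⟩
        · exact g₄ i' (by omega) hk'
  · rintro s₂ ⟨a₂, hI, hI'⟩
    refine ⟨a₁.trans (a₂.mono (by decide)), hI, fun hz => ?_⟩
    obtain ⟨g₁, g₂, g₃, g₄⟩ := hI' hz
    exact ⟨g₁, g₂, fun i hi hk => g₃ ▸ g₄ i hi hk⟩

/-! ### The reconstruction of a labeling -/

/-- The state of the reconstruction in the store. -/
def sweepOf (birth : ℕ → ℕ) (s : Store) : Sweep where
  numLabels := s.natVar vLabels
  numStrips := s.natVar vStrips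
  assign := s.natArr aAssign
  birth := birth
  height := s.realArr fHeight
  color := s.natArr aLabelColor
  upper := s.natArr aStripUp
  lower := s.natArr aStripLow
  upperLabel := s.natArr aStripUpLabel
  lowerLabel := s.natArr aStripLowLabel
  budget := s.natArr aStripBudget

/-- The strip with index `lStrip` contains the point with rank `lR`. -/
def stripTest : Test :=
  .conj (.realLT (.cell fHb (.cell aStripLow (.var lStrip))) (.cell fPy (.var lR)))
    (.neg (.realLT (.cell fHb (.cell aStripUp (.var lStrip))) (.cell fPy (.var lR))))

def findStrip : Program :=
  .setNat vBound (.var vStrips) ;;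
  .forUp lStrip vBound (.ite stripTest (.setNat vStrip (.var lStrip)) .skip)

theorem findStrip_runs {σ : Sweep} {birth : ℕ → ℕ} (h : Ready d Z s) (hσ : sweepOf birth s = σ)
    (hr : s.natVar lR = r) (hk : k < σ.numStrips) (hin : d.InStrip r (σ.upper k) (σ.lower k))
    (huniq : ∀ k', k' < σ.numStrips → d.InStrip r (σ.upper k') (σ.lower k') → k' = k) :
    RunsWithin findStrip s (σ.numStrips * 30 + 8) fun s' => AgreeBelow 85 s s' ∧
      sweepOf birth s' = σ ∧ s'.natVar vStrip = k := by
  refine (RunsWithin.seq (T := 2) (T' := σ.numStrips * 30 + 6) (.of_loopFree rfl (by decide)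
    ?_)).mono_time (by omega)
  have R₁ := h.of_agree (s' := Program.run (.setNat vBound (.var vStrips)) s) (.setNat (by decide))
  refine (RunsWithin.forUp (T := 22) (n := σ.numStrips) (fun q s' => sweepOf birth s' = σ ∧
    (k < q → s'.natVar vStrip = k)) (by decide) ?_ rfl ?_ ?_).mono le_rfl ?_
  · simp [← hσ, sweepOf]
  · refine ⟨?_, fun h' => absurd h' (by omega)⟩
    simpa [sweepOf] using hσ
  · rintro q hq s₁ a₁ hv ⟨hσ₁, hI⟩
    have R₂ := R₁.of_agree (a₁.mono (by decide))
    have hr₁ : s₁.natVar lR = r := (a₁.natVar _ (by decide)).trans (by simpa using hr)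
    have hup : s₁.natArr aStripUp = σ.upper := by rw [← hσ₁]; rfl
    have hlow : s₁.natArr aStripLow = σ.lower := by rw [← hσ₁]; rfl
    have e0 : stripTest.Holds s₁ ↔ d.InStrip r (σ.upper q) (σ.lower q) := by
      simp [stripTest, hv, hr₁, hup, hlow, R₂.hb_eq, R₂.py_eq, Data.InStrip]
    refine .of_loopFree rfl (by decide) ?_
    rw [Program.run_ite]
    split_ifs with hc
    · rw [e0] at hc
      obtain rfl := huniq q hq hc
      refine ⟨?_, fun _ => by simp [hv]⟩
      simpa [sweepOf] using hσ₁
    · rw [e0] at hc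
      refine ⟨by simpa [sweepOf] using hσ₁, fun hlt => ?_⟩
      have : k ≠ q := by rintro rfl; exact hc hin
      simpa using hI (by omega)
  · rintro s₁ ⟨a₁, hσ₁, hI⟩
    exact ⟨(AgreeBelow.setNat (by decide)).trans (a₁.mono (by decide)), hσ₁, hI hk⟩

def traceSplit : Program :=
  .setNat vNew (.add (.cell aCand (.var vAddr)) (.cell aMulM (.cell aPc (.var lR)))) ;;
  .storeNat aAssign (.var lR) (.var vLabels) ;;
  .storeReal fHeight (.var vLabels) (.cell fCand (.cell aCand (.var vAddr))) ;;
  .storeNat aLabelColor (.var vLabels) (.cell aPc (.var lR)) ;;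
  .storeNat aStripUp (.var vStrips) (.var vNew) ;;
  .storeNat aStripLow (.var vStrips) (.cell aStripLow (.var vStrip)) ;;
  .storeNat aStripLow (.var vStrip) (.var vNew) ;;
  .storeNat aStripUpLabel (.var vStrips) (.var vLabels) ;;
  .storeNat aStripLowLabel (.var vStrips) (.cell aStripLowLabel (.var vStrip)) ;;
  .storeNat aStripLowLabel (.var vStrip) (.var vLabels) ;;
  .storeNat aStripBudget (.var vStrips) (.cell aLower (.var vAddr)) ;;
  .storeNat aStripBudget (.var vStrip) (.cell aUpper (.var vAddr)) ;;
  .setNat vLabels (.add (.var vLabels) (.const 1)) ;;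
  .setNat vStrips (.add (.var vStrips) (.const 1))

def tracePoint : Program :=
  findStrip ;;
  (.setNat vAddr (.add (baseExp (.var lR) (.cell aStripUp (.var vStrip))
    (.cell aStripLow (.var vStrip))) (.cell aStripBudget (.var vStrip))) ;;
  .ite (.natEq (.cell aKind (.var vAddr)) (.const 2))
    (.storeNat aAssign (.var lR) (.cell aStripUpLabel (.var vStrip)))
    (.ite (.natEq (.cell aKind (.var vAddr)) (.const 3))
      (.storeNat aAssign (.var lR) (.cell aStripLowLabel (.var vStrip)))
      traceSplit))

theorem tracePoint_runs {birth : ℕ → ℕ} {vec : ℕ → ℕ → ℕ} {V : ℝ} {U : ℕ → ℕ} (h : Ready d Z s)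
    (ok : d.Ok cl) (hsol : d.Solves (tableOf Z s))
    (hvec : ∀ i, i < d.B → (∀ c, c < d.D → vec i c < d.k c) ∧ d.cd i = d.code (vec i))
    (hr : s.natVar lR = r) (hrn : r < d.n)
    (hI : (sweepOf birth s).Inv d cl (tableOf Z s) vec V U r) :
    RunsWithin tracePoint s (s.natVar vStrips * 30 + 208) fun s' =>
      s'.natVar vStrips ≤ s.natVar vStrips + 1 ∧
      ∃ birth', (sweepOf birth' s').Inv d cl (tableOf Z s) vec V U (r + 1) := by
  obtain ⟨k, hk, hin, huniq⟩ := hI.exists_strip ok hrn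
  refine (RunsWithin.seq (T := s.natVar vStrips * 30 + 8) (T' := 200) ?_).mono_time (by omega)
  refine (findStrip_runs h rfl hr hk hin huniq).mono le_rfl ?_
  rintro s₁ ⟨a₁, hσ, hstrip⟩
  have R₁ := h.of_agree (a₁.mono (by decide))
  have hr₁ : s₁.natVar lR = r := (a₁.natVar _ (by decide)).trans hr
  have hn := h.n_lt
  have hN := h.NB_le
  rw [← hσ] at hI hin hk
  have g₁ := hI.upper_lt k hk
  have g₂ := hI.lower_lt k hk
  set σ := sweepOf birth s₁ with hσdef
  have hσn : s.natVar vStrips = s₁.natVar vStrips := (congrArg Sweep.numStrips hσ).symm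
  refine .of_loopFree rfl (by decide) ?_
  rw [Program.run_seq]
  set x := cellBase Z r (σ.upper k) (σ.lower k) + σ.budget k with hx
  have hs₂ : Program.run (.setNat vAddr (.add (baseExp (.var lR) (.cell aStripUp (.var vStrip))
      (.cell aStripLow (.var vStrip))) (.cell aStripBudget (.var vStrip)))) s₁ =
      s₁.setNat vAddr x := by
    rw [Program.run, NatExp.eval, Strides.eval_baseExp (r := r) (b₁ := σ.upper k) (b₂ := σ.lower k)
      R₁.strides (by simp [hr₁]) (by simp [hstrip, hσdef, sweepOf])
      (by simp [hstrip, hσdef, sweepOf]) (by omega) (by omega) (by omega)]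
    simp [hstrip, hσdef, sweepOf, hx]
  rw [hs₂]
  set s₂ := s₁.setNat vAddr x with hs₂def
  have htab : tableOf Z s = tableOf Z s₁ := (a₁.mono (by decide)).tableOf_eq.symm
  rw [htab] at hI hsol ⊢
  have hkind : s₂.natArr aKind x =
    (tableOf Z s₁).kind r (σ.upper k) (σ.lower k) (σ.budget k) := rfl
  have hxv : s₂.natVar vAddr = x := by simp [hs₂def]
  have hrv : s₂.natVar lR = r := by simpa [hs₂def] using hr₁
  have hkv : s₂.natVar vStrip = k := by simpa [hs₂def] using hstrip
  have hsv : s₂.natVar vStrips = s₁.natVar vStrips := by simp [hs₂def]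
  have hσ₂ : sweepOf birth s₂ = σ := by simp [hs₂def, hσdef, sweepOf]
  rw [Program.run_ite]
  have e0 : Test.Holds s₂ (.natEq (.cell aKind (.var vAddr)) (.const 2)) ↔
      (tableOf Z s₁).kind r (σ.upper k) (σ.lower k) (σ.budget k) = 2 := by
    simp [hxv, hkind]
  have e1 : Test.Holds s₂ (.natEq (.cell aKind (.var vAddr)) (.const 3)) ↔
      (tableOf Z s₁).kind r (σ.upper k) (σ.lower k) (σ.budget k) = 3 := by
    simp [hxv, hkind]
  split_ifs with h2
  · rw [e0] at h2
    refine ⟨by simp [hsv, hσn], birth, ?_⟩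
    convert hI.connect_up ok hsol hrn hk hin h2 using 1
    rw [← hσ₂]
    simp [sweepOf, Sweep.connect, hrv, hkv]
  · rw [e0] at h2
    rw [Program.run_ite]
    split_ifs with h3
    · rw [e1] at h3
      refine ⟨by simp [hsv, hσn], birth, ?_⟩
      convert hI.connect_down ok hsol hrn hk hin h3 using 1
      rw [← hσ₂]
      simp [sweepOf, Sweep.connect, hrv, hkv]
    · rw [e1] at h3
      refine ⟨by simp [traceSplit, hsv, hσn], Function.update birth σ.numLabels r, ?_⟩
      have R₂ : Ready d Z s₂ := R₁.of_agree (.setNat (by decide))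
      convert hI.split ok hsol hvec hrn hk hin h2 h3 using 1
      have hmul := R₂.mulM_eq (d.pc r) (ok.pc_lt r hrn).le
      have hc : s₂.natArr aCand x =
        (tableOf Z s₁).cand r (σ.upper k) (σ.lower k) (σ.budget k) := rfl
      have hu : s₂.natArr aUpper x =
        (tableOf Z s₁).upper r (σ.upper k) (σ.lower k) (σ.budget k) := rfl
      have hl : s₂.natArr aLower x =
        (tableOf Z s₁).lower r (σ.upper k) (σ.lower k) (σ.budget k) := rfl
      rw [← hc, ← hu, ← hl, ← hσ₂]
      simp [sweepOf, Sweep.split, traceSplit, hrv, hkv, hxv, R₂.pc_eq, R₂.Y_eq, hmul]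

end BackboneLabeling

namespace BackboneLabeling

namespace Reg
/-- counter of the loops of the output -/
abbrev lOut : ℕ := 99
end Reg

open Reg

variable {d : Data} {Z r i : ℕ} {s s' s'' : Store} {cl : Clearance} {T : Table}

def trace : Program :=
  (.setNat vLabels (.const 0) ;; .setNat vStrips (.const 1) ;;
    .storeNat aStripUp (.const 0) (.var vTop) ;; .storeNat aStripLow (.const 0) (.var vBottom) ;;
    .storeNat aStripBudget (.const 0) (.var vBest)) ;;
  .forUp lR vn tracePoint

theorem trace_runs {vec : ℕ → ℕ → ℕ} (h : Ready d Z s) (ok : d.Ok cl) (hT : tableOf Z s = T)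
    (hsol : d.Solves T)
    (hvec : ∀ i, i < d.B → (∀ c, c < d.D → vec i c < d.k c) ∧ d.cd i = d.code (vec i))
    (hi : s.natVar vBest = i) (hiB : i < d.B)
    (hkind : T.kind 0 d.virtualTop d.virtualBottom i ≠ 0) :
    RunsWithin trace s (d.n * (d.n * 30 + 216) + 26) fun s' => AgreeBelow 84 s s' ∧
      ∃ birth, (sweepOf birth s').Inv d cl T vec (T.val 0 d.virtualTop d.virtualBottom i) (vec i)
        d.n := by
  refine (RunsWithin.seq (T := 20) (T' := d.n * (d.n * 30 + 216) + 6) (.of_loopFree rfl (by decide)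
    ?_)).mono_time (by omega)
  set s₁ := Program.run (.setNat vLabels (.const 0) ;; .setNat vStrips (.const 1) ;;
    .storeNat aStripUp (.const 0) (.var vTop) ;; .storeNat aStripLow (.const 0) (.var vBottom) ;;
    .storeNat aStripBudget (.const 0) (.var vBest)) s with hs₁
  have a₁ : AgreeBelow 84 s s₁ := ((AgreeBelow.setNat (by decide)).trans
    (.setNat (by decide))).trans (((AgreeBelow.storeNat (by decide)).trans
    (.storeNat (by decide))).trans (.storeNat (by decide)))
  have R₁ := h.of_agree (a₁.mono (by decide))
  have hT₁ : tableOf Z s₁ = T := (a₁.mono (by decide)).tableOf_eq.trans hT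
  refine (RunsWithin.forUp (T := d.n * 30 + 208) (fun r s' => s'.natVar vStrips ≤ r + 1 ∧
    ∃ birth, (sweepOf birth s').Inv d cl T vec (T.val 0 d.virtualTop d.virtualBottom i) (vec i) r)
    (by decide) R₁.n_eq rfl ?_ ?_).mono (le_of_eq (by ring)) ?_
  · refine ⟨by simp [hs₁], fun _ => 0, Sweep.Inv.init ok hiB hkind ?_ ?_ ?_ ?_ ?_⟩ <;>
      simp [hs₁, sweepOf, h.top_eq, h.bottom_eq, hi]
  · rintro r hr s₂ a₂ hv ⟨hle, birth, hI⟩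
    have R₂ := R₁.of_agree (a₂.mono (by decide))
    have hT₂ : tableOf Z s₂ = T := (a₂.mono (by decide)).tableOf_eq.trans hT₁
    rw [← hT₂] at hI hsol
    refine (tracePoint_runs R₂ ok hsol hvec hv hr hI).mono ?_ ?_
    · have : s₂.natVar vStrips * 30 ≤ d.n * 30 := Nat.mul_le_mul_right _ (by omega)
      omega
    · rintro s₃ ⟨hle', birth', hI'⟩
      rw [hT₂] at hI'
      refine ⟨?_, birth', ?_⟩
      · rw [Store.natVar_setNat_of_ne _ _ _ (by decide)]
        omega
      · convert hI' using 1
        simp [sweepOf]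
  · rintro s₂ ⟨a₂, -, hI⟩
    exact ⟨a₁.trans a₂, hI⟩

/-! ### The output -/

def copyLabels : Program :=
  .forUp lOut vLabels (.storeNat 0 (.var lOut) (.cell aLabelColor (.var lOut)) ;;
    .storeReal 0 (.var lOut) (.cell fHeight (.var lOut)))

theorem copyLabels_runs {m : ℕ} (hm : s.natVar vLabels = m) :
    RunsWithin copyLabels s (m * 18 + 6) fun s' =>
      (∀ l, l < m → s'.natArr 0 l = s.natArr aLabelColor l ∧
        s'.realArr 0 l = s.realArr fHeight l) ∧
      s'.natVar vn = s.natVar vn ∧ s'.natVar vLabels = m ∧ s'.natArr aPts = s.natArr aPts ∧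
      s'.natArr aAssign = s.natArr aAssign := by
  refine (RunsWithin.forUp_of_keeps (T := 10) (n := m) (fun i s' =>
    (∀ l, l < i → s'.natArr 0 l = s.natArr aLabelColor l ∧ s'.realArr 0 l = s.realArr fHeight l) ∧
      s'.natVar vn = s.natVar vn ∧ s'.natVar vLabels = m ∧ s'.natArr aPts = s.natArr aPts ∧
      s'.natArr aAssign = s.natArr aAssign ∧ s'.natArr aLabelColor = s.natArr aLabelColor ∧
      s'.realArr fHeight = s.realArr fHeight) (by simpa using hm) ?_ ?_).mono le_rfl ?_
  · refine ⟨fun l hl => absurd hl (by omega), by simp, by simpa using hm, ?_⟩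
    simp
  · rintro i hi s₁ hv hw ⟨h₁, h₂, h₃, h₄, h₅, h₆, h₇⟩
    refine .of_loopFree rfl (by decide) ⟨by simpa using hv, by simpa using hw, ?_, by simpa using h₂,
      by simpa using h₃, by simpa using h₄, by simpa using h₅, by simpa using h₆, by simpa using h₇⟩
    intro l hl
    by_cases he : l = i
    · subst he
      simp [hv, h₆, h₇]
    · have := h₁ l (by omega)
      simp [hv, he, this]
  · rintro s₁ ⟨h₁, h₂, h₃, h₄, h₅, -⟩
    exact ⟨h₁, h₂, h₃, h₄, h₅⟩

def copyAssign : Program :=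
  .forUp lOut vn (.storeNat 1 (.cell aPts (.var lOut)) (.cell aAssign (.var lOut)))

theorem copyAssign_runs {n : ℕ} (hn : s.natVar vn = n)
    (hinj : ∀ r, r < n → ∀ r', r' < n → s.natArr aPts r = s.natArr aPts r' → r = r') :
    RunsWithin copyAssign s (n * 18 + 6) fun s' =>
      (∀ r, r < n → s'.natArr 1 (s.natArr aPts r) = s.natArr aAssign r) ∧
      s'.natVar vLabels = s.natVar vLabels ∧ s'.natArr 0 = s.natArr 0 ∧
      s'.realArr 0 = s.realArr 0 := by
  refine (RunsWithin.forUp_of_keeps (T := 10) (n := n) (fun i s' =>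
    (∀ r, r < i → s'.natArr 1 (s.natArr aPts r) = s.natArr aAssign r) ∧
      s'.natVar vLabels = s.natVar vLabels ∧ s'.natArr 0 = s.natArr 0 ∧
      s'.realArr 0 = s.realArr 0 ∧ s'.natArr aPts = s.natArr aPts ∧
      s'.natArr aAssign = s.natArr aAssign) (by simpa using hn) ?_ ?_).mono le_rfl ?_
  · refine ⟨fun l hl => absurd hl (by omega), ?_⟩
    simp
  · rintro i hi s₁ hv hw ⟨h₁, h₂, h₃, h₄, h₅, h₆⟩
    refine .of_loopFree rfl (by decide) ⟨by simpa using hv, by simpa using hw, ?_, by simpa using h₂,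
      by simpa using h₃, by simpa using h₄, by simpa using h₅, by simpa using h₆⟩
    intro r hr
    by_cases he : r = i
    · subst he
      simp [hv, h₅, h₆]
    · have hne : s.natArr aPts r ≠ s.natArr aPts i := fun h' =>
        he (hinj r (by omega) i hi h')
      have := h₁ r (by omega)
      simp [hv, h₅, hne, this]
  · rintro s₁ ⟨h₁, h₂, h₃, h₄, -⟩
    exact ⟨h₁, h₂, h₃, h₄⟩

def output : Program :=
  .ite (.natEq (.var vFound) (.const 0)) (.setNat 0 (.const 0))
    (trace ;; copyLabels ;; copyAssign ;; (.setNat 1 (.var vLabels) ;; .setNat 0 (.const 1)))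

def solve (cl : Clearance) (obj : Objective) : Program :=
  setup cl obj ;; fillTable ;; bestBudget ;; output

/-- Feasibility with bounds `k` on the numbers of labels of the `D` classes of colors. -/
def ClassFeasible {n C : ℕ} (P : PointSet n C) (cl : Clearance) (Δ : ℝ) (D : ℕ) (γ k : ℕ → ℕ)
    (L : Labeling n C) : Prop :=
  L.Valid P cl Δ ∧ ∀ c, c < D → (Finset.univ.filter fun l => γ (L.color l) = c).card ≤ k c

theorem output_runs {n C : ℕ} {P : PointSet n C} {Δ : ℝ} {D : ℕ} {γ k : ℕ → ℕ} {obj : Objective}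
    {σ : Equiv.Perm (Fin n)} (hf : d.Fits P Δ obj γ σ) (hn : 0 < n) (hΔ : 0 < Δ)
    (hk : ∀ c, c < D → 0 < k c) (hD : d.D = D) (hdk : ∀ c, c < D → d.k c = k c)
    (h : Ready d Z s) (ok : d.Ok cl) (hT : tableOf Z s = T) (hsol : d.Solves T)
    (hpts : ∀ r : Fin n, s.natArr aPts r = σ r)
    (hnone : s.natVar vFound = 0 → ∀ i, i < d.B → T.kind 0 d.virtualTop d.virtualBottom i = 0)
    (hbest : s.natVar vFound ≠ 0 → s.natVar vBest < d.B ∧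
        T.kind 0 d.virtualTop d.virtualBottom (s.natVar vBest) ≠ 0 ∧
        ∀ i, i < d.B → T.kind 0 d.virtualTop d.virtualBottom i ≠ 0 →
          T.val 0 d.virtualTop d.virtualBottom (s.natVar vBest) ≤
            T.val 0 d.virtualTop d.virtualBottom i) :
    RunsWithin output s (n * (n * 30 + 216) + n * 36 + 70) fun s' =>
      IsMinimizationOutput (ClassFeasible P cl Δ D γ k) (fun L => L.totalLength P obj) s' := by
  have hfeas : ∀ L, ClassFeasible P cl Δ D γ k L ↔ Data.Fits.Feasible d P cl Δ γ L := by
    intro L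
    rw [ClassFeasible, Data.Fits.Feasible, hD]
    exact and_congr_right fun _ => forall₂_congr fun c hc => by rw [hdk c hc]
  have hk' : ∀ c, c < d.D → 0 < d.k c := fun c hc => by
    rw [hD] at hc
    rw [hdk c hc]
    exact hk c hc
  have hdn := hf.n_eq
  refine (RunsWithin.ite (T := (n * (n * 30 + 216) + 26) + ((n * 18 + 6) + ((n * 18 + 6) + 10)))
    ?_ ?_).mono_time ?_
  · intro hc
    have hc : s.natVar vFound = 0 := by simpa using hc
    refine (RunsWithin.of_loopFree (T := 2) rfl (by decide) (.inr ⟨by simp, fun L hL => ?_⟩)).mono_time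
      (by omega)
    obtain ⟨i, hi, hne, -⟩ := hf.exists_val_le ok hn hΔ hk' hsol ((hfeas L).1 hL)
    exact hne (hnone hc i hi)
  · intro hc
    have hc : s.natVar vFound ≠ 0 := by simpa using hc
    obtain ⟨hiB, hkind, hmin⟩ := hbest hc
    have hex : ∀ i, ∃ u : ℕ → ℕ, i < d.B → (∀ c, c < d.D → u c < d.k c) ∧ d.cd i = d.code u := by
      intro i
      by_cases hi : i < d.B
      · obtain ⟨u, hu⟩ := ok.cd_box i hi
        exact ⟨u, fun _ => hu⟩
      · exact ⟨fun _ => 0, fun h' => absurd h' hi⟩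
    choose vec hvec using hex
    refine .seq ((trace_runs h ok hT hsol hvec rfl hiB hkind).mono (le_of_eq (by rw [hdn])) ?_)
    rintro s₁ ⟨a₁, birth, hI⟩
    obtain ⟨L, e₁, e₂, e₃, e₄, hL, hopt⟩ := hf.exists_optimal ok hn hΔ hk' hsol hiB hvec hmin hI
    have hm : s₁.natVar vLabels = L.numLabels := e₁.symm
    have hmn : L.numLabels ≤ n := by
      simpa using Fintype.card_le_of_surjective _ L.assign_surj
    have R₁ := h.of_agree (a₁.mono (by decide))
    have hpts₁ : s₁.natArr aPts = s.natArr aPts := a₁.natArr _ (by decide)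
    refine .seq ((copyLabels_runs hm).mono (by omega) ?_)
    rintro s₂ ⟨c₁, c₂, c₃, c₄, c₅⟩
    have hn₂ : s₂.natVar vn = n := by rw [c₂, R₁.n_eq, hdn]
    refine .seq ((copyAssign_runs hn₂ ?_).mono le_rfl ?_)
    · intro r hr r' hr' he
      rw [c₄, hpts₁, hpts ⟨r, hr⟩, hpts ⟨r', hr'⟩] at he
      simpa using σ.injective (Fin.ext he)
    rintro s₃ ⟨f₁, f₂, f₃, f₄⟩
    refine .of_loopFree rfl (by decide) (.inl ⟨by simp, L, ⟨?_, ?_, ?_, ?_⟩, (hfeas L).2 hL, ?_⟩)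
    · simp [f₂, c₃]
    · intro l
      rw [e₂ l]
      simpa [f₃, sweepOf] using (c₁ l l.2).1
    · intro l
      rw [e₃ l]
      simpa [f₄, sweepOf] using (c₁ l l.2).2
    · intro p
      obtain ⟨q, rfl⟩ := σ.surjective p
      rw [e₄ q]
      have := f₁ q q.2
      rw [c₄, hpts₁, hpts q, c₅] at this
      simpa [sweepOf] using this
    · exact fun L' hL' => hopt L' ((hfeas L').1 hL')
  · have : Test.cost (.natEq (.var vFound) (.const 0)) ≤ 10 := by decide
    omega

/-- The program solves the problem for a point set in the store. -/
theorem solve_runs {n C : ℕ} {P : PointSet n C} {Δ : ℝ} {D : ℕ} {γ k : ℕ → ℕ} (obj : Objective)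
    (h : Holds P Δ D γ k s) (hn : 0 < n) (hΔ : 0 < Δ) (hk : ∀ c, c < D → 0 < k c)
    (hγ : ∀ c, c < C → γ c < D) (hDC : D ≤ C) :
    RunsWithin (solve cl obj) s (5000000 * timeOrder n C (boxCard k D)) fun s' =>
      IsMinimizationOutput (ClassFeasible P cl Δ D γ k) (fun L => L.totalLength P obj) s' := by
  set B := boxCard k D with hB
  have hBpos : 0 < B := boxCard_pos hk
  have hC : 0 < C := Fin.pos (P.color ⟨0, hn⟩)
  refine (RunsWithin.seq (T := 20000 * timeOrder n C B) (T' :=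
    1000 * (n * ((C * numCand n + 2) * (C * numCand n + 2) * numCand n * (B * B))) +
    ((B * 68 + 26) + (n * (n * 30 + 216) + n * 36 + 70))) ?_).mono_time ?_
  rotate_left
  · have hM := numCand_le hn
    have hN : C * numCand n + 2 ≤ 17 * (C * n ^ 2) := by
      have h1 : C * numCand n ≤ C * (15 * n ^ 2) := Nat.mul_le_mul_left _ hM
      have h2 : 0 < C * n ^ 2 := by positivity
      nlinarith
    have hmain : n * ((C * numCand n + 2) * (C * numCand n + 2) * numCand n * (B * B)) ≤
        4335 * timeOrder n C B := by
      calc n * ((C * numCand n + 2) * (C * numCand n + 2) * numCand n * (B * B))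
          ≤ n * (17 * (C * n ^ 2) * (17 * (C * n ^ 2)) * (15 * n ^ 2) * (B * B)) := by gcongr
        _ = 4335 * timeOrder n C B := by simp only [timeOrder]; ring
    have g0 := le_timeOrder (a := 0) (b := 0) (c := 0) hn hC hBpos (by simp) (by simp) (by simp)
    have g1 := le_timeOrder (a := 1) (b := 0) (c := 0) hn hC hBpos (by simp) (by simp) (by simp)
    have g2 := le_timeOrder (a := 2) (b := 0) (c := 0) hn hC hBpos (by simp) (by simp) (by simp)
    have g6 := le_timeOrder (a := 0) (b := 0) (c := 1) hn hC hBpos (by simp) (by simp) (by simp)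
    simp only [pow_zero, one_mul, mul_one, pow_one] at g0 g1 g2 g6
    have e : n * (n * 30 + 216) = 30 * n ^ 2 + 216 * n := by ring
    rw [e]
    linarith
  refine (setup_runs cl obj h hn hΔ hk hγ hDC).mono le_rfl ?_
  rintro s₁ ⟨-, σ, hpts, d, Z, R, ok, hf, hM, hdB, hD, hdk⟩
  refine .seq ((fillTable_runs ok R (by rw [hf.n_eq]; exact hn) ?_ ?_).mono ?_ ?_)
  · rw [hM, numCand]
    positivity
  · rw [hdB]
    exact hBpos
  · rw [hf.n_eq, hf.C_eq, hM, hdB]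
  rintro s₂ ⟨a₂, hsol⟩
  have R₂ := R.of_agree a₂
  refine .seq ((bestBudget_runs R₂ rfl).mono (by rw [hdB]) ?_)
  rintro s₃ ⟨a₃, hnone, hbest⟩
  refine output_runs hf hn hΔ hk hD hdk (R₂.of_agree (a₃.mono (by decide))) ok a₃.tableOf_eq hsol
    (fun r => ?_) hnone hbest
  rw [a₃.natArr _ (by decide), a₂.natArr _ (by decide)]
  exact hpts r

end BackboneLabeling

namespace BackboneLabeling

open Reg

variable {n C : ℕ} {P : PointSet n C} {Δ : ℝ} {cl : Clearance} {s s' : Store}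

/-! ### The two versions of the problem -/

theorem toArray_apply {α : Type} [Zero α] {m : ℕ} (f : Fin m → α) (i : Fin m) :
    toArray f (i : ℕ) = f i := by simp [toArray]

theorem holds_of_inputStore {K D : ℕ} {k : Fin C → ℕ} {γ k' : ℕ → ℕ}
    (h : AgreeBelow 5 (inputStore P Δ K k) s) (hD : s.natVar vD = D)
    (hγ : ∀ c, c < C → s.natArr aClass c = γ c) (hk : ∀ c, c < D → s.natArr aK c = k' c) :
    Holds P Δ D γ k' s where
  n_eq := (h.natVar _ (by decide)).trans rfl
  C_eq := (h.natVar _ (by decide)).trans rfl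
  Δ_eq := (h.realVar _ (by decide)).trans rfl
  right_eq := (h.realVar _ (by decide)).trans rfl
  bottom_eq := (h.realVar _ (by decide)).trans rfl
  top_eq := (h.realVar _ (by decide)).trans rfl
  color_eq p := by
    rw [h.natArr _ (by decide)]
    exact toArray_apply (fun p => (P.color p : ℕ)) p
  x_eq p := by
    rw [h.realArr _ (by decide)]
    exact toArray_apply P.x p
  y_eq p := by
    rw [h.realArr _ (by decide)]
    exact toArray_apply P.y p
  D_eq := hD
  class_eq := hγ
  k_eq := hk

/-- All labels are counted together. -/
def prepareGlobal : Program := .storeNat aK (.const 0) (.var vK) ;; .setNat vD (.const 1)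

theorem prepareGlobal_runs (P : PointSet n C) (Δ : ℝ) (K : ℕ) (k : Fin C → ℕ) :
    RunsWithin prepareGlobal (inputStore P Δ K k) 10
      (Holds P Δ 1 (fun _ => 0) (fun _ => K)) := by
  refine .of_loopFree rfl (by decide) (holds_of_inputStore (K := K) (k := k)
    ((AgreeBelow.storeNat (by decide)).trans (.setNat (by decide))) (by simp [prepareGlobal]) ?_ ?_)
  · intro c _
    simp [prepareGlobal, inputStore, toArray]
  · intro c hc
    obtain rfl : c = 0 := by omega
    simp [prepareGlobal, inputStore, toArray]

/-- The labels of each color are counted separately. -/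
def prepareVector : Program :=
  .forUp 5 vC (.storeNat aClass (.var 5) (.var 5) ;; .storeNat aK (.var 5) (.cell aVector (.var 5)))
    ;; .setNat vD (.var vC)

theorem prepareVector_runs (P : PointSet n C) (Δ : ℝ) (K : ℕ) (k : Fin C → ℕ) :
    RunsWithin prepareVector (inputStore P Δ K k) (C * 18 + 10)
      (Holds P Δ C id (toArray k)) := by
  refine (RunsWithin.seq (T := C * 18 + 6) (T' := 2) ?_).mono_time (by omega)
  refine (RunsWithin.forUp (T := 10) (n := C) (fun i s' => ∀ c, c < i → s'.natArr aClass c = c ∧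
    s'.natArr aK c = toArray k c) (by decide) rfl rfl (fun c hc => absurd hc (by omega)) ?_).mono
    le_rfl ?_
  · intro i hi s₁ a₁ hv hI
    have hvec : s₁.natArr aVector = toArray k := (a₁.natArr _ (by decide)).trans rfl
    refine .of_loopFree rfl (by decide) fun c hc => ?_
    by_cases he : c = i
    · subst he
      simp [hv, hvec]
    · have := hI c (by omega)
      simp [hv, he, this]
  · rintro s₁ ⟨a₁, hI⟩
    have hC : s₁.natVar vC = C := (a₁.natVar _ (by decide)).trans rfl
    refine .of_loopFree rfl (by decide) (holds_of_inputStore (K := K) (k := k)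
      (a₁.trans (.setNat (by decide))) (by simp [hC]) ?_ ?_)
    · exact fun c hc => by simpa using (hI c hc).1
    · exact fun c hc => by simpa using (hI c hc).2

theorem classFeasible_global {K : ℕ} (L : Labeling n C) :
    ClassFeasible P cl Δ 1 (fun _ => 0) (fun _ => K) L ↔ L.FeasibleGlobal P cl Δ K := by
  simp [ClassFeasible, Labeling.FeasibleGlobal]

theorem classFeasible_vector {k : Fin C → ℕ} (L : Labeling n C) :
    ClassFeasible P cl Δ C id (toArray k) L ↔ L.FeasibleVector P cl Δ k := by
  refine and_congr_right fun _ => ⟨fun h c => ?_, fun h c hc => ?_⟩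
  · simpa [Labeling.numOfColor, toArray_apply, Fin.ext_iff] using h c c.2
  · have := h ⟨c, hc⟩
    rw [← toArray_apply k] at this
    simpa [Labeling.numOfColor, Fin.ext_iff] using this

theorem boxCard_toArray (k : Fin C → ℕ) : boxCard (toArray k) C = ∏ c, k c := by
  rw [boxCard, Finset.prod_range]
  exact Finset.prod_congr rfl fun c _ => toArray_apply k c

theorem exists_program_global (cl : Clearance) (obj : Objective) :
    ∃ (prog : Program) (A : ℕ), ∀ (n C K : ℕ) (P : PointSet n C) (Δ : ℝ), 0 < n → 0 < K → 0 < Δ →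
      ∃ (s : Store) (t : ℕ), Runs prog (inputStore P Δ K (fun _ => 0)) s t ∧
        t ≤ A * (n ^ 7 * C ^ 2 * K ^ 2) ∧
        IsMinimizationOutput (fun L => L.FeasibleGlobal P cl Δ K) (fun L => L.totalLength P obj)
          s := by
  refine ⟨prepareGlobal ;; solve cl obj, 5000010, fun n C K P Δ hn hK hΔ => ?_⟩
  have hC : 0 < C := Fin.pos (P.color ⟨0, hn⟩)
  have hbox : boxCard (fun _ => K) 1 = K := by simp [boxCard]
  have ht := le_timeOrder (a := 0) (b := 0) (c := 0) hn hC hK (by simp) (by simp) (by simp)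
  have hrun : RunsWithin (prepareGlobal ;; solve cl obj) (inputStore P Δ K (fun _ => 0))
      (10 + 5000000 * timeOrder n C K) _ :=
    .seq ((prepareGlobal_runs P Δ K _).mono le_rfl fun s h =>
      hbox ▸ solve_runs (cl := cl) obj h hn hΔ (fun _ _ => hK) (fun _ _ => one_pos) hC)
  obtain ⟨s, t, hr, hle, hout⟩ := hrun
  refine ⟨s, t, hr, ?_, ?_⟩
  · simp only [pow_zero, mul_one] at ht
    exact hle.trans (by rw [← timeOrder]; linarith)
  · simpa only [IsMinimizationOutput, classFeasible_global] using hout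

theorem exists_program_vector (cl : Clearance) (obj : Objective) :
    ∃ (prog : Program) (A : ℕ), ∀ (n C : ℕ) (k : Fin C → ℕ) (P : PointSet n C) (Δ : ℝ), 0 < n →
      (∀ c, 0 < k c) → 0 < Δ →
      ∃ (s : Store) (t : ℕ), Runs prog (inputStore P Δ 0 k) s t ∧
        t ≤ A * (n ^ 7 * C ^ 2 * (∏ c, k c) ^ 2) ∧
        IsMinimizationOutput (fun L => L.FeasibleVector P cl Δ k) (fun L => L.totalLength P obj)
          s := by
  refine ⟨prepareVector ;; solve cl obj, 5000028, fun n C k P Δ hn hk hΔ => ?_⟩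
  have hC : 0 < C := Fin.pos (P.color ⟨0, hn⟩)
  have hpos : 0 < ∏ c, k c := Finset.prod_pos fun c _ => hk c
  have h0 := le_timeOrder (a := 0) (b := 0) (c := 0) hn hC hpos (by simp) (by simp) (by simp)
  have h1 := le_timeOrder (a := 0) (b := 1) (c := 0) hn hC hpos (by simp) (by simp) (by simp)
  have hk' : ∀ c, c < C → 0 < toArray k c := fun c hc =>
    (toArray_apply k ⟨c, hc⟩).symm ▸ hk ⟨c, hc⟩
  have hrun : RunsWithin (prepareVector ;; solve cl obj) (inputStore P Δ 0 k)
      (C * 18 + 10 + 5000000 * timeOrder n C (∏ c, k c)) _ :=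
    .seq ((prepareVector_runs P Δ 0 k).mono le_rfl fun s h =>
      boxCard_toArray k ▸ solve_runs (cl := cl) obj h hn hΔ hk' (fun _ h => h) le_rfl)
  obtain ⟨s, t, hr, hle, hout⟩ := hrun
  refine ⟨s, t, hr, ?_, ?_⟩
  · simp only [pow_zero, mul_one, one_mul, pow_one] at h0 h1
    exact hle.trans (by rw [← timeOrder]; linarith)
  · simpa only [IsMinimizationOutput, classFeasible_vector] using hout

end BackboneLabeling

theorem mainTheorem5 (cl : BackboneLabeling.Clearance) (obj : BackboneLabeling.Objective) :
    (∃ (prog : BackboneLabeling.Program) (A : ℕ),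
      ∀ (n C K : ℕ) (P : BackboneLabeling.PointSet n C) (Δ : ℝ), 0 < n → 0 < K → 0 < Δ →
        ∃ (s : BackboneLabeling.Store) (t : ℕ),
          BackboneLabeling.Runs prog
            (BackboneLabeling.inputStore P Δ K (fun _ => 0)) s t ∧
          t ≤ A * (n ^ 7 * C ^ 2 * K ^ 2) ∧
          BackboneLabeling.IsMinimizationOutput
            (fun L => L.FeasibleGlobal P cl Δ K) (fun L => L.totalLength P obj) s) ∧
    (∃ (prog : BackboneLabeling.Program) (A : ℕ),
      ∀ (n C : ℕ) (k : Fin C → ℕ) (P : BackboneLabeling.PointSet n C) (Δ : ℝ),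
        0 < n → (∀ c, 0 < k c) → 0 < Δ →
        ∃ (s : BackboneLabeling.Store) (t : ℕ),
          BackboneLabeling.Runs prog
            (BackboneLabeling.inputStore P Δ 0 k) s t ∧
          t ≤ A * (n ^ 7 * C ^ 2 * (∏ c, k c) ^ 2) ∧
          BackboneLabeling.IsMinimizationOutput
            (fun L => L.FeasibleVector P cl Δ k) (fun L => L.totalLength P obj) s) :=
  ⟨BackboneLabeling.exists_program_global cl obj, BackboneLabeling.exists_program_vector cl obj⟩
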